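/- Let $n\ge 1$, let $M$ and $N$ be oriented Riemannian orbifolds of dimensions $n+1$ and $n$, with $N$ connected, and let $f:M\to N$ be an $\mathbb S^1$-principal orbifold bundle such that $\mathbb S^1$ acts on $M$ by isometries and $f$ is a Riemannian submersion. Let a spin structure $P_{\mathrm{Spin}}(M)\to P_{\mathrm{SO}}(M)$ be given which is nonprojectable, i.e. the action of $\mathbb S^1$ on $P_{\mathrm{SO}}(M)$ by differentials does not lift to an $\mathbb S^1$-action on $P_{\mathrm{Spin}}(M)$ by bundle automorphisms. Then the double cover $\mathbb S^1\to\mathbb S^1$, $z\mapsto z^2$, acts on $P_{\mathrm{Spin}}(M)$: there is a continuous action $\kappa$ of $\mathbb S^1$ on $P_{\mathrm{Spin}}(M)$ by automorphisms of the $\mathrm{Spin}(n+1)$-bundle such that $\kappa_z$ covers the action of $z^2$ on $P_{\mathrm{SO}}(M)$; moreover $\kappa_{-1}$ is the action of $-1\in\mathrm{Spin}(n+1)$. Let $P\subset P_{\mathrm{Spin}}(M)$ be the preimage of the set of positively oriented orthonormal frames $(e_0,e_1,\dots,e_n)$ of $M$ such that $e_0$ is vertical and $(df(e_1),\dots,df(e_n))$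 is a positively oriented frame of $N$. Then $\kappa$ and the action of $\mathrm{Spin}(n)\subset\mathrm{Spin}(n+1)$ define an action of $\mathrm{Spin}^{\mathbb C}(n)=\mathrm{Spin}(n)\times_{\mathbb Z_2}\mathbb S^1$ on $P$ by $p\cdot[s,z]=\kappa_z(p\cdot s)$, and with this action and the map $P\to P_{\mathrm{SO}}(N)$ induced by $df$, $P$ is a $\mathrm{spin}^{\mathbb C}$ structure on $N$, i.e. an orbifold principal $\mathrm{Spin}^{\mathbb C}(n)$-bundle over $N$ with an equivariant bundle map to $P_{\mathrm{SO}}(N)$. -/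

import Mathlib

open scoped Manifold ContDiff Topology

universe u v w

noncomputable section

/-! ### The groups `Spin(n)` and `Spin^c(n)` -/

/-- The negative definite quadratic form `-|x|^2` on `ℝⁿ`. -/
def negSumSq (n : ℕ) : QuadraticForm ℝ (Fin n → ℝ) :=
  QuadraticMap.weightedSumSquares ℝ (fun _ : Fin n => (-1 : ℝ))

/-- The Clifford algebra of `ℝⁿ`, with `v * v = -|v|^2`. -/
abbrev Cl (n : ℕ) : Type := CliffordAlgebra (negSumSq n)

/-- The generator of the Clifford algebra given by the `k`-th standard basis vector. -/
def clBasis (n : ℕ) (k : Fin n) : Cl n := CliffordAlgebra.ι (negSumSq n) (Pi.single k 1)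

/-- The group `Spin(n)` inside the Clifford algebra. -/
abbrev Spin (n : ℕ) : Type := ↥(spinGroup (negSumSq n))

/-- `Spin(n)` carries the subspace topology of the finite-dimensional real vector space `Cl n`,
whose canonical vector space topology is the module topology. -/
instance spinTopology (n : ℕ) : TopologicalSpace (Spin n) :=
  TopologicalSpace.induced (fun s : Spin n => (s : Cl n)) (moduleTopology ℝ (Cl n))

theorem exists_spin_conj {n : ℕ} (s : Spin n) (v : Fin n → ℝ) :
    ∃ x : Fin n → ℝ, CliffordAlgebra.ι (negSumSq n) x =
      (s : Cl n) * CliffordAlgebra.ι (negSumSq n) v * star (s : Cl n) := by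
  have h := spinGroup.conjAct_smul_ι_mem_range_ι (x := spinGroup.toUnits s) (by
    change (s : Cl n) ∈ spinGroup (negSumSq n); exact s.2) v
  obtain ⟨x, hx⟩ := h
  refine ⟨x, ?_⟩
  rw [hx, ConjAct.units_smul_def]
  rfl

/-- The vector `s v s⁻¹` for `s ∈ Spin(n)` and `v ∈ ℝⁿ`. -/
def spinConj {n : ℕ} (s : Spin n) (v : Fin n → ℝ) : Fin n → ℝ :=
  Classical.choose (exists_spin_conj s v)

/-- The matrix of the image of `s` under the double covering `Spin(n) → SO(n)`: its `l`-th column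
is `s e_l s⁻¹`. -/
def spinMatrix {n : ℕ} (s : Spin n) : Matrix (Fin n) (Fin n) ℝ :=
  fun k l => spinConj s (Pi.single l 1) k

/-- The isometric inclusion `ℝⁿ → ℝⁿ⁺¹`, `x ↦ (0, x)`. -/
def shiftIsometry (n : ℕ) : negSumSq n →qᵢ negSumSq (n + 1) where
  toFun x := Fin.cons 0 x
  map_add' x y := by
    ext k; refine Fin.cases ?_ (fun k => ?_) k <;> simp
  map_smul' c x := by
    ext k; refine Fin.cases ?_ (fun k => ?_) k <;> simp
  map_app' x := by
    simp [negSumSq, QuadraticMap.weightedSumSquares_apply, Fin.sum_univ_succ]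

theorem map_shift_mem_spin {n : ℕ} (s : Spin n) :
    CliffordAlgebra.map (shiftIsometry n) (s : Cl n) ∈ spinGroup (negSumSq (n + 1)) := by
  set F := CliffordAlgebra.map (shiftIsometry n) with hF
  have hstar : ∀ x : Cl n, F (star x) = star (F x) := by
    intro x
    induction x using CliffordAlgebra.induction with
    | algebraMap r => simp [CliffordAlgebra.star_def]
    | ι x => simp [CliffordAlgebra.star_def, hF]
    | mul a b ha hb => simp [ha, hb]
    | add a b ha hb => simp [ha, hb]
  refine ⟨⟨?_, ?_⟩, ?_⟩
  · obtain ⟨x, hx, hxs⟩ := s.2.1.1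
    refine ⟨Units.map (F : Cl n →* Cl (n + 1)) x, ?_, ?_⟩
    · have hle : lipschitzGroup (negSumSq n) ≤
          (lipschitzGroup (negSumSq (n + 1))).comap (Units.map (F : Cl n →* Cl (n + 1))) := by
        refine (Subgroup.closure_le _).2 ?_
        rintro y ⟨m, hm⟩
        refine Subgroup.subset_closure ⟨shiftIsometry n m, ?_⟩
        rw [← CliffordAlgebra.map_apply_ι, hm]
        rfl
      exact hle hx
    · rw [← hxs]
      rfl
  · rw [SetLike.mem_coe, Unitary.mem_iff, ← hstar, ← map_mul, ← map_mul, spinGroup.star_mul_self_of_mem s.2,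
      spinGroup.mul_star_self_of_mem s.2, map_one]
    exact ⟨rfl, rfl⟩
  · have he : ∀ x ∈ CliffordAlgebra.even (negSumSq n),
        F x ∈ CliffordAlgebra.even (negSumSq (n + 1)) := by
      intro x hx
      induction x, hx using CliffordAlgebra.even_induction with
      | algebraMap r => rw [AlgHom.commutes]; exact Subalgebra.algebraMap_mem _ r
      | add x y hx hy ihx ihy => rw [map_add]; exact Subalgebra.add_mem _ ihx ihy
      | ι_mul_ι_mul m₁ m₂ x hx ih =>
        rw [map_mul, map_mul, hF, CliffordAlgebra.map_apply_ι, CliffordAlgebra.map_apply_ι]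
        exact Subalgebra.mul_mem _ (CliffordAlgebra.ι_mul_ι_mem_evenOdd_zero _ _ _) ih
    exact he _ s.2.2

/-- The inclusion `Spin(n) → Spin(n+1)` as the elements built from the last `n` basis vectors. -/
def spinIncl {n : ℕ} (s : Spin n) : Spin (n + 1) :=
  ⟨CliffordAlgebra.map (shiftIsometry n) (s : Cl n), map_shift_mem_spin s⟩

theorem neg_one_mem_spin (n : ℕ) : (-1 : Cl (n + 1)) ∈ spinGroup (negSumSq (n + 1)) := by
  have hsq : clBasis (n + 1) 0 * clBasis (n + 1) 0 = -1 := by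
    have hQ : negSumSq (n + 1) (Pi.single 0 1) = -1 := by
      simp [negSumSq, QuadraticMap.weightedSumSquares_apply, Fin.sum_univ_succ]
    rw [clBasis, CliffordAlgebra.ι_sq_scalar, hQ, map_neg, map_one]
  refine ⟨⟨⟨-1, ?_, by simp⟩, by simp [Unitary.mem_iff]⟩, ?_⟩
  · let y : (Cl (n + 1))ˣ := ⟨clBasis (n + 1) 0, -clBasis (n + 1) 0,
      by rw [mul_neg, hsq, neg_neg], by rw [neg_mul, hsq, neg_neg]⟩
    have hy : y ∈ lipschitzGroup (negSumSq (n + 1)) := Subgroup.subset_closure ⟨_, rfl⟩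
    have hyy : y * y = -1 := Units.ext hsq
    rw [← hyy]
    exact mul_mem hy hy
  · exact Subalgebra.neg_mem _ (Subalgebra.one_mem _)

/-- The element `-1` of `Spin(n+1)`. -/
def spinNegOne (n : ℕ) : Spin (n + 1) := ⟨-1, neg_one_mem_spin n⟩

/-- The subgroup `{(1, 1), (-1, -1)}` of `Spin(n) × S¹`. -/
def spinCKernel (n : ℕ) : Subgroup (Spin n × Circle) where
  carrier := {p | ((p.1 : Cl n) = 1 ∧ (p.2 : ℂ) = 1) ∨ ((p.1 : Cl n) = -1 ∧ (p.2 : ℂ) = -1)}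
  one_mem' := by simp
  mul_mem' := by
    rintro a b (⟨h1, h2⟩ | ⟨h1, h2⟩) (⟨h3, h4⟩ | ⟨h3, h4⟩) 
    all_goals simp only [Prod.fst_mul, Prod.snd_mul, Submonoid.coe_mul, Circle.coe_mul,
      Set.mem_ofPred_eq, h1, h2, h3, h4]; simp
  inv_mem' := by
    rintro ⟨a, b⟩ (⟨h1, h2⟩ | ⟨h1, h2⟩)
    · left
      refine ⟨?_, by simpa using h2⟩
      change star (a : Cl n) = 1
      simp only at h1
      rw [h1, star_one]
    · right
      refine ⟨?_, ?_⟩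
      · change star (a : Cl n) = -1
        simp only at h1
        rw [h1, star_neg, star_one]
      · simp only at h2
        simp [h2]

instance spinCKernel_normal (n : ℕ) : (spinCKernel n).Normal where
  conj_mem := by
    rintro ⟨a, b⟩ h ⟨c, d⟩
    have hc : (c : Cl n) * ((c⁻¹ : Spin n) : Cl n) = 1 := by
      rw [← Submonoid.coe_mul, mul_inv_cancel, Submonoid.coe_one]
    rcases h with ⟨h1, h2⟩ | ⟨h1, h2⟩ <;> simp only at h1 h2
    · left
      simp [h1, h2, hc]
    · right
      simp [h1, h2, hc]

/-- `Spin^c(n) = Spin(n) ×_{ℤ/2} S¹`, with the quotient topology. -/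
abbrev SpinC (n : ℕ) : Type := (Spin n × Circle) ⧸ spinCKernel n

/-- The element `[s, z]` of `Spin^c(n)`. -/
def SpinC.mk {n : ℕ} (s : Spin n) (z : Circle) : SpinC n := QuotientGroup.mk (s, z)

theorem spinMatrix_congr {n : ℕ} (a b : Spin n × Circle)
    (h : QuotientGroup.leftRel (spinCKernel n) a b) : spinMatrix a.1 = spinMatrix b.1 := by
  have hab : (b.1 : Cl n) = a.1 ∨ (b.1 : Cl n) = -a.1 := by
    have hb : a.1 * (a⁻¹ * b).1 = b.1 := by simp
    rw [QuotientGroup.leftRel_apply] at h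
    rcases h with ⟨h1, -⟩ | ⟨h1, -⟩
    · left; rw [← hb, Submonoid.coe_mul, h1, mul_one]
    · right; rw [← hb, Submonoid.coe_mul, h1, mul_neg, mul_one]
  have hv : ∀ v, spinConj a.1 v = spinConj b.1 v := by
    intro v
    have hP : (fun x => CliffordAlgebra.ι (negSumSq n) x =
        (a.1 : Cl n) * CliffordAlgebra.ι (negSumSq n) v * star (a.1 : Cl n)) =
        (fun x => CliffordAlgebra.ι (negSumSq n) x =
        (b.1 : Cl n) * CliffordAlgebra.ι (negSumSq n) v * star (b.1 : Cl n)) := by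
      rcases hab with h | h <;> simp [h]
    unfold spinConj
    congr 1
  funext k l
  exact congrFun (hv _) k

/-- The matrix of the image of `[s, z]` under `Spin^c(n) → SO(n)`, `[s, z] ↦ λ(s)`. -/
def spinCMatrix {n : ℕ} (g : SpinC n) : Matrix (Fin n) (Fin n) ℝ :=
  Quotient.lift (fun a : Spin n × Circle => spinMatrix a.1) spinMatrix_congr g

/-! ### Oriented Riemannian manifolds and their frames -/

/-- `v` is a positively oriented basis with respect to the orientation `o`. -/
def IsPositiveBasis {n : ℕ} {V : Type*} [AddCommGroup V] [Module ℝ V]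
    (o : Orientation ℝ V (Fin n)) (v : Fin n → V) : Prop :=
  ∃ b : Module.Basis (Fin n) ℝ V, (∀ k, b k = v k) ∧ b.orientation = o

/-- An `n`-tuple of tangent vectors at one point of a manifold. -/
structure TangentTuple (n : ℕ) (X : Type u) [TopologicalSpace X]
    [ChartedSpace (EuclideanSpace ℝ (Fin n)) X] where
  pt : X
  vec : Fin n → TangentSpace (𝓡 n) pt

namespace TangentTuple

variable {n : ℕ} {X : Type u} [TopologicalSpace X] [ChartedSpace (EuclideanSpace ℝ (Fin n)) X]

/-- The `k`-th vector of a tuple, as a point of the tangent bundle. -/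
def tan (t : TangentTuple n X) (k : Fin n) : TangentBundle (𝓡 n) X := ⟨t.pt, t.vec k⟩

/-- Tuples are topologized as points of the `n`-fold fibre product of the tangent bundle. -/
instance [IsManifold (𝓡 n) ∞ X] : TopologicalSpace (TangentTuple n X) :=
  TopologicalSpace.induced (fun t => (t.pt, t.tan))
    (inferInstance : TopologicalSpace (X × (Fin n → TangentBundle (𝓡 n) X)))

end TangentTuple

/-- A smooth oriented `n`-manifold with a Riemannian metric. The metric is only required to be
continuous (limit metrics need not be smooth; smooth metrics are a special case). -/
structure ORManifold (n : ℕ) : Type (u + 1) where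
  carrier : Type u
  [top : TopologicalSpace carrier]
  [t2 : T2Space carrier]
  [secondCountable : SecondCountableTopology carrier]
  [charted : ChartedSpace (EuclideanSpace ℝ (Fin n)) carrier]
  [smooth : IsManifold (𝓡 n) ∞ carrier]
  metric : Bundle.ContinuousRiemannianMetric (EuclideanSpace ℝ (Fin n))
    (fun x : carrier => TangentSpace (𝓡 n) x)
  orientation : ∀ x : carrier, Orientation ℝ (TangentSpace (𝓡 n) x) (Fin n)
  /-- The orientation depends continuously on the point. -/
  orientation_open :
    IsOpen {t : TangentTuple n carrier | IsPositiveBasis (orientation t.pt) t.vec}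

namespace ORManifold

instance (n : ℕ) : CoeSort (ORManifold.{u} n) (Type u) := ⟨ORManifold.carrier⟩

attribute [instance] ORManifold.top ORManifold.t2 ORManifold.secondCountable
  ORManifold.charted ORManifold.smooth

variable {n m : ℕ}

/-- The scalar product of two tangent vectors. -/
def scal (X : ORManifold.{u} n) (x : X) (v w : TangentSpace (𝓡 n) x) : ℝ :=
  X.metric.inner x v w

/-- The total space `P_SO(X)` of the bundle of positively oriented orthonormal frames, a subspace
of the space of `n`-tuples of tangent vectors. -/
def SOFrame (X : ORManifold.{u} n) : Type u :=
  {t : TangentTuple n X // (∀ k l, X.scal t.pt (t.vec k) (t.vec l) = if k = l then 1 else 0) ∧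
    IsPositiveBasis (X.orientation t.pt) t.vec}

instance (X : ORManifold.{u} n) : TopologicalSpace X.SOFrame :=
  instTopologicalSpaceSubtype

namespace SOFrame

variable {X : ORManifold.{u} n} {Y : ORManifold.{v} n}

/-- The base point of a frame. -/
def pt (e : X.SOFrame) : X := e.1.pt

/-- The `k`-th vector of a frame. -/
def vec (e : X.SOFrame) (k : Fin n) : TangentSpace (𝓡 n) e.pt := e.1.vec k

/-- The `k`-th vector of a frame, as a point of the tangent bundle. -/
def tan (e : X.SOFrame) (k : Fin n) : TangentBundle (𝓡 n) X := e.1.tan k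

/-- `e'` is the image of the frame `e` under the differential of `φ`. -/
def IsImage (φ : X → Y) (e : X.SOFrame) (e' : Y.SOFrame) : Prop :=
  e'.pt = φ e.pt ∧ ∀ k, e'.tan k = tangentMap (𝓡 n) (𝓡 n) φ (e.tan k)

/-- `e' = e · A`, the right action of matrices on frames: `e'_l = ∑_k A_{kl} e_k`. -/
def IsRightMul (e : X.SOFrame) (A : Matrix (Fin n) (Fin n) ℝ) (e' : X.SOFrame) : Prop :=
  e'.pt = e.pt ∧ ∀ l, e'.tan l = ⟨e.pt, ∑ k, A k l • e.vec k⟩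

/-- For `f : B → X` from an `(n+1)`-manifold to an `n`-manifold: the first vector of the frame `e`
is vertical, and the differential of `f` maps the remaining vectors to the frame `ε` of `X`. -/
def IsAdaptedOver {B : ORManifold.{u} (n + 1)} {X : ORManifold.{v} n} (f : B → X)
    (e : B.SOFrame) (ε : X.SOFrame) : Prop :=
  ε.pt = f e.pt ∧ mfderiv (𝓡 (n + 1)) (𝓡 n) f e.pt (e.vec 0) = 0 ∧
    ∀ k : Fin n, ε.tan k = tangentMap (𝓡 (n + 1)) (𝓡 n) f (e.tan k.succ)

end SOFrame

/-- `h` is an orientation preserving isometric diffeomorphism between open subsets. -/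
structure IsLocalIsometry {X Y : ORManifold.{u} n} (h : OpenPartialHomeomorph X Y) : Prop where
  smooth : ContMDiffOn (𝓡 n) (𝓡 n) ∞ h h.source
  smooth_symm : ContMDiffOn (𝓡 n) (𝓡 n) ∞ h.symm h.target
  isometric : ∀ x ∈ h.source, ∀ v w : TangentSpace (𝓡 n) x,
    Y.scal (h x) (mfderiv (𝓡 n) (𝓡 n) h x v) (mfderiv (𝓡 n) (𝓡 n) h x w) = X.scal x v w
  oriented : ∀ x ∈ h.source, ∀ v : Fin n → TangentSpace (𝓡 n) x,
    IsPositiveBasis (X.orientation x) v →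
      IsPositiveBasis (Y.orientation (h x)) (fun k => mfderiv (𝓡 n) (𝓡 n) h x (v k))

end ORManifold

/-! ### Orbifolds -/

/-- An oriented Riemannian (effective) orbifold of dimension `n`, given by an atlas indexed by `ι`.
The `i`-th chart consists of a connected manifold `X i`, a finite group `Γ i` acting effectively on
it, and a map `q i` inducing a homeomorphism of `X i / Γ i` onto an open subset of the underlying
space. The changes of charts are orientation preserving isometries between open subsets of the
`X i` which commute with the maps `q i`; they contain the local groups, are closed under composition
and inversion, and connect any two points with the same image. -/
structure Orbifold (ι : Type w) (n : ℕ) : Type (max w (u + 1)) where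
  space : Type u
  [top : TopologicalSpace space]
  [t2 : T2Space space]
  [secondCountable : SecondCountableTopology space]
  X : ι → ORManifold.{u} n
  X_connected : ∀ i, ConnectedSpace (X i)
  Γ : ∀ i, Subgroup (X i ≃ₜ X i)
  Γ_finite : ∀ i, Finite (Γ i)
  q : ∀ i, X i → space
  q_continuous : ∀ i, Continuous (q i)
  q_open : ∀ i, IsOpenMap (q i)
  q_fiber : ∀ i (x y : X i), q i x = q i y ↔ ∃ γ ∈ Γ i, γ x = y
  q_cover : ∀ p : space, ∃ i, ∃ x : X i, q i x = p
  trans : ∀ i j, Set (OpenPartialHomeomorph (X i) (X j))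
  trans_isometry : ∀ i j, ∀ h ∈ trans i j, ORManifold.IsLocalIsometry h
  trans_q : ∀ i j, ∀ h ∈ trans i j, ∀ x ∈ h.source, q j (h x) = q i x
  trans_group : ∀ i, ∀ γ ∈ Γ i, γ.toOpenPartialHomeomorph ∈ trans i i
  trans_comp : ∀ i j k, ∀ h ∈ trans i j, ∀ h' ∈ trans j k, h.trans h' ∈ trans i k
  trans_symm : ∀ i j, ∀ h ∈ trans i j, h.symm ∈ trans j i
  trans_exists : ∀ i j (x : X i) (y : X j), q i x = q j y →
    ∃ h ∈ trans i j, x ∈ h.source ∧ h x = y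

attribute [instance] Orbifold.top Orbifold.t2 Orbifold.secondCountable

/-! ### Principal bundles, spin and spin^c structures on orbifolds -/

/-- `P → X` with the right action `act` is a (locally trivial) principal `G`-bundle. -/
structure IsPrincipalBundle {G P X : Type*} [Group G] [TopologicalSpace G] [TopologicalSpace P]
    [TopologicalSpace X] (proj : P → X) (act : P → G → P) : Prop where
  continuous_proj : Continuous proj
  continuous_act : Continuous (fun p : P × G => act p.1 p.2)
  act_one : ∀ p, act p 1 = p
  act_mul : ∀ p g g', act p (g * g') = act (act p g) g'
  proj_act : ∀ p g, proj (act p g) = proj p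
  locally_trivial : ∀ x : X, ∃ U : Set X, IsOpen U ∧ x ∈ U ∧ ∃ Ψ : (U × G) ≃ₜ (proj ⁻¹' U),
    ∀ (y : U) (g : G), proj (Ψ (y, g)) = y ∧
      ∀ g' : G, act (Ψ (y, g)) g' = Ψ (y, g * g')

/-- For a homomorphism `ρ` from a topological group `G` to `SO(n)` (given by its matrices), a
reduction of the oriented orthonormal frame bundle of the orbifold `O` along `ρ`: a principal
`G`-bundle on the orbifold with a `ρ`-equivariant bundle map to the frame bundle. As usual, a bundle
on an orbifold consists of a bundle `P i` over every chart together with lifts of the changes of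
charts to bundle maps, which are compatible with compositions and depend only on germs. In
particular the local groups act on the `P i`. -/
structure FrameLift {ι : Type w} {n : ℕ} (O : Orbifold.{u} ι n) (G : Type) [Group G]
    [TopologicalSpace G] (ρ : G → Matrix (Fin n) (Fin n) ℝ) where
  P : ι → Type v
  [topP : ∀ i, TopologicalSpace (P i)]
  /-- the map to the frame bundle -/
  frame : ∀ i, P i → (O.X i).SOFrame
  frame_continuous : ∀ i, Continuous (frame i)
  act : ∀ i, P i → G → P i
  principal : ∀ i, IsPrincipalBundle (fun p => (frame i p).pt) (act i)
  frame_act : ∀ i p g, (frame i p).IsRightMul (ρ g) (frame i (act i p g))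
  /-- the lift of a change of charts `h`; only its values over `h.source` are relevant -/
  lift : ∀ {i j}, OpenPartialHomeomorph (O.X i) (O.X j) → P i → P j
  lift_continuous : ∀ i j, ∀ h ∈ O.trans i j,
    ContinuousOn (lift h) {p | (frame i p).pt ∈ h.source}
  lift_frame : ∀ i j, ∀ h ∈ O.trans i j, ∀ p, (frame i p).pt ∈ h.source →
    (frame i p).IsImage h (frame j (lift h p))
  lift_act : ∀ i j, ∀ h ∈ O.trans i j, ∀ p, (frame i p).pt ∈ h.source →
    ∀ g, lift h (act i p g) = act j (lift h p) g
  lift_comp : ∀ i j k, ∀ h ∈ O.trans i j, ∀ h' ∈ O.trans j k, ∀ p,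
    (frame i p).pt ∈ (h.trans h').source → lift (h.trans h') p = lift h' (lift h p)
  lift_germ : ∀ i j, ∀ h ∈ O.trans i j, ∀ h' ∈ O.trans i j, ∀ p,
    (frame i p).pt ∈ h.source → (frame i p).pt ∈ h'.source →
    h =ᶠ[𝓝 (frame i p).pt] h' → lift h p = lift h' p

attribute [instance] FrameLift.topP

/-- A spin structure on an oriented Riemannian orbifold: a principal `Spin(n)`-bundle which is an
equivariant two-sheeted covering of the oriented orthonormal frame bundle. -/
structure SpinStructure {ι : Type w} {n : ℕ} (O : Orbifold.{u} ι n) extends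
    FrameLift.{u, v, w} O (Spin n) spinMatrix where
  covering : ∀ i, IsCoveringMap (frame i)
  two_sheeted : ∀ i (e : (O.X i).SOFrame), (frame i ⁻¹' {e}).ncard = 2

/-- A spin^c structure on an oriented Riemannian orbifold: a principal `Spin^c(n)`-bundle with an
equivariant bundle map to the oriented orthonormal frame bundle. -/
abbrev SpinCStructure {ι : Type w} {n : ℕ} (O : Orbifold.{u} ι n) :=
  FrameLift.{u, v, w} O (SpinC n) spinCMatrix

/-! ### Principal circle bundles over orbifolds -/

/-- `k` is a circle-equivariant map covering `h`, defined over the whole domain of `h`. -/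
structure CoversEquivariantly {B X B' X' : Type*} [TopologicalSpace B] [TopologicalSpace X]
    [TopologicalSpace B'] [TopologicalSpace X'] (proj : B → X) (proj' : B' → X')
    (rot : Circle → B → B) (rot' : Circle → B' → B')
    (k : OpenPartialHomeomorph B B') (h : OpenPartialHomeomorph X X') : Prop where
  source_eq : k.source = proj ⁻¹' h.source
  covers : ∀ b ∈ k.source, proj' (k b) = h (proj b)
  equivariant : ∀ b ∈ k.source, ∀ z, k (rot z b) = rot' z (k b)

/-- An `S¹`-principal orbifold bundle `f : M → N` of oriented Riemannian orbifolds, on which `S¹`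
acts by isometries and such that `f` is a Riemannian submersion. Over every chart `N.X i` there is a
smooth principal circle bundle `M.X i`, and the `M.X i` are the charts of the total space `M`; every
change of charts of `N` has a unique lift to a bundle map, and these lifts are the changes of charts
of `M`. No relation between the orientations of `M` and `N` is prescribed. -/
structure CircleOrbibundle {ι : Type w} {n : ℕ} (M : Orbifold.{u} ι (n + 1))
    (N : Orbifold.{u} ι n) where
  f : M.space → N.space
  f_continuous : Continuous f
  proj : ∀ i, M.X i → N.X i
  proj_smooth : ∀ i, ContMDiff (𝓡 (n + 1)) (𝓡 n) ∞ (proj i)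
  f_q : ∀ i b, f (M.q i b) = N.q i (proj i b)
  /-- the circle action on the charts of `M` -/
  rot : ∀ i, Circle → M.X i → M.X i
  rot_smooth : ∀ i, ContMDiff ((𝓡 1).prod (𝓡 (n + 1))) (𝓡 (n + 1)) ∞
    (fun p : Circle × M.X i => rot i p.1 p.2)
  rot_one : ∀ i b, rot i 1 b = b
  rot_mul : ∀ i z z' b, rot i (z * z') b = rot i z (rot i z' b)
  locally_trivial : ∀ i (x : N.X i), ∃ U : Set (N.X i), IsOpen U ∧ x ∈ U ∧
    ∃ Ψ : OpenPartialHomeomorph (N.X i × Circle) (M.X i),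
      Ψ.source = U ×ˢ Set.univ ∧ Ψ.target = proj i ⁻¹' U ∧
      ContMDiffOn ((𝓡 n).prod (𝓡 1)) (𝓡 (n + 1)) ∞ Ψ Ψ.source ∧
      ContMDiffOn (𝓡 (n + 1)) ((𝓡 n).prod (𝓡 1)) ∞ Ψ.symm Ψ.target ∧
      ∀ y ∈ U, ∀ z : Circle, proj i (Ψ (y, z)) = y ∧
        ∀ z' : Circle, rot i z' (Ψ (y, z)) = Ψ (y, z' * z)
  rot_isometric : ∀ i z (b : M.X i) (v w : TangentSpace (𝓡 (n + 1)) b),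
    (M.X i).scal (rot i z b) (mfderiv (𝓡 (n + 1)) (𝓡 (n + 1)) (rot i z) b v)
      (mfderiv (𝓡 (n + 1)) (𝓡 (n + 1)) (rot i z) b w) = (M.X i).scal b v w
  /-- the differential of the projection is isometric on vectors orthogonal to the fibres -/
  submersion : ∀ i (b : M.X i) (v w : TangentSpace (𝓡 (n + 1)) b),
    (∀ y : TangentSpace (𝓡 (n + 1)) b, mfderiv (𝓡 (n + 1)) (𝓡 n) (proj i) b y = 0 →
      (M.X i).scal b v y = 0 ∧ (M.X i).scal b w y = 0) →
    (N.X i).scal (proj i b) (mfderiv (𝓡 (n + 1)) (𝓡 n) (proj i) b v)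
      (mfderiv (𝓡 (n + 1)) (𝓡 n) (proj i) b w) = (M.X i).scal b v w
  trans_lift : ∀ i j, ∀ h ∈ N.trans i j, ∃ k ∈ M.trans i j,
    CoversEquivariantly (proj i) (proj j) (rot i) (rot j) k h
  trans_descend : ∀ i j, ∀ k ∈ M.trans i j, ∃ h ∈ N.trans i j,
    CoversEquivariantly (proj i) (proj j) (rot i) (rot j) k h
  trans_unique : ∀ i j, ∀ h ∈ N.trans i j, ∀ h' ∈ N.trans i j, ∀ k ∈ M.trans i j,
    ∀ k' ∈ M.trans i j, CoversEquivariantly (proj i) (proj j) (rot i) (rot j) k h →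
    CoversEquivariantly (proj i) (proj j) (rot i) (rot j) k' h' →
    ∀ b, proj i b ∈ h.source → proj i b ∈ h'.source → h =ᶠ[𝓝 (proj i b)] h' → k b = k' b

namespace CircleOrbibundle

variable {ι : Type w} {n : ℕ} {M : Orbifold.{u} ι (n + 1)} {N : Orbifold.{u} ι n}

/-- An action of the `d`-fold covering `S¹ → S¹`, `z ↦ z ^ d`, of the circle on the spin frame
bundle of `M` by automorphisms of the `Spin(n+1)`-bundle, which lifts the action of the circle on
the frame bundle of `M` by differentials. For `d = 1` this is a lift of the `S¹`-action to the spin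
structure, for `d = 2` it is an action of the double covering of `S¹`. An action on the spin frame
bundle of the orbifold is an action on the bundles over all charts which commutes with the changes
of charts. -/
structure CoverAction (E : CircleOrbibundle M N) (S : SpinStructure.{u, v, w} M) (d : ℕ) where
  κ : ∀ i, Circle → S.P i → S.P i
  continuous_κ : ∀ i, Continuous (fun p : Circle × S.P i => κ i p.1 p.2)
  κ_one : ∀ i p, κ i 1 p = p
  κ_mul : ∀ i z z' p, κ i (z * z') p = κ i z (κ i z' p)
  κ_frame : ∀ i z p, (S.frame i p).IsImage (E.rot i (z ^ d)) (S.frame i (κ i z p))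
  κ_act : ∀ i z p s, κ i z (S.act i p s) = S.act i (κ i z p) s
  κ_lift : ∀ i j, ∀ k ∈ M.trans i j, ∀ p, (S.frame i p).pt ∈ k.source →
    ∀ z, κ j z (S.lift k p) = S.lift k (κ i z p)

/-- The spin structure on `M` is projectable if the circle action lifts to it. -/
def IsProjectable (E : CircleOrbibundle M N) (S : SpinStructure.{u, v, w} M) : Prop :=
  Nonempty (E.CoverAction S 1)

/-- The preimage in the spin frame bundle of `M` of the adapted frames, i.e. of those positively
oriented orthonormal frames whose first vector is vertical and whose remaining vectors project to a
positively oriented frame of `N`. (As `M` and `N` are oriented, the last condition chooses one of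
the two directions of the first vector.) -/
def adapted (E : CircleOrbibundle M N) (S : SpinStructure.{u, v, w} M) (i : ι) : Set (S.P i) :=
  {p | ∃ ε, ORManifold.SOFrame.IsAdaptedOver (E.proj i) (S.frame i p) ε}

/-- The spin^c structure `T` on `N` is the one defined by the action `a` of the double covering of
the circle together with the action of `Spin(n)` on the adapted part `P` of the spin frame bundle of
`M`: the maps `Φ i` identify the total spaces of `T` with the spaces `P`, such that the action of
`[s, z] ∈ Spin^c(n)` is `p ↦ κ_z (p · s)`, the map to the frame bundle of `N` is induced by `f`, and
the changes of charts of `N` act through their lifts to `M`. -/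
structure Induces (E : CircleOrbibundle M N) (S : SpinStructure.{u, v, w} M)
    (a : E.CoverAction S 2) (T : SpinCStructure.{u, v, w} N)
    (Φ : ∀ i, T.P i → S.P i) : Prop where
  embedding : ∀ i, Topology.IsEmbedding (Φ i)
  range_eq : ∀ i, Set.range (Φ i) = E.adapted S i
  frame_eq : ∀ i p, ORManifold.SOFrame.IsAdaptedOver (E.proj i) (S.frame i (Φ i p)) (T.frame i p)
  act_eq : ∀ i p s z, Φ i (T.act i p (SpinC.mk s z)) = a.κ i z (S.act i (Φ i p) (spinIncl s))
  lift_eq : ∀ i j, ∀ h ∈ N.trans i j, ∀ k ∈ M.trans i j,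
    CoversEquivariantly (E.proj i) (E.proj j) (E.rot i) (E.rot j) k h →
    ∀ p, (T.frame i p).pt ∈ h.source → Φ j (T.lift h p) = S.lift k (Φ i p)

end CircleOrbibundle

end

noncomputable section

/-! ### The Clifford algebra and the spin group -/

/-! Over each chart, spin frames form a two-sheeted covering of the oriented orthonormal frames of
M, and the circle acts on these frames by differentials: isometry preserves orthonormality,
connectedness of the circle preserves orientation (`isSO_map_rot`). Lifting the paths t ↦ exp(it)·e
gives a flow of ℝ on spin frames (`flow`). Uniqueness of lifts (`eq_of_lifts`) makes it a
one-parameter group commuting with Spin(n+1) and with the changes of charts. At time 2π it covers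
the identity, so a spin frame p returns to p or to p·(-1). This alternative is locally constant,
constant on the fibres of the spin bundle and preserved by changes of charts, hence the same
everywhere because N is connected (`flow_two_pi_global`). If p always returned to p, the flow would
be a lift of the circle action, against nonprojectability. So the flow has period 4π, κ_z is the
flow at time 2 arg z, and κ_{-1}, the flow at time 2π, is -1 (`exists_coverAction_two`).

Since κ commutes with Spin(n), the group Spin(n) × S¹ acts on the adapted spin frames, and κ_{-1} =
-1 says that (-1,-1) acts trivially. Nothing more is lost: base points determine z up to sign, and
then freeness of the spin bundle determines s (`pairAct_cancel`). For transitivity over a point of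
N, a square root of the angle between two base points brings them together. Two adapted frames at
one point of M differ by a matrix in SO(n), which lifts to Spin(n) by Cartan–Dieudonné
(`exists_spinMatrix_eq`); the remaining sign is absorbed by -1 ∈ Spin(n), where n ≥ 1 enters.

Local triviality follows from the criterion `IsPrincipalBundle.of_sections`: the translation
function is continuous (`continuousOn_divC`), and continuous local sections arise by tilting the
first vector of a local spin frame into the vertical direction (`exists_adapted_section`). A change
of charts of N acts through its lift to M and then through the lift of that to spin frames;
uniqueness on germs makes the choice of lift immaterial. -/

instance clTopology (n : ℕ) : TopologicalSpace (Cl n) := moduleTopology ℝ (Cl n)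

instance (n : ℕ) : IsModuleTopology ℝ (Cl n) := ⟨rfl⟩

theorem negSumSq_apply {n : ℕ} (v : Fin n → ℝ) : negSumSq n v = -∑ k, v k ^ 2 := by
  simp [negSumSq, QuadraticMap.weightedSumSquares_apply, pow_two]

theorem polar_negSumSq {n : ℕ} (v w : Fin n → ℝ) :
    QuadraticMap.polar (negSumSq n) v w = -2 * ∑ k, v k * w k := by
  simp only [QuadraticMap.polar, negSumSq_apply, Pi.add_apply, Finset.mul_sum,
    ← Finset.sum_neg_distrib, ← Finset.sum_sub_distrib]
  exact Finset.sum_congr rfl fun k _ => by ring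

theorem clBasis_mul_self {n : ℕ} (k : Fin n) : clBasis n k * clBasis n k = -1 := by
  rw [clBasis, CliffordAlgebra.ι_sq_scalar, negSumSq_apply]
  simp [Pi.single_apply]

theorem ι_shift_mul_clBasis_zero {n : ℕ} (v : Fin n → ℝ) :
    CliffordAlgebra.ι (negSumSq (n + 1)) (Fin.cons 0 v) * clBasis (n + 1) 0 =
      -(clBasis (n + 1) 0 * CliffordAlgebra.ι (negSumSq (n + 1)) (Fin.cons 0 v)) := by
  rw [eq_neg_iff_add_eq_zero, clBasis, CliffordAlgebra.ι_mul_ι_add_swap, polar_negSumSq]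
  simp [Fin.sum_univ_succ]

theorem cons_eq_smul_single_add {n : ℕ} (v : Fin (n + 1) → ℝ) :
    v = v 0 • Pi.single 0 1 + (Fin.cons 0 (Fin.tail v) : Fin (n + 1) → ℝ) := by
  ext k
  refine Fin.cases ?_ (fun k => ?_) k <;> simp [Fin.tail]

/-- Multiply by one vector at a time: its e₀-part is absorbed by e₀² = -1, and its remaining part
anticommutes with e₀, so e₀ can always be moved to the left. -/
theorem exists_eq_map_add_clBasis_mul_map {n : ℕ} (x : Cl (n + 1)) : ∃ a b : Cl n,
    x = CliffordAlgebra.map (shiftIsometry n) a +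
      clBasis (n + 1) 0 * CliffordAlgebra.map (shiftIsometry n) b := by
  induction x using CliffordAlgebra.left_induction with
  | algebraMap r => exact ⟨algebraMap ℝ _ r, 0, by simp⟩
  | add x y hx hy =>
    obtain ⟨a, b, rfl⟩ := hx
    obtain ⟨a', b', rfl⟩ := hy
    exact ⟨a + a', b + b', by simp only [map_add, mul_add]; abel⟩
  | ι_mul x m hx =>
    obtain ⟨a, b, rfl⟩ := hx
    have hm : CliffordAlgebra.ι (negSumSq (n + 1)) (Fin.cons 0 (Fin.tail m)) =
        CliffordAlgebra.map (shiftIsometry n) (CliffordAlgebra.ι _ (Fin.tail m)) := by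
      rw [CliffordAlgebra.map_apply_ι]; rfl
    have hι : CliffordAlgebra.ι (negSumSq (n + 1)) m = m 0 • clBasis (n + 1) 0 +
        CliffordAlgebra.map (shiftIsometry n) (CliffordAlgebra.ι _ (Fin.tail m)) := by
      conv_lhs => rw [cons_eq_smul_single_add m, map_add, map_smul, hm]
      rfl
    have hanti := ι_shift_mul_clBasis_zero (Fin.tail m)
    rw [hm] at hanti
    refine ⟨CliffordAlgebra.ι _ (Fin.tail m) * a - m 0 • b,
      m 0 • a - CliffordAlgebra.ι _ (Fin.tail m) * b, ?_⟩
    rw [hι, add_mul, mul_add, mul_add, ← mul_assoc _ _ (CliffordAlgebra.map _ b),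
      ← mul_assoc _ _ (CliffordAlgebra.map _ b), hanti, smul_mul_assoc, smul_mul_assoc,
      clBasis_mul_self]
    simp only [map_sub, map_mul, map_smul, smul_mul_assoc, mul_sub, neg_mul, mul_smul_comm, one_mul,
      smul_neg, mul_assoc]
    abel

/-- Finite dimension is what makes the module topology on `Cl n` a ring topology. -/
instance cl_finite : ∀ n : ℕ, Module.Finite ℝ (Cl n)
  | 0 => by
    refine Module.Finite.of_surjective (Algebra.linearMap ℝ (Cl 0)) fun x => ?_
    induction x using CliffordAlgebra.left_induction with
    | algebraMap r => exact ⟨r, rfl⟩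
    | add x y hx hy =>
      obtain ⟨a, rfl⟩ := hx
      obtain ⟨b, rfl⟩ := hy
      exact ⟨a + b, map_add _ _ _⟩
    | ι_mul x m hx => exact ⟨0, by rw [Subsingleton.elim m 0, map_zero, map_zero, zero_mul]⟩
  | n + 1 => by
    have := cl_finite n
    let F := (CliffordAlgebra.map (shiftIsometry n)).toLinearMap
    refine Module.Finite.of_surjective
      (F.coprod ((LinearMap.mulLeft ℝ (clBasis (n + 1) 0)).comp F)) fun x => ?_
    obtain ⟨a, b, rfl⟩ := exists_eq_map_add_clBasis_mul_map x
    exact ⟨(a, b), by simp [F]⟩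

instance (n : ℕ) : IsTopologicalRing (Cl n) := IsModuleTopology.isTopologicalRing ℝ (Cl n)

theorem isInducing_spin_coe (n : ℕ) : Topology.IsInducing (fun s : Spin n => (s : Cl n)) := ⟨rfl⟩

/-- Scalars embed in the Clifford algebra because 2 is invertible. This is what separates the two
sheets p and p·(-1). -/
theorem cl_one_ne_neg_one (n : ℕ) : (1 : Cl n) ≠ -1 := by
  let := invertibleOfNonzero (two_ne_zero (α := ℝ))
  intro h
  have h2 : algebraMap ℝ (Cl n) 2 = 0 := by
    rw [← one_add_one_eq_two, map_add, map_one]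
    exact eq_neg_iff_add_eq_zero.1 h
  exact two_ne_zero (((algebraMap ℝ (Cl n)).injective) (h2.trans (map_zero _).symm))

theorem continuous_cl_star (n : ℕ) : Continuous (star : Cl n → Cl n) := by
  have : (star : Cl n → Cl n) =
      (CliffordAlgebra.reverse.comp (CliffordAlgebra.involute (Q := negSumSq n)).toLinearMap :
        Cl n →ₗ[ℝ] Cl n) := by
    ext x; rfl
  rw [this]
  exact IsModuleTopology.continuous_of_linearMap _

instance (n : ℕ) : IsTopologicalGroup (Spin n) where
  continuous_mul := by
    rw [(isInducing_spin_coe n).continuous_iff]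
    exact ((isInducing_spin_coe n).continuous.comp continuous_fst).mul
      ((isInducing_spin_coe n).continuous.comp continuous_snd)
  continuous_inv := by
    rw [(isInducing_spin_coe n).continuous_iff]
    exact (continuous_cl_star n).comp (isInducing_spin_coe n).continuous

theorem ι_spinConj {n : ℕ} (s : Spin n) (v : Fin n → ℝ) :
    CliffordAlgebra.ι (negSumSq n) (spinConj s v) =
      (s : Cl n) * CliffordAlgebra.ι (negSumSq n) v * star (s : Cl n) :=
  Classical.choose_spec (exists_spin_conj s v)

/-- Definiteness of the form: a vector that vanishes in the algebra has square -|v|² = 0. -/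
theorem ι_negSumSq_injective (n : ℕ) : Function.Injective (CliffordAlgebra.ι (negSumSq n)) :=
  (injective_iff_map_eq_zero _).2 fun v hv => by
    let := invertibleOfNonzero (two_ne_zero (α := ℝ))
    have h := CliffordAlgebra.ι_sq_scalar (negSumSq n) v
    rw [hv, zero_mul, eq_comm, map_eq_zero_iff _ (algebraMap ℝ (Cl n)).injective, negSumSq_apply,
      neg_eq_zero, Finset.sum_eq_zero_iff_of_nonneg fun _ _ => sq_nonneg _] at h
    funext k
    exact pow_eq_zero_iff two_ne_zero |>.1 (h k (Finset.mem_univ k))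

/-- `spinConj` is obtained by choice, so its linearity has to be read off in the Clifford algebra,
through injectivity of `ι`. -/
theorem spinMatrix_mulVec {n : ℕ} (s : Spin n) (v : Fin n → ℝ) :
    (spinMatrix s).mulVec v = spinConj s v := by
  apply ι_negSumSq_injective
  have h : (spinMatrix s).mulVec v = ∑ l, v l • spinConj s (Pi.single l 1) := by
    ext k
    simp [Matrix.mulVec, dotProduct, spinMatrix, mul_comm]
  rw [h, ι_spinConj, map_sum]
  conv_rhs => rw [pi_eq_sum_univ' v]
  simp [ι_spinConj, Finset.mul_sum, Finset.sum_mul]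

theorem spinMatrix_eq_of_conj {n : ℕ} {s : Spin n} {B : Matrix (Fin n) (Fin n) ℝ}
    (h : ∀ v, (s : Cl n) * CliffordAlgebra.ι (negSumSq n) v * star (s : Cl n) =
      CliffordAlgebra.ι (negSumSq n) (B.mulVec v)) : spinMatrix s = B := by
  apply Matrix.mulVec_injective
  funext v
  apply ι_negSumSq_injective
  rw [spinMatrix_mulVec, ι_spinConj, h]

theorem spinMatrix_negOne (n : ℕ) : spinMatrix (spinNegOne n) = 1 := by
  apply spinMatrix_eq_of_conj
  simp [spinNegOne]

theorem spinNegOne_ne_one (n : ℕ) : spinNegOne n ≠ 1 := fun h =>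
  cl_one_ne_neg_one (n + 1) (congrArg Subtype.val h).symm

theorem spinNegOne_mul_self (n : ℕ) : spinNegOne n * spinNegOne n = 1 :=
  Subtype.ext (by simp [spinNegOne])

/-! ### The inclusion `Spin(n) → Spin(n+1)` -/

/-- The block matrix with blocks `1` and `B`. -/
def blockOne {n : ℕ} (B : Matrix (Fin n) (Fin n) ℝ) : Matrix (Fin (n + 1)) (Fin (n + 1)) ℝ :=
  fun k l => Fin.cases (Fin.cases 1 (fun _ => 0) l) (fun k => Fin.cases 0 (fun l => B k l) l) k

section blockOne

variable {n : ℕ} (B : Matrix (Fin n) (Fin n) ℝ)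

@[simp] theorem blockOne_zero_zero : blockOne B 0 0 = 1 := rfl
@[simp] theorem blockOne_zero_succ (l : Fin n) : blockOne B 0 l.succ = 0 := rfl
@[simp] theorem blockOne_succ_zero (k : Fin n) : blockOne B k.succ 0 = 0 := rfl
@[simp] theorem blockOne_succ_succ (k l : Fin n) : blockOne B k.succ l.succ = B k l := rfl

theorem det_blockOne : (blockOne B).det = B.det := by
  rw [Matrix.det_succ_row_zero, Fin.sum_univ_succ]
  simp
  rfl

theorem blockOne_mulVec_cons (a : ℝ) (v : Fin n → ℝ) :
    (blockOne B).mulVec (Fin.cons a v) = Fin.cons a (B.mulVec v) := by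
  ext k
  refine Fin.cases ?_ (fun k => ?_) k <;> simp [Matrix.mulVec, dotProduct, Fin.sum_univ_succ]

end blockOne

/-- Each vector of the shifted ℝⁿ contributes one sign when passing e₀, and an even product
contributes an even number of them. Hence Spin(n) fixes e₀. -/
theorem map_shift_even_comm {n : ℕ} {x : Cl n} (hx : x ∈ CliffordAlgebra.even (negSumSq n)) :
    CliffordAlgebra.map (shiftIsometry n) x * clBasis (n + 1) 0 =
      clBasis (n + 1) 0 * CliffordAlgebra.map (shiftIsometry n) x := by
  have hι : ∀ m : Fin n → ℝ,
      CliffordAlgebra.map (shiftIsometry n) (CliffordAlgebra.ι (negSumSq n) m) *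
        clBasis (n + 1) 0 = -(clBasis (n + 1) 0 *
          CliffordAlgebra.map (shiftIsometry n) (CliffordAlgebra.ι (negSumSq n) m)) := by
    intro m
    rw [CliffordAlgebra.map_apply_ι]
    exact ι_shift_mul_clBasis_zero m
  induction x, hx using CliffordAlgebra.even_induction with
  | algebraMap r => rw [AlgHom.commutes]; exact Algebra.commutes _ _
  | add x y hx hy ihx ihy => rw [map_add, add_mul, mul_add, ihx, ihy]
  | ι_mul_ι_mul m₁ m₂ x hx ih =>
    rw [map_mul, map_mul, mul_assoc, ih, ← mul_assoc, mul_assoc _ _ (clBasis (n + 1) 0), hι,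
      mul_neg, ← mul_assoc, hι]
    simp only [neg_mul, neg_neg, mul_assoc]

theorem map_shift_star {n : ℕ} (x : Cl n) : CliffordAlgebra.map (shiftIsometry n) (star x) =
    star (CliffordAlgebra.map (shiftIsometry n) x) := by
  induction x using CliffordAlgebra.induction with
  | algebraMap r => simp [CliffordAlgebra.star_def]
  | ι x => simp [CliffordAlgebra.star_def]
  | mul a b ha hb => simp [ha, hb]
  | add a b ha hb => simp [ha, hb]

theorem spin_mul_star {n : ℕ} (s : Spin n) : (s : Cl n) * star (s : Cl n) = 1 :=
  spinGroup.mul_star_self_of_mem s.2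

theorem spinMatrix_incl {n : ℕ} (s : Spin n) : spinMatrix (spinIncl s) = blockOne (spinMatrix s) := by
  apply spinMatrix_eq_of_conj
  intro v
  have hcons : ∀ w : Fin n → ℝ, CliffordAlgebra.ι (negSumSq (n + 1)) (Fin.cons 0 w) =
      CliffordAlgebra.map (shiftIsometry n) (CliffordAlgebra.ι _ w) := by
    intro w
    rw [CliffordAlgebra.map_apply_ι]; rfl
  have hι : ∀ (a : ℝ) (w : Fin n → ℝ), CliffordAlgebra.ι (negSumSq (n + 1)) (Fin.cons a w) =
      a • clBasis (n + 1) 0 + CliffordAlgebra.map (shiftIsometry n) (CliffordAlgebra.ι _ w) := by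
    intro a w
    conv_lhs => rw [cons_eq_smul_single_add (Fin.cons a w), map_add, map_smul, Fin.tail_cons, hcons]
    rfl
  obtain ⟨a, w, rfl⟩ : ∃ a w, v = Fin.cons a w := ⟨v 0, Fin.tail v, (Fin.cons_self_tail v).symm⟩
  rw [blockOne_mulVec_cons, hι, hι, spinMatrix_mulVec, ι_spinConj]
  simp only [spinIncl, ← map_shift_star, mul_add, add_mul, mul_smul_comm, smul_mul_assoc,
    map_shift_even_comm s.2.2, map_mul]
  rw [mul_assoc (clBasis (n + 1) 0), ← map_mul, spin_mul_star, map_one, mul_one]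

theorem spinIncl_mul {n : ℕ} (s t : Spin n) : spinIncl (s * t) = spinIncl s * spinIncl t :=
  Subtype.ext (by simp [spinIncl])

theorem spinIncl_one (n : ℕ) : spinIncl (1 : Spin n) = 1 := Subtype.ext (by simp [spinIncl])

/-- The representation of `Cl(n+1)` on `Cl(n)²` in which `(a, v) ∈ ℝⁿ⁺¹` acts by the matrix with
rows `(v, -a)` and `(a, -v)`. -/
def clMatrixRep (n : ℕ) : Cl (n + 1) →ₐ[ℝ] Matrix (Fin 2) (Fin 2) (Cl n) :=
  CliffordAlgebra.lift (negSumSq (n + 1)) ⟨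
    { toFun := fun v => !![CliffordAlgebra.ι _ (Fin.tail v), -algebraMap ℝ _ (v 0);
        algebraMap ℝ _ (v 0), -CliffordAlgebra.ι _ (Fin.tail v)]
      map_add' := fun v w => by
        have : Fin.tail (v + w) = Fin.tail v + Fin.tail w := rfl
        ext i j
        fin_cases i <;> fin_cases j <;> simp [this, add_comm]
      map_smul' := fun c v => by
        have : Fin.tail (c • v) = c • Fin.tail v := rfl
        rw [this]
        ext i j
        fin_cases i <;> fin_cases j <;> simp [Algebra.algebraMap_eq_smul_one, mul_smul] }, fun v => by
    have hQ : negSumSq (n + 1) v = negSumSq n (Fin.tail v) - v 0 * v 0 := by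
      simp only [negSumSq_apply, Fin.sum_univ_succ, Fin.tail]; ring
    have hc := Algebra.commutes (v 0) (CliffordAlgebra.ι (negSumSq n) (Fin.tail v))
    ext i j
    fin_cases i <;> fin_cases j <;>
      simp [Matrix.mul_apply, hQ, CliffordAlgebra.ι_sq_scalar, hc, Matrix.algebraMap_matrix_apply]
    all_goals abel⟩

/-- A linear left inverse of the inclusion `Cl(n) → Cl(n+1)`. -/
def clRestrict (n : ℕ) : Cl (n + 1) →ₗ[ℝ] Cl n :=
  (LinearMap.proj 0 ∘ₗ LinearMap.proj 0) ∘ₗ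
    (Matrix.ofLinearEquiv ℝ (m := Fin 2) (n := Fin 2) (α := Cl n)).symm.toLinearMap ∘ₗ (clMatrixRep n).toLinearMap

/-- The upper left entry recovers x. This gives injectivity of Cl(n) → Cl(n+1), and a linear left
inverse, without a basis of the Clifford algebra. -/
theorem clMatrixRep_map_shift {n : ℕ} (x : Cl n) :
    clMatrixRep n (CliffordAlgebra.map (shiftIsometry n) x) =
      !![x, 0; 0, CliffordAlgebra.involute x] := by
  induction x using CliffordAlgebra.induction with
  | algebraMap r =>
    rw [AlgHom.commutes, AlgHom.commutes]
    ext i j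
    fin_cases i <;> fin_cases j <;> simp [Matrix.algebraMap_matrix_apply]
  | ι x =>
    rw [CliffordAlgebra.map_apply_ι, clMatrixRep, CliffordAlgebra.lift_ι_apply]
    have h0 : shiftIsometry n x 0 = 0 := rfl
    have ht : Fin.tail (shiftIsometry n x) = x := rfl
    simp [h0, ht]
  | mul a b ha hb => rw [map_mul, map_mul, ha, hb]; simp
  | add a b ha hb => rw [map_add, map_add, ha, hb]; simp

theorem clRestrict_map_shift {n : ℕ} (x : Cl n) :
    clRestrict n (CliffordAlgebra.map (shiftIsometry n) x) = x := by
  change clMatrixRep n _ 0 0 = x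
  rw [clMatrixRep_map_shift]
  rfl

theorem spinIncl_injective (n : ℕ) : Function.Injective (spinIncl (n := n)) := fun s t h =>
  Subtype.ext (by
    have := congrArg (fun x : Spin (n + 1) => clRestrict n x) h
    simpa only [spinIncl, clRestrict_map_shift] using this)

/-- Linear maps are continuous for the module topologies, so the linear left inverse turns Cl(n) →
Cl(n+1) into an embedding, and this restricts to the spin groups. -/
theorem isInducing_spinIncl (n : ℕ) : Topology.IsInducing (spinIncl (n := n)) := by
  have hF : Continuous (CliffordAlgebra.map (shiftIsometry n)) :=
    IsModuleTopology.continuous_of_linearMap (R := ℝ) (CliffordAlgebra.map (shiftIsometry n)).toLinearMap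
  have hL : Continuous (clRestrict n) := IsModuleTopology.continuous_of_linearMap _
  have h1 : Topology.IsInducing (CliffordAlgebra.map (shiftIsometry n)) :=
    (Function.LeftInverse.isEmbedding (f := clRestrict n) clRestrict_map_shift hL hF).isInducing
  rw [← (isInducing_spin_coe (n + 1)).of_comp_iff]
  exact h1.comp (isInducing_spin_coe n)

/-! ### Elements of the spin group -/

theorem ι_mem_pinGroup {n : ℕ} {v : Fin n → ℝ} (hv : ∑ k, v k ^ 2 = 1) :
    CliffordAlgebra.ι (negSumSq n) v ∈ pinGroup (negSumSq n) := by
  have hsq : CliffordAlgebra.ι (negSumSq n) v * CliffordAlgebra.ι (negSumSq n) v = -1 := by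
    rw [CliffordAlgebra.ι_sq_scalar, negSumSq_apply, hv, map_neg, map_one]
  let y : (Cl n)ˣ := ⟨CliffordAlgebra.ι (negSumSq n) v, -CliffordAlgebra.ι (negSumSq n) v,
    by rw [mul_neg, hsq, neg_neg], by rw [neg_mul, hsq, neg_neg]⟩
  refine ⟨⟨y, Subgroup.subset_closure ⟨v, rfl⟩, rfl⟩, ?_⟩
  rw [SetLike.mem_coe, Unitary.mem_iff, CliffordAlgebra.star_ι, mul_neg, neg_mul, hsq, neg_neg]
  exact ⟨rfl, rfl⟩

/-- The right side is the reflection of v in the hyperplane orthogonal to m. As m⁻¹ = -m,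
conjugation by m is minus this reflection. -/
theorem ι_mul_ι_mul_ι_self {n : ℕ} {m : Fin n → ℝ} (hm : ∑ k, m k ^ 2 = 1) (v : Fin n → ℝ) :
    CliffordAlgebra.ι (negSumSq n) m * CliffordAlgebra.ι (negSumSq n) v *
      CliffordAlgebra.ι (negSumSq n) m =
    CliffordAlgebra.ι (negSumSq n) (v - (2 * ∑ k, m k * v k) • m) := by
  rw [CliffordAlgebra.ι_mul_ι_mul_ι, polar_negSumSq, negSumSq_apply, hm]
  congr 1
  module

/-- The unit vector bisecting the angle between `e₀` and the unit vector `c`. -/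
def bisector {n : ℕ} (c : Fin (n + 1) → ℝ) : Fin (n + 1) → ℝ :=
  (Real.sqrt (2 + 2 * c 0))⁻¹ • (c + Pi.single 0 1)

theorem bisector_sq {n : ℕ} {c : Fin (n + 1) → ℝ} (hc : ∑ k, c k ^ 2 = 1) (h0 : -1 < c 0) :
    ∑ k, bisector c k ^ 2 = 1 := by
  have hpos : 0 < 2 + 2 * c 0 := by linarith
  have hs : ∑ k, (c + Pi.single 0 1 : Fin (n + 1) → ℝ) k ^ 2 = 2 + 2 * c 0 := by
    rw [Fin.sum_univ_succ] at hc ⊢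
    simp only [Pi.add_apply, Pi.single_eq_same, ne_eq, Fin.succ_ne_zero, not_false_eq_true,
      Pi.single_eq_of_ne, add_zero]
    linarith
  simp only [bisector, Pi.smul_apply, smul_eq_mul, mul_pow, inv_pow, Real.sq_sqrt hpos.le]
  rw [← Finset.mul_sum, hs, inv_mul_cancel₀ hpos.ne']

theorem bisector_reflect {n : ℕ} {c : Fin (n + 1) → ℝ} (h0 : -1 < c 0) :
    (2 * bisector c 0) • bisector c - Pi.single 0 1 = c := by
  have hpos : 0 < 2 + 2 * c 0 := by linarith
  have h : 2 * bisector c 0 * (Real.sqrt (2 + 2 * c 0))⁻¹ = 1 := by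
    have h1 : (Real.sqrt (2 + 2 * c 0))⁻¹ * (Real.sqrt (2 + 2 * c 0))⁻¹ = (2 + 2 * c 0)⁻¹ := by
      rw [← mul_inv, Real.mul_self_sqrt hpos.le]
    have h2 : (2 + 2 * c 0)⁻¹ * (2 + 2 * c 0) = 1 := inv_mul_cancel₀ hpos.ne'
    simp only [bisector, Pi.smul_apply, Pi.add_apply, Pi.single_eq_same, smul_eq_mul]
    linear_combination (2 * (c 0 + 1)) * h1 + h2
  conv_lhs => rw [bisector.eq_1 c]
  rw [smul_smul]
  have hb : bisector c 0 = (Real.sqrt (2 + 2 * c 0))⁻¹ * (c 0 + 1) := by simp [bisector]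
  have : 2 * ((Real.sqrt (2 + 2 * c 0))⁻¹ • (c + Pi.single 0 1) : Fin (n + 1) → ℝ) 0 * (Real.sqrt (2 + 2 * c 0))⁻¹ = 1 := h
  rw [this, one_smul, add_sub_cancel_right]

/-- For a unit vector `c ≠ -e₀`, the element of `Spin(n+1)` which rotates `e₀` to `c` in the plane of
these two vectors. -/
def tilt {n : ℕ} (c : {c : Fin (n + 1) → ℝ // ∑ k, c k ^ 2 = 1 ∧ -1 < c 0}) : Spin (n + 1) :=
  ⟨CliffordAlgebra.ι (negSumSq (n + 1)) (bisector c.1) *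
    CliffordAlgebra.ι (negSumSq (n + 1)) (-Pi.single 0 1), by
    refine ⟨mul_mem (ι_mem_pinGroup (bisector_sq c.2.1 c.2.2)) (ι_mem_pinGroup ?_),
      CliffordAlgebra.ι_mul_ι_mem_evenOdd_zero _ _ _⟩
    simp [Pi.single_apply]⟩

/-- Conjugation by e₀ fixes e₀; conjugation by the bisector b is minus the reflection along b, which
sends e₀ to 2⟨b,e₀⟩b - e₀ = c. -/
theorem spinMatrix_tilt {n : ℕ} (c : {c : Fin (n + 1) → ℝ // ∑ k, c k ^ 2 = 1 ∧ -1 < c 0})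
    (k : Fin (n + 1)) : spinMatrix (tilt c) k 0 = c.1 k := by
  have h : spinConj (tilt c) (Pi.single 0 1) = c.1 := by
    apply ι_negSumSq_injective
    have h1 := clBasis_mul_self (0 : Fin (n + 1))
    rw [clBasis] at h1
    rw [ι_spinConj]
    change CliffordAlgebra.ι _ (bisector c.1) * CliffordAlgebra.ι _ (-Pi.single 0 1) * _ *
      star (CliffordAlgebra.ι _ (bisector c.1) * CliffordAlgebra.ι _ (-Pi.single 0 1)) = _
    rw [star_mul, CliffordAlgebra.star_ι, CliffordAlgebra.star_ι, map_neg, neg_neg,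
      mul_neg, mul_neg, neg_mul, neg_mul, mul_neg, neg_neg, mul_assoc _ (CliffordAlgebra.ι _ (Pi.single 0 1)),
      ← mul_assoc (CliffordAlgebra.ι _ (Pi.single 0 1)) (CliffordAlgebra.ι _ (Pi.single 0 1)),
      h1, neg_mul, one_mul, mul_neg,
      ι_mul_ι_mul_ι_self (bisector_sq c.2.1 c.2.2), ← map_neg, neg_sub]
    congr 1
    conv_rhs => rw [← bisector_reflect c.2.2]
    simp [Pi.single_apply]
  exact congrFun h k

theorem continuous_tilt (n : ℕ) : Continuous (tilt (n := n)) := by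
  rw [(isInducing_spin_coe (n + 1)).continuous_iff]
  have h1 : Continuous (CliffordAlgebra.ι (negSumSq (n + 1))) :=
    IsModuleTopology.continuous_of_linearMap _
  refine (h1.comp ?_).mul continuous_const
  have h0 : Continuous fun c : {c : Fin (n + 1) → ℝ // ∑ k, c k ^ 2 = 1 ∧ -1 < c 0} => c.1 0 :=
    (continuous_apply 0).comp continuous_subtype_val
  refine Continuous.smul (Continuous.inv₀ (Real.continuous_sqrt.comp
    (continuous_const.add (continuous_const.mul h0))) fun c => ?_)
    (continuous_subtype_val.add continuous_const)
  have hpos : 0 < 2 + 2 * c.1 0 := by linarith [c.2.2]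
  exact (Real.sqrt_pos.2 hpos).ne'

/-- The sign in the second factor of `tilt` is chosen for this: e₀·(-e₀) = 1, not -1. -/
theorem tilt_single {n : ℕ} (h) : tilt (n := n) ⟨Pi.single 0 1, h⟩ = 1 := by
  apply Subtype.ext
  have hb : bisector (Pi.single 0 1 : Fin (n + 1) → ℝ) = Pi.single 0 1 := by
    have : Real.sqrt 4 = 2 := by
      rw [show (4 : ℝ) = 2 ^ 2 by norm_num, Real.sqrt_sq (by norm_num)]
    ext k
    simp only [bisector, Pi.single_eq_same, Pi.smul_apply, Pi.add_apply, smul_eq_mul, mul_one]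
    norm_num [this]
    ring
  have h1 := clBasis_mul_self (0 : Fin (n + 1))
  rw [clBasis] at h1
  simp only [tilt, hb, map_neg, mul_neg, h1, neg_neg]
  rfl

/-- Up to sign, a product of reflections is the conjugation by an element of the pin group. -/
theorem exists_pin_of_reflections {n : ℕ} (l : List (EuclideanSpace ℝ (Fin n))) :
    ∃ x ∈ pinGroup (negSumSq n), ∃ (i : ZMod 2) (σ : ℝ), x ∈ CliffordAlgebra.evenOdd (negSumSq n) i ∧
      (i = 0 ∧ σ = 1 ∨ i = 1 ∧ σ = -1) ∧
      LinearMap.det ((l.map fun v => (ℝ ∙ v)ᗮ.reflection).prod.toLinearEquiv.toLinearMap) = σ ∧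
      ∀ v : EuclideanSpace ℝ (Fin n), σ • (x * CliffordAlgebra.ι (negSumSq n) v.ofLp * star x) =
        CliffordAlgebra.ι (negSumSq n)
          ((l.map fun v => (ℝ ∙ v)ᗮ.reflection).prod v).ofLp := by
  induction l with
  | nil =>
    refine ⟨1, one_mem _, 0, 1, (CliffordAlgebra.even (negSumSq n)).one_mem, .inl ⟨rfl, rfl⟩, ?_, ?_⟩
    · exact LinearMap.det_id
    · simp
  | cons m l ih =>
    obtain ⟨x, hx, i, σ, hxi, hi, hdet, hconj⟩ := ih
    set P := (l.map fun v => (ℝ ∙ v)ᗮ.reflection).prod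
    simp only [List.map_cons, List.prod_cons]
    -- The list may contain the zero vector, whose reflection is the identity and contributes no
    -- factor.
    by_cases hm : m = 0
    · have h1 : (ℝ ∙ m)ᗮ.reflection = 1 := by
        subst hm
        ext1 v
        rw [Submodule.reflection_orthogonal_apply, Submodule.reflection_singleton_apply]
        simp
      rw [h1, one_mul]
      exact ⟨x, hx, i, σ, hxi, hi, hdet, hconj⟩
    · set m' : Fin n → ℝ := ‖m‖⁻¹ • m.ofLp with hm'
      have hn : ‖m‖ ≠ 0 := norm_ne_zero_iff.2 hm
      have hunit : ∑ k, m' k ^ 2 = 1 := by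
        simp only [hm', Pi.smul_apply, smul_eq_mul, mul_pow, ← Finset.mul_sum]
        have := EuclideanSpace.norm_sq_eq m
        simp only [Real.norm_eq_abs, sq_abs] at this
        rw [← this]
        field_simp
      have hrefl : ∀ v : EuclideanSpace ℝ (Fin n), ((ℝ ∙ m)ᗮ.reflection v).ofLp =
          v.ofLp - (2 * ∑ k, m' k * v k) • m' := by
        intro v
        rw [Submodule.reflection_orthogonal_apply, Submodule.reflection_singleton_apply]
        have hin : inner ℝ m v = ∑ k, m k * v k := by
          simp [PiLp.inner_apply, mul_comm]
        ext k
        simp only [hin, hm', Pi.smul_apply, smul_eq_mul, mul_assoc, ← Finset.mul_sum, PiLp.neg_apply,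
          PiLp.sub_apply, PiLp.smul_apply, nsmul_eq_mul, Pi.sub_apply, RCLike.ofReal_real_eq_id, id]
        field_simp
        norm_num
        ring
      have hstar : star (CliffordAlgebra.ι (negSumSq n) m') = -CliffordAlgebra.ι (negSumSq n) m' :=
        CliffordAlgebra.star_ι _
      -- One more factor changes the parity, the determinant, and the sign σ between conjugation and
      -- the product of reflections, all at once.
      refine ⟨CliffordAlgebra.ι _ m' * x, mul_mem (ι_mem_pinGroup hunit) hx, 1 + i, -σ,
        CliffordAlgebra.evenOdd_mul_le _ _ _
          (Submodule.mul_mem_mul (CliffordAlgebra.ι_mem_evenOdd_one _ _) hxi), ?_, ?_, ?_⟩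
      · rcases hi with ⟨rfl, rfl⟩ | ⟨rfl, rfl⟩
        · exact .inr ⟨rfl, rfl⟩
        · exact .inl ⟨rfl, neg_neg 1⟩
      · have h2 : ((ℝ ∙ m)ᗮ.reflection * P).toLinearEquiv.toLinearMap =
            (ℝ ∙ m)ᗮ.reflection.toLinearMap ∘ₗ P.toLinearEquiv.toLinearMap := rfl
        rw [h2, LinearMap.det_comp, hdet, Submodule.det_reflection, Submodule.orthogonal_orthogonal,
          finrank_span_singleton hm]
        simp
      · intro v
        rw [LinearIsometryEquiv.coe_mul, Function.comp_apply, hrefl, ← ι_mul_ι_mul_ι_self hunit,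
          ← hconj, star_mul, hstar]
        simp only [neg_smul, mul_neg, smul_neg, neg_neg, mul_smul_comm, smul_mul_assoc, mul_assoc]

/-- Cartan–Dieudonné: B is a product of reflections, and the product of the corresponding unit
vectors conjugates as B up to the sign det B. -/
theorem exists_spinMatrix_eq {n : ℕ} {B : Matrix (Fin n) (Fin n) ℝ} (hB : B.transpose * B = 1)
    (hdet : 0 < B.det) : ∃ s : Spin n, spinMatrix s = B := by
  let φ₀ : EuclideanSpace ℝ (Fin n) →ₗᵢ[ℝ] EuclideanSpace ℝ (Fin n) :=
    { Matrix.toLpLin 2 2 B with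
      norm_map' := fun v => by
        have h : ∀ w : EuclideanSpace ℝ (Fin n), ‖w‖ ^ 2 = dotProduct w.ofLp w.ofLp := fun w => by
          rw [EuclideanSpace.norm_sq_eq]
          simp only [Real.norm_eq_abs, sq_abs, dotProduct, ← pow_two]
        rw [← sq_eq_sq₀ (norm_nonneg _) (norm_nonneg _), h, h]
        change dotProduct (B.mulVec v.ofLp) (B.mulVec v.ofLp) = _
        rw [Matrix.dotProduct_mulVec, ← Matrix.mulVec_transpose, Matrix.mulVec_mulVec, hB,
          Matrix.one_mulVec] }
  let φ := φ₀.toLinearIsometryEquiv rfl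
  have hφ : ∀ v, (φ v).ofLp = B.mulVec v.ofLp := fun v => rfl
  obtain ⟨l, -, hl⟩ := φ.reflections_generate_dim
  obtain ⟨x, hx, i, σ, hxi, hi, hd, hconj⟩ := exists_pin_of_reflections l
  rw [← hl] at hd hconj
  have hd' : LinearMap.det φ.toLinearEquiv.toLinearMap = B.det :=
    LinearMap.det_toLpLin 2 B
  rcases hi with ⟨rfl, rfl⟩ | ⟨rfl, rfl⟩
  · refine ⟨⟨x, hx, hxi⟩, spinMatrix_eq_of_conj fun v => ?_⟩
    have := hconj (WithLp.toLp 2 v)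
    rwa [one_smul, hφ] at this
  -- An odd number of reflections would give determinant -1.
  · linarith

/-! ### Principal bundles -/

namespace IsPrincipalBundle

variable {G P X : Type*} [Group G] [TopologicalSpace G] [TopologicalSpace P]
    [TopologicalSpace X] {proj : P → X} {act : P → G → P}

/-- A section σ and a fibre coordinate τ as total functions with irrelevant values off U, so that
continuity can be treated by `ContinuousOn` instead of through subtypes. -/
theorem exists_trivialization (h : IsPrincipalBundle proj act) (x : X) : ∃ U : Set X, IsOpen U ∧
    x ∈ U ∧ ∃ (σ : X → P) (τ : P → G), ContinuousOn σ U ∧ (∀ y ∈ U, proj (σ y) = y) ∧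
      ContinuousOn τ (proj ⁻¹' U) ∧ (∀ p ∈ proj ⁻¹' U, act (σ (proj p)) (τ p) = p) ∧
      ∀ y ∈ U, ∀ g, τ (act (σ y) g) = g := by
  obtain ⟨U, hU, hx, Ψ, hΨ⟩ := h.locally_trivial x
  let d : P := Ψ (⟨x, hx⟩, 1)
  classical
  let σ : X → P := fun y => if hy : y ∈ U then Ψ (⟨y, hy⟩, 1) else d
  let τ : P → G := fun p => if hp : p ∈ proj ⁻¹' U then (Ψ.symm ⟨p, hp⟩).2 else 1
  have hσ : ∀ y : U, σ y = Ψ (y, 1) := fun y => dif_pos y.2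
  have hτ : ∀ p : proj ⁻¹' U, τ p = (Ψ.symm p).2 := fun p => dif_pos p.2
  have hact : ∀ (y : U) (g : G), act (σ y) g = Ψ (y, g) := fun y g => by
    rw [hσ, (hΨ y 1).2, one_mul]
  refine ⟨U, hU, hx, σ, τ, ?_, ?_, ?_, ?_, ?_⟩
  · rw [continuousOn_iff_continuous_domRestrict]
    have : U.domRestrict σ = fun y => (Ψ (y, 1) : P) := funext hσ
    rw [this]
    fun_prop
  · intro y hy
    rw [hσ ⟨y, hy⟩, (hΨ _ _).1]
  · rw [continuousOn_iff_continuous_domRestrict]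
    have : (proj ⁻¹' U).domRestrict τ = fun p => (Ψ.symm p).2 := funext hτ
    rw [this]
    fun_prop
  · intro p hp
    have hp1 : (Ψ.symm ⟨p, hp⟩).1 = ⟨proj p, hp⟩ := by
      apply Subtype.ext
      have := (hΨ (Ψ.symm ⟨p, hp⟩).1 (Ψ.symm ⟨p, hp⟩).2).1
      rw [Prod.mk.eta, Homeomorph.apply_symm_apply] at this
      exact this.symm
    rw [hact ⟨proj p, hp⟩, hτ ⟨p, hp⟩, ← hp1, Prod.mk.eta, Homeomorph.apply_symm_apply]
  · intro y hy g
    rw [hact ⟨y, hy⟩, hτ, Homeomorph.symm_apply_apply]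

theorem proj_surjective (h : IsPrincipalBundle proj act) : Function.Surjective proj := fun x =>
  let ⟨_, _, hx, σ, _, _, hσ, _⟩ := h.exists_trivialization x
  ⟨σ x, hσ x hx⟩

theorem act_cancel (h : IsPrincipalBundle proj act) {p : P} {g g' : G}
    (hg : act p g = act p g') : g = g' := by
  obtain ⟨U, hU, hx, σ, τ, -, -, -, h1, h2⟩ := h.exists_trivialization (proj p)
  rw [← h1 p hx, ← h.act_mul, ← h.act_mul] at hg
  have := congrArg τ hg
  rw [h2 _ hx, h2 _ hx] at this
  exact mul_left_cancel this

theorem exists_act_eq (h : IsPrincipalBundle proj act) {p q : P} (hpq : proj p = proj q) :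
    ∃ g, act p g = q := by
  obtain ⟨U, hU, hx, σ, τ, -, -, -, h1, h2⟩ := h.exists_trivialization (proj p)
  refine ⟨(τ p)⁻¹ * τ q, ?_⟩
  calc act p ((τ p)⁻¹ * τ q) = act (act (σ (proj p)) (τ p)) ((τ p)⁻¹ * τ q) := by rw [h1 p hx]
    _ = q := by
      rw [← h.act_mul, mul_inv_cancel_left, hpq, h1 q (by rwa [Set.mem_preimage, ← hpq])]

open Classical in
/-- The group element which moves `p` to the point `q` of the same fibre. -/
def div (h : IsPrincipalBundle proj act) (p q : P) : G :=
  if hpq : proj p = proj q then (h.exists_act_eq hpq).choose else 1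

theorem act_div (h : IsPrincipalBundle proj act) {p q : P} (hpq : proj p = proj q) :
    act p (h.div p q) = q := by
  rw [div, dif_pos hpq]
  exact (h.exists_act_eq hpq).choose_spec

/-- In a local trivialization the quotient is τ(p)⁻¹ τ(q). -/
theorem continuousOn_div [IsTopologicalGroup G] (h : IsPrincipalBundle proj act) :
    ContinuousOn (fun a : P × P => h.div a.1 a.2) {a | proj a.1 = proj a.2} := by
  refine continuousOn_of_locally_continuousOn fun a _ => ?_
  obtain ⟨U, hU, hx, σ, τ, -, -, hτ, h1, h2⟩ := h.exists_trivialization (proj a.1)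
  refine ⟨{a | proj a.1 ∈ U}, hU.preimage (h.continuous_proj.comp continuous_fst), hx, ?_⟩
  have hc : ContinuousOn (fun a : P × P => (τ a.1)⁻¹ * τ a.2)
      ({a | proj a.1 = proj a.2} ∩ {a | proj a.1 ∈ U}) :=
    (hτ.comp continuousOn_fst fun b hb => hb.2).inv.mul
      (hτ.comp continuousOn_snd fun b hb => by
        rw [Set.mem_preimage, ← hb.1]; exact hb.2)
  refine hc.congr fun b hb => ?_
  apply h.act_cancel (p := b.1)
  have h3 := h1 b.2 (by rw [Set.mem_preimage, ← hb.1]; exact hb.2)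
  rw [← hb.1] at h3
  conv_rhs => rw [← h1 b.1 hb.2]
  rw [h.act_div hb.1, ← h.act_mul, mul_inv_cancel_left, h3]

theorem exists_section (h : IsPrincipalBundle proj act) (p : P) : ∃ U : Set X, IsOpen U ∧
    proj p ∈ U ∧ ∃ σ : X → P, ContinuousOn σ U ∧ (∀ y ∈ U, proj (σ y) = y) ∧ σ (proj p) = p := by
  obtain ⟨U, hU, hx, σ, τ, hσ, h1, -, h2, -⟩ := h.exists_trivialization (proj p)
  refine ⟨U, hU, hx, fun y => act (σ y) (τ p), ?_, fun y hy => ?_, h2 p hx⟩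
  · exact h.continuous_act.comp_continuousOn (hσ.prodMk continuousOn_const)
  · rw [h.proj_act, h1 y hy]

/-- There is a continuous local section through every point, so images of neighbourhoods are
neighbourhoods. -/
theorem isOpenMap_proj (h : IsPrincipalBundle proj act) : IsOpenMap proj := by
  refine IsOpenMap.of_nhds_le fun p => ?_
  obtain ⟨U, hU, hx, σ, hσ, h1, h2⟩ := h.exists_section p
  have hc : Filter.Tendsto σ (𝓝 (proj p)) (𝓝 p) := by
    simpa only [h2] using (hσ.continuousAt (hU.mem_nhds hx)).tendsto
  calc 𝓝 (proj p) = Filter.map (proj ∘ σ) (𝓝 (proj p)) := by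
        rw [Filter.map_congr (m₁ := proj ∘ σ) (m₂ := id) (Filter.eventuallyEq_of_mem (hU.mem_nhds hx) fun y hy => h1 y hy),
          Filter.map_id]
    _ = Filter.map proj (Filter.map σ (𝓝 (proj p))) := Filter.map_map.symm
    _ ≤ Filter.map proj (𝓝 p) := Filter.map_mono hc

/-- A local section σ gives the trivialization (y, g) ↦ σ(y)·g, and the continuous translation
function δ provides its continuous inverse. The spin^c bundle is built with this criterion, as no
trivialization of it is given beforehand. -/
theorem of_sections (hproj : Continuous proj) (hact : Continuous fun p : P × G => act p.1 p.2)
    (act_one : ∀ p, act p 1 = p) (act_mul : ∀ p g g', act p (g * g') = act (act p g) g')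
    (proj_act : ∀ p g, proj (act p g) = proj p) (free : ∀ p g g', act p g = act p g' → g = g')
    (δ : P → P → G) (hδ : ContinuousOn (fun a : P × P => δ a.1 a.2) {a | proj a.1 = proj a.2})
    (act_δ : ∀ p q, proj p = proj q → act p (δ p q) = q)
    (sections : ∀ x, ∃ U : Set X, IsOpen U ∧ x ∈ U ∧ ∃ σ : X → P, ContinuousOn σ U ∧
      ∀ y ∈ U, proj (σ y) = y) : IsPrincipalBundle proj act where
  continuous_proj := hproj
  continuous_act := hact
  act_one := act_one
  act_mul := act_mul
  proj_act := proj_act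
  locally_trivial x := by
    obtain ⟨U, hU, hx, σ, hσ, h1⟩ := sections x
    have hσ' : Continuous fun y : U => σ y := continuousOn_iff_continuous_domRestrict.1 hσ
    refine ⟨U, hU, hx,
      { toFun := fun a => ⟨act (σ a.1) a.2, by
          rw [Set.mem_preimage, proj_act, h1 _ a.1.2]; exact a.1.2⟩
        invFun := fun p => (⟨proj p.1, p.2⟩, δ (σ (proj p.1)) p.1)
        left_inv := fun a => ?_
        right_inv := fun p => ?_
        continuous_toFun := ?_
        continuous_invFun := ?_ }, fun y g => ⟨?_, fun g' => ?_⟩⟩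
    · have ha : proj (act (σ a.1) a.2) = a.1 := by rw [proj_act, h1 _ a.1.2]
      refine Prod.ext (Subtype.ext ha) ?_
      apply free (σ a.1)
      simp only [ha]
      exact act_δ _ _ (proj_act _ _).symm
    · exact Subtype.ext (act_δ _ _ (h1 _ p.2))
    · exact (hact.comp ((hσ'.comp continuous_fst).prodMk continuous_snd)).subtype_mk _
    · have hp : Continuous fun p : proj ⁻¹' U => (⟨proj p.1, p.2⟩ : U) :=
        (hproj.comp continuous_subtype_val).subtype_mk _
      refine hp.prodMk ?_
      exact hδ.comp_continuous ((hσ'.comp hp).prodMk continuous_subtype_val) fun p => h1 _ p.2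
    · change proj (act (σ y) g) = y
      rw [proj_act, h1 _ y.2]
    · exact (act_mul _ _ _).symm

end IsPrincipalBundle

/-! ### Tuples of vectors -/

section Tuples

variable {n : ℕ} {V : Type*} [AddCommGroup V] [Module ℝ V]

/-- The right action of matrices on tuples of vectors. -/
def tupleMul (v : Fin n → V) (A : Matrix (Fin n) (Fin n) ℝ) : Fin n → V :=
  fun l => ∑ k, A k l • v k

theorem tupleMul_one (v : Fin n → V) : tupleMul v 1 = v := by
  funext l
  simp [tupleMul, Matrix.one_apply]

theorem IsPositiveBasis.mul_iff {o : Orientation ℝ V (Fin n)} {v : Fin n → V}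
    (hv : IsPositiveBasis o v) (A : Matrix (Fin n) (Fin n) ℝ) :
    IsPositiveBasis o (tupleMul v A) ↔ 0 < A.det := by
  obtain ⟨b, hb, rfl⟩ := hv
  obtain rfl : v = b := funext fun k => (hb k).symm
  have hA : ∀ l, Matrix.toLin b b A (b l) = tupleMul b A l := fun l => Matrix.toLin_self b b A l
  constructor
  · rintro ⟨b', hb', ho⟩
    have h1 := (b.orientation_eq_iff_det_pos b').1 ho.symm
    have h2 : b.toMatrix b' = A := by
      ext k l
      rw [Module.Basis.toMatrix_apply, hb', ← hA, ← LinearMap.toMatrix_apply,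
        LinearMap.toMatrix_toLin]
    rwa [Module.Basis.det_apply, h2] at h1
  · intro h
    have hdet : LinearMap.det (Matrix.toLin b b A) = A.det := by simp
    have : FiniteDimensional ℝ V := b.finiteDimensional_of_finite
    let f := LinearMap.equivOfDetNeZero (Matrix.toLin b b A) (by rw [hdet]; exact h.ne')
    refine ⟨b.map f, fun k => hA k, ?_⟩
    rw [b.orientation_comp_linearEquiv_eq_iff_det_pos f]
    have : (f : V →ₗ[ℝ] V) = Matrix.toLin b b A := by ext; rfl
    rw [this, hdet]
    exact h

theorem IsPositiveBasis.exists_eq_mul {o : Orientation ℝ V (Fin n)} {v : Fin n → V}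
    (hv : IsPositiveBasis o v) (w : Fin n → V) : ∃ A, w = tupleMul v A := by
  obtain ⟨b, hb, -⟩ := hv
  obtain rfl : v = b := funext fun k => (hb k).symm
  refine ⟨fun k l => b.repr (w l) k, funext fun l => ?_⟩
  exact (b.sum_repr (w l)).symm

/-- The diagonal matrix with first entry `-1` and all other entries `1`. -/
def flipZero (n : ℕ) : Matrix (Fin (n + 1)) (Fin (n + 1)) ℝ :=
  Matrix.diagonal (Fin.cons (-1) fun _ => 1)

theorem det_flipZero (n : ℕ) : (flipZero n).det = -1 := by
  simp [flipZero, Matrix.det_diagonal, Fin.prod_univ_succ]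

theorem flipZero_mul_self (n : ℕ) : flipZero n * flipZero n = 1 := by
  rw [flipZero, Matrix.diagonal_mul_diagonal, ← Matrix.diagonal_one]
  congr 1
  funext k
  refine Fin.cases ?_ (fun k => ?_) k <;> simp

theorem flipZero_transpose (n : ℕ) : (flipZero n).transpose = flipZero n :=
  Matrix.diagonal_transpose _

/-- A real vector space has just two orientations, and negating one basis vector exchanges them. -/
theorem isPositiveBasis_or_flip {o : Orientation ℝ V (Fin (n + 1))} {v : Fin (n + 1) → V}
    (hv : LinearIndependent ℝ v) (hd : Module.finrank ℝ V = n + 1) :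
    IsPositiveBasis o v ∨ IsPositiveBasis o (tupleMul v (flipZero n)) := by
  let b := basisOfLinearIndependentOfCardEqFinrank hv (by simp [hd])
  have hb : ∀ k, b k = v k := fun k => by simp [b]
  rcases b.orientation_eq_or_eq_neg o with h | h
  · exact .inl ⟨b, hb, h.symm⟩
  · refine .inr ⟨b.unitsSMul (Function.update 1 0 (-1)), fun k => ?_, ?_⟩
    · rw [Module.Basis.unitsSMul_apply, hb, tupleMul]
      simp only [flipZero, Matrix.diagonal_apply, ite_smul, zero_smul, Finset.sum_ite_eq', Finset.mem_univ, if_true]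
      refine Fin.cases ?_ (fun k => ?_) k <;> simp
    · rw [h, Module.Basis.orientation_neg_single]

theorem not_isPositiveBasis_and_flip {o : Orientation ℝ V (Fin (n + 1))} {v : Fin (n + 1) → V} :
    ¬ (IsPositiveBasis o v ∧ IsPositiveBasis o (tupleMul v (flipZero n))) := by
  rintro ⟨h1, h2⟩
  have := (h1.mul_iff _).1 h2
  rw [det_flipZero] at this
  linarith

/-- The tuple `v` is orthonormal for the bilinear form `g`. -/
def IsONTuple (g : V →ₗ[ℝ] V →ₗ[ℝ] ℝ) (v : Fin n → V) : Prop :=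
  ∀ k l, g (v k) (v l) = if k = l then 1 else 0

variable {g : V →ₗ[ℝ] V →ₗ[ℝ] ℝ} {v : Fin n → V}

theorem IsONTuple.apply_mul_mul (hv : IsONTuple g v) (A : Matrix (Fin n) (Fin n) ℝ) (k l : Fin n) :
    g (tupleMul v A k) (tupleMul v A l) = (A.transpose * A) k l := by
  have hv' : ∀ i j, g (v i) (v j) = if i = j then 1 else 0 := hv
  simp [tupleMul, hv', Matrix.mul_apply, mul_comm]

theorem IsONTuple.mul_iff (hv : IsONTuple g v) (A : Matrix (Fin n) (Fin n) ℝ) :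
    IsONTuple g (tupleMul v A) ↔ A.transpose * A = 1 := by
  simp only [IsONTuple, hv.apply_mul_mul, ← Matrix.ext_iff, Matrix.one_apply]

theorem IsONTuple.linearIndependent (hv : IsONTuple g v) : LinearIndependent ℝ v := by
  have hv' : ∀ i j, g (v i) (v j) = if i = j then 1 else 0 := hv
  rw [Fintype.linearIndependent_iff]
  intro c hc k
  have := congrArg (fun w => g w (v k)) hc
  simpa [hv'] using this

theorem IsONTuple.sum_smul {v : Fin (n + 1) → V} (hv : IsONTuple g v)
    (hd : Module.finrank ℝ V = n + 1) (w : V) :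
    ∑ k, g w (v k) • v k = w := by
  have hv' : ∀ i j, g (v i) (v j) = if i = j then 1 else 0 := hv
  let b := basisOfLinearIndependentOfCardEqFinrank hv.linearIndependent (by simp [hd])
  have hb : ∀ k, b k = v k := fun k => by simp [b]
  have hw := b.sum_repr w
  simp only [hb] at hw
  have h : ∀ l, g w (v l) = b.repr w l := by
    intro l
    conv_lhs => rw [← hw]
    simp [hv']
  simp only [h, hw]

/-! ### Riemannian submersions of vector spaces -/

variable {W : Type*} [AddCommGroup W] [Module ℝ W] {g' : W →ₗ[ℝ] W →ₗ[ℝ] ℝ}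

theorem ker_le_span_singleton {L : V →ₗ[ℝ] W} (hL : Function.Surjective L) (hV : Module.finrank ℝ V = n + 1)
    (hW : Module.finrank ℝ W = n) {v : V} (hv : L v = 0) (hv0 : v ≠ 0) {y : V} (hy : L y = 0) :
    ∃ a : ℝ, y = a • v := by
  have : FiniteDimensional ℝ V := Module.finite_of_finrank_eq_succ hV
  have h1 := L.finrank_range_add_finrank_ker
  rw [LinearMap.range_eq_top.2 hL, finrank_top, hV, hW] at h1
  have h2 : Module.finrank ℝ (LinearMap.ker L) = 1 := by omega
  obtain ⟨a, ha⟩ := (finrank_eq_one_iff_of_nonzero' (⟨v, hv⟩ : LinearMap.ker L)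
    (fun h => hv0 (congrArg Subtype.val h))).1 h2 ⟨y, hy⟩
  exact ⟨a, (congrArg Subtype.val ha).symm⟩

theorem exists_ker_ne_zero {L : V →ₗ[ℝ] W} (hV : Module.finrank ℝ V = n + 1)
    (hW : Module.finrank ℝ W = n) [FiniteDimensional ℝ W] : ∃ v, L v = 0 ∧ v ≠ 0 := by
  have : FiniteDimensional ℝ V := Module.finite_of_finrank_eq_succ hV
  have h := LinearMap.ker_ne_bot_of_finrank_lt (f := L) (by omega)
  obtain ⟨v, hv, h0⟩ := (Submodule.ne_bot_iff _).1 h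
  exact ⟨v, hv, h0⟩

/-- A surjective linear map which is isometric on the orthogonal complement of its kernel. -/
structure IsLinearSubmersion (g : V →ₗ[ℝ] V →ₗ[ℝ] ℝ) (g' : W →ₗ[ℝ] W →ₗ[ℝ] ℝ) (n : ℕ)
    (L : V →ₗ[ℝ] W) : Prop where
  symm : ∀ x y, g x y = g y x
  surjective : Function.Surjective L
  finrank_source : Module.finrank ℝ V = n + 1
  finrank_target : Module.finrank ℝ W = n
  isometric : ∀ v w, (∀ y, L y = 0 → g v y = 0 ∧ g w y = 0) → g' (L v) (L w) = g v w

namespace IsLinearSubmersion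

variable {L : V →ₗ[ℝ] W}

/-- The vector x - g(x,v)v is orthogonal to the line ker L spanned by v, and L is isometric on such
vectors. So the pulled-back metric is g minus the square of the vertical component. -/
theorem apply_apply (h : IsLinearSubmersion g g' n L) {v : V} (hv : L v = 0) (hv1 : g v v = 1) (x y : V) :
    g' (L x) (L y) = g x y - g x v * g y v := by
  have hv0 : v ≠ 0 := by rintro rfl; simp at hv1
  have key : ∀ x : V, ∀ y, L y = 0 → g (x - g x v • v) y = 0 := by
    intro x y hy
    obtain ⟨a, rfl⟩ := ker_le_span_singleton h.surjective h.finrank_source h.finrank_target hv hv0 hy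
    simp [hv1]
  have h1 := h.isometric (x - g x v • v) (y - g y v • v) fun z hz => ⟨key x z hz, key y z hz⟩
  simp only [map_sub, map_smul, hv, smul_zero, sub_zero, LinearMap.sub_apply, LinearMap.smul_apply,
    smul_eq_mul, hv1, mul_one, sub_self, mul_zero] at h1
  rw [h1, h.symm v y]

theorem isONTuple_tail (h : IsLinearSubmersion g g' n L) {t : Fin (n + 1) → V} (ht : IsONTuple g t) (h0 : L (t 0) = 0) :
    IsONTuple g' fun k : Fin n => L (t k.succ) := by
  intro k l
  rw [h.apply_apply h0 (by rw [ht, if_pos rfl]), ht, ht, ht]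
  simp

end IsLinearSubmersion

end Tuples

/-! ### Tuples of tangent vectors -/

namespace TangentTuple

variable {n m : ℕ} {X : Type*} [TopologicalSpace X] [ChartedSpace (EuclideanSpace ℝ (Fin n)) X]
  {Y : Type*} [TopologicalSpace Y] [ChartedSpace (EuclideanSpace ℝ (Fin m)) Y]

theorem ext_tan {t t' : TangentTuple n X} (hpt : t.pt = t'.pt) (h : ∀ k, t.tan k = t'.tan k) :
    t = t' := by
  obtain ⟨x, v⟩ := t
  obtain ⟨x', v'⟩ := t'
  obtain rfl : x = x' := hpt
  congr 1
  funext k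
  exact eq_of_heq (Bundle.TotalSpace.mk.inj (h k)).2

/-- The right action of matrices on tuples of tangent vectors. -/
def mul (t : TangentTuple n X) (A : Matrix (Fin n) (Fin n) ℝ) : TangentTuple n X :=
  ⟨t.pt, tupleMul t.vec A⟩

/-- The image under the differential of `φ`. -/
def map {Y : Type*} [TopologicalSpace Y] [ChartedSpace (EuclideanSpace ℝ (Fin n)) Y]
    (φ : X → Y) (t : TangentTuple n X) : TangentTuple n Y :=
  ⟨φ t.pt, fun k => mfderiv (𝓡 n) (𝓡 n) φ t.pt (t.vec k)⟩

/-- The image under the differential of `f` of all vectors but the first. -/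
def mapTail {B : Type*} [TopologicalSpace B] [ChartedSpace (EuclideanSpace ℝ (Fin (n + 1))) B]
    (f : B → X) (t : TangentTuple (n + 1) B) : TangentTuple n X :=
  ⟨f t.pt, fun k => mfderiv (𝓡 (n + 1)) (𝓡 n) f t.pt (t.vec k.succ)⟩

theorem mul_one (t : TangentTuple n X) : t.mul 1 = t := by
  obtain ⟨x, v⟩ := t
  rw [mul, tupleMul_one]

variable {Y : Type*} [TopologicalSpace Y] [ChartedSpace (EuclideanSpace ℝ (Fin n)) Y]
  {Z : Type*} [TopologicalSpace Z] [ChartedSpace (EuclideanSpace ℝ (Fin n)) Z]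
  {B : Type*} [TopologicalSpace B] [ChartedSpace (EuclideanSpace ℝ (Fin (n + 1))) B]
  {C : Type*} [TopologicalSpace C] [ChartedSpace (EuclideanSpace ℝ (Fin (n + 1))) C]

theorem map_mul (φ : X → Y) (t : TangentTuple n X) (A : Matrix (Fin n) (Fin n) ℝ) :
    (t.mul A).map φ = (t.map φ).mul A := by
  simp only [map, mul, tupleMul]
  congr 1
  funext l
  exact (map_sum (mfderiv (𝓡 n) (𝓡 n) φ t.pt) _ _).trans
    (Finset.sum_congr rfl fun k _ => map_smul _ _ _)

theorem mapTail_mul_of_row_zero (f : B → X) (t : TangentTuple (n + 1) B)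
    {A : Matrix (Fin (n + 1)) (Fin (n + 1)) ℝ} (hA : ∀ l : Fin n, A 0 l.succ = 0) :
    (t.mul A).mapTail f = (t.mapTail f).mul (A.submatrix Fin.succ Fin.succ) := by
  simp only [mapTail, mul, tupleMul]
  congr 1
  funext l
  rw [Fin.sum_univ_succ, hA, zero_smul, zero_add]
  exact (map_sum (mfderiv (𝓡 (n + 1)) (𝓡 n) f t.pt) _ _).trans
    (Finset.sum_congr rfl fun k _ => map_smul _ _ _)

theorem mapTail_mul (f : B → X) (t : TangentTuple (n + 1) B) (A : Matrix (Fin n) (Fin n) ℝ) :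
    (t.mul (blockOne A)).mapTail f = (t.mapTail f).mul A :=
  mapTail_mul_of_row_zero f t (blockOne_zero_succ A)

theorem mul_blockOne_vec_zero (t : TangentTuple (n + 1) B) (A : Matrix (Fin n) (Fin n) ℝ) :
    (t.mul (blockOne A)).vec 0 = t.vec 0 := by
  simp [mul, tupleMul, Fin.sum_univ_succ]

theorem map_map {φ : X → Y} {ψ : Y → Z} {t : TangentTuple n X}
    (hφ : MDifferentiableAt (𝓡 n) (𝓡 n) φ t.pt) (hψ : MDifferentiableAt (𝓡 n) (𝓡 n) ψ (φ t.pt)) :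
    (t.map φ).map ψ = t.map (ψ ∘ φ) := by
  simp only [map]
  congr 1
  funext k
  exact (mfderiv_comp_apply t.pt hψ hφ (t.vec k)).symm

theorem map_mapTail {f : B → X} {φ : X → Y} {t : TangentTuple (n + 1) B}
    (hf : MDifferentiableAt (𝓡 (n + 1)) (𝓡 n) f t.pt)
    (hφ : MDifferentiableAt (𝓡 n) (𝓡 n) φ (f t.pt)) :
    (t.mapTail f).map φ = t.mapTail (φ ∘ f) := by
  simp only [mapTail, map]
  congr 1
  funext k
  exact (mfderiv_comp_apply t.pt hφ hf (t.vec k.succ)).symm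

theorem mapTail_map {φ : B → C} {f : C → X} {t : TangentTuple (n + 1) B}
    (hφ : MDifferentiableAt (𝓡 (n + 1)) (𝓡 (n + 1)) φ t.pt)
    (hf : MDifferentiableAt (𝓡 (n + 1)) (𝓡 n) f (φ t.pt)) :
    (t.map φ).mapTail f = t.mapTail (f ∘ φ) := by
  simp only [mapTail, map]
  congr 1
  funext k
  exact (mfderiv_comp_apply t.pt hf hφ (t.vec k.succ)).symm

theorem map_id (t : TangentTuple n X) : t.map id = t := by
  obtain ⟨x, v⟩ := t
  simp only [map]
  congr 1
  funext k
  rw [mfderiv_id]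
  rfl

theorem map_congr {φ ψ : X → Y} {t : TangentTuple n X} (h : φ =ᶠ[𝓝 t.pt] ψ) :
    t.map φ = t.map ψ :=
  ext_tan h.eq_of_nhds fun k => by
    change (⟨φ t.pt, mfderiv (𝓡 n) (𝓡 n) φ t.pt (t.vec k)⟩ : TangentBundle (𝓡 n) Y) =
      ⟨ψ t.pt, mfderiv (𝓡 n) (𝓡 n) ψ t.pt (t.vec k)⟩
    rw [h.mfderiv_eq, h.eq_of_nhds]

theorem mapTail_congr {φ ψ : B → X} {t : TangentTuple (n + 1) B} (h : φ =ᶠ[𝓝 t.pt] ψ) :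
    t.mapTail φ = t.mapTail ψ :=
  ext_tan h.eq_of_nhds fun k => by
    change (⟨φ t.pt, mfderiv (𝓡 (n + 1)) (𝓡 n) φ t.pt (t.vec k.succ)⟩ : TangentBundle (𝓡 n) X) =
      ⟨ψ t.pt, mfderiv (𝓡 (n + 1)) (𝓡 n) ψ t.pt (t.vec k.succ)⟩
    rw [h.mfderiv_eq, h.eq_of_nhds]

section Topology

variable [IsManifold (𝓡 n) ∞ X] [IsManifold (𝓡 (n + 1)) ∞ B]

theorem isInducing : Topology.IsInducing fun t : TangentTuple n X => (t.pt, t.tan) := ⟨rfl⟩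

theorem continuous_pt : Continuous fun t : TangentTuple n X => t.pt :=
  continuous_fst.comp isInducing.continuous

theorem continuous_tan (k : Fin n) : Continuous fun t : TangentTuple n X => t.tan k :=
  (continuous_apply k).comp (continuous_snd.comp isInducing.continuous)

theorem continuous_of {T : Type*} [TopologicalSpace T] {g : T → TangentTuple n X}
    (hpt : Continuous fun t => (g t).pt) (htan : ∀ k, Continuous fun t => (g t).tan k) :
    Continuous g :=
  isInducing.continuous_iff.2 (hpt.prodMk (continuous_pi htan))

theorem continuous_mapTail {f : B → X} (hf : ContMDiff (𝓡 (n + 1)) (𝓡 n) ∞ f) :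
    Continuous (mapTail (n := n) f) := by
  refine continuous_of (hf.continuous.comp continuous_pt) fun k => ?_
  have h := hf.continuous_tangentMap (by simp)
  exact h.comp (continuous_tan k.succ)

/-- The differential of ρ(z) is the differential of the whole action restricted to vectors (0, v) on
the product; this gives continuity jointly in z and the tuple. -/
theorem continuous_map_action {ρ : Circle → X → X}
    (hρ : ContMDiff ((𝓡 1).prod (𝓡 n)) (𝓡 n) ∞ fun p : Circle × X => ρ p.1 p.2) :
    Continuous fun a : Circle × TangentTuple n X => a.2.map (ρ a.1) := by
  refine continuous_of (hρ.continuous.comp (continuous_fst.prodMk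
    (continuous_pt.comp continuous_snd))) fun k => ?_
  have h1 := hρ.continuous_tangentMap (by simp)
  have h2 : Continuous (equivTangentBundleProd (𝓡 1) Circle (𝓡 n) X).symm :=
    (contMDiff_equivTangentBundleProd_symm (n := 0)).continuous
  have h3 : Continuous fun z : Circle => (⟨z, 0⟩ : TangentBundle (𝓡 1) Circle) :=
    (Bundle.contMDiff_zeroSection ℝ (fun z : Circle => TangentSpace (𝓡 1) z) (n := 0)
      (IB := 𝓡 1)).continuous
  have h4 := h1.comp (h2.comp ((h3.comp continuous_fst).prodMk
    ((continuous_tan (X := X) k).comp continuous_snd)))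
  refine h4.congr fun a => ?_
  obtain ⟨z, t⟩ := a
  have hd : MDifferentiableAt (𝓡 n) ((𝓡 1).prod (𝓡 n)) (fun b : X => (z, b)) t.pt :=
    mdifferentiableAt_const.prodMk mdifferentiableAt_id
  have h5 := tangentMap_comp_at (p := t.tan k) (f := fun b : X => (z, b))
    (g := fun p : Circle × X => ρ p.1 p.2) (hρ.mdifferentiable (by simp) _) hd
  rw [tangentMap_prod_right] at h5
  exact h5.symm

end Topology

end TangentTuple

/-! ### Oriented orthonormal frames -/

theorem finrank_tangentSpace {n : ℕ} {X : Type*} [TopologicalSpace X]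
    [ChartedSpace (EuclideanSpace ℝ (Fin n)) X] (x : X) :
    Module.finrank ℝ (TangentSpace (𝓡 n) x) = n :=
  finrank_euclideanSpace_fin

namespace ORManifold

variable {n : ℕ}

/-- The metric as a bilinear form on the tangent space. -/
def form (X : ORManifold.{u} n) (x : X) :
    TangentSpace (𝓡 n) x →ₗ[ℝ] TangentSpace (𝓡 n) x →ₗ[ℝ] ℝ :=
  LinearMap.mk₂ ℝ (X.scal x) (fun v w y => by simp [scal]) (fun c v y => by simp [scal])
    (fun v w y => by simp [scal]) (fun c v y => by simp [scal])

/-- The tuple `t` is a positively oriented orthonormal frame. -/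
def IsSO (X : ORManifold.{u} n) (t : TangentTuple n X) : Prop :=
  IsONTuple (X.form t.pt) t.vec ∧ IsPositiveBasis (X.orientation t.pt) t.vec

theorem IsSO.mul_iff {X : ORManifold.{u} n} {t : TangentTuple n X} (ht : X.IsSO t)
    (A : Matrix (Fin n) (Fin n) ℝ) : X.IsSO (t.mul A) ↔ A.transpose * A = 1 ∧ 0 < A.det :=
  and_congr (ht.1.mul_iff A) (ht.2.mul_iff A)

theorem IsSO.exists_eq_mul {X : ORManifold.{u} n} {t t' : TangentTuple n X} (ht : X.IsSO t)
    (ht' : X.IsSO t') (h : t.pt = t'.pt) :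
    ∃ A : Matrix (Fin n) (Fin n) ℝ, t' = t.mul A ∧ A.transpose * A = 1 ∧ 0 < A.det := by
  obtain ⟨x, v⟩ := t
  obtain ⟨x', w⟩ := t'
  obtain rfl : x = x' := h
  obtain ⟨A, rfl⟩ := ht.2.exists_eq_mul w
  exact ⟨A, rfl, (ht.mul_iff A).1 ht'⟩

open Bundle in
theorem continuous_scal_differential {B : ORManifold.{u} (n + 1)} {X : ORManifold.{v} n} {f : B → X}
    (hf : ContMDiff (𝓡 (n + 1)) (𝓡 n) ∞ f) (k l : Fin (n + 1)) :
    Continuous fun t : TangentTuple (n + 1) B => X.scal (f t.pt)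
      (mfderiv (𝓡 (n + 1)) (𝓡 n) f t.pt (t.vec k)) (mfderiv (𝓡 (n + 1)) (𝓡 n) f t.pt (t.vec l)) := by
  let _ : Bundle.RiemannianBundle fun x : X => TangentSpace (𝓡 n) x := ⟨X.metric.toRiemannianMetric⟩
  have h := hf.continuous_tangentMap (by simp)
  have hk : ∀ k, Continuous fun t : TangentTuple (n + 1) B =>
      (⟨f t.pt, mfderiv (𝓡 (n + 1)) (𝓡 n) f t.pt (t.vec k)⟩ : TangentBundle (𝓡 n) X) := fun k =>
    h.comp (TangentTuple.continuous_tan k)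
  exact Continuous.inner_bundle (F := EuclideanSpace ℝ (Fin n)) (hk k) (hk l)

namespace SOFrame

variable {X : ORManifold.{u} n} {Y : ORManifold.{v} n}

theorem isSO (e : X.SOFrame) : X.IsSO e.1 := e.2

theorem isRightMul_iff {e f : X.SOFrame} {A : Matrix (Fin n) (Fin n) ℝ} :
    e.IsRightMul A f ↔ f.1 = e.1.mul A :=
  ⟨fun h => TangentTuple.ext_tan h.1 h.2, fun h =>
    ⟨congrArg (fun t => t.pt) h, fun l => congrArg (fun t => t.tan l) h⟩⟩

theorem isImage_iff {φ : X → Y} {e : X.SOFrame} {e' : Y.SOFrame} :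
    IsImage φ e e' ↔ e'.1 = e.1.map φ :=
  ⟨fun h => TangentTuple.ext_tan h.1 h.2, fun h =>
    ⟨congrArg (fun t => t.pt) h, fun l => congrArg (fun t => t.tan l) h⟩⟩

theorem isAdaptedOver_iff {B : ORManifold.{u} (n + 1)} {X : ORManifold.{v} n} {f : B → X}
    {e : B.SOFrame} {ε : X.SOFrame} : IsAdaptedOver f e ε ↔
      mfderiv (𝓡 (n + 1)) (𝓡 n) f e.pt (e.vec 0) = 0 ∧ ε.1 = e.1.mapTail f :=
  ⟨fun h => ⟨h.2.1, TangentTuple.ext_tan h.1 h.2.2⟩, fun h =>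
    ⟨congrArg (fun t => t.pt) h.2, h.1, fun l => congrArg (fun t => t.tan l) h.2⟩⟩

theorem continuous_val : Continuous fun e : X.SOFrame => e.1 := continuous_subtype_val

theorem continuous_iff {T : Type*} [TopologicalSpace T] {g : T → X.SOFrame} :
    Continuous g ↔ Continuous fun t => (g t).1 :=
  Topology.IsInducing.subtypeVal.continuous_iff

end SOFrame

theorem IsLocalIsometry.isSO_map {X Y : ORManifold.{u} n} {h : OpenPartialHomeomorph X Y}
    (hh : IsLocalIsometry h) {t : TangentTuple n X} (ht : X.IsSO t) (hs : t.pt ∈ h.source) :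
    Y.IsSO (t.map h) :=
  ⟨fun k l => (hh.isometric _ hs _ _).trans (ht.1 k l), hh.oriented _ hs _ ht.2⟩

theorem IsLocalIsometry.mdifferentiableAt {X Y : ORManifold.{u} n} {h : OpenPartialHomeomorph X Y}
    (hh : IsLocalIsometry h) {x : X} (hx : x ∈ h.source) :
    MDifferentiableAt (𝓡 n) (𝓡 n) h x :=
  (hh.smooth.contMDiffAt (h.open_source.mem_nhds hx)).mdifferentiableAt (by simp)

end ORManifold

/-! ### The circle action on frames -/

namespace CircleOrbibundle

open ORManifold

variable {ι : Type w} {n : ℕ} {M : Orbifold.{u} ι (n + 1)} {N : Orbifold.{u} ι n}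
  (E : CircleOrbibundle M N)

theorem exists_trivialization (i : ι) (x : N.X i) : ∃ U : Set (N.X i), IsOpen U ∧ x ∈ U ∧
    ∃ (σ : N.X i → M.X i) (τ : M.X i → Circle),
      ContMDiffOn (𝓡 n) (𝓡 (n + 1)) ∞ σ U ∧ (∀ y ∈ U, E.proj i (σ y) = y) ∧
      ContinuousOn τ (E.proj i ⁻¹' U) ∧ (∀ b ∈ E.proj i ⁻¹' U, E.rot i (τ b) (σ (E.proj i b)) = b) ∧
      ∀ y ∈ U, ∀ z, τ (E.rot i z (σ y)) = z ∧ E.proj i (E.rot i z (σ y)) = y := by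
  obtain ⟨U, hU, hx, Ψ, hs, ht, hΨ, hΨ', h⟩ := E.locally_trivial i x
  have h1 : ∀ y ∈ U, ∀ z, (y, z) ∈ Ψ.source := fun y hy z => by rw [hs]; exact ⟨hy, trivial⟩
  have h2 : ∀ y ∈ U, ∀ z, E.rot i z (Ψ (y, 1)) = Ψ (y, z) := fun y hy z => by
    rw [(h y hy 1).2, mul_one]
  refine ⟨U, hU, hx, fun y => Ψ (y, 1), fun b => (Ψ.symm b).2, ?_, fun y hy => (h y hy 1).1, ?_, ?_,
    fun y hy z => ⟨?_, ?_⟩⟩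
  · exact hΨ.comp (contMDiff_id.prodMk contMDiff_const).contMDiffOn fun y hy => h1 y hy 1
  · rw [← ht]
    exact continuous_snd.comp_continuousOn Ψ.continuousOn_symm
  · intro b hb
    have hb' : b ∈ Ψ.target := by rw [ht]; exact hb
    have hmem := Ψ.map_target hb'
    rw [hs] at hmem
    have hp : E.proj i b = (Ψ.symm b).1 := by
      conv_lhs => rw [← Ψ.right_inv hb']
      exact (h _ hmem.1 _).1
    simp only
    rw [h2 _ hb, hp]
    exact Ψ.right_inv hb'
  · simp only
    rw [h2 y hy, Ψ.left_inv (h1 y hy z)]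
  · rw [h2 y hy]
    exact (h y hy z).1

theorem proj_rot (i : ι) (z : Circle) (b : M.X i) : E.proj i (E.rot i z b) = E.proj i b := by
  obtain ⟨U, -, hx, σ, τ, -, -, -, h1, h2⟩ := E.exists_trivialization i (E.proj i b)
  conv_lhs => rw [← h1 b hx, ← E.rot_mul]
  exact (h2 _ hx _).2

theorem rot_inv_eq {i : ι} {b b' : M.X i} {z : Circle} (h : E.rot i z b = b') :
    E.rot i z⁻¹ b' = b := by
  rw [← h, ← E.rot_mul, inv_mul_cancel, E.rot_one]

theorem exists_rot_eq {i : ι} {b b' : M.X i} (h : E.proj i b = E.proj i b') :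
    ∃ z, E.rot i z b = b' := by
  obtain ⟨U, -, hx, σ, τ, -, -, -, h1, h2⟩ := E.exists_trivialization i (E.proj i b)
  refine ⟨τ b' * (τ b)⁻¹, ?_⟩
  have h3 := h1 b' (by rwa [Set.mem_preimage, ← h])
  have h4 := E.rot_inv_eq (h1 b hx)
  rw [E.rot_mul, h4, h, h3]

theorem rot_cancel {i : ι} {b : M.X i} {z z' : Circle} (h : E.rot i z b = E.rot i z' b) : z = z' := by
  obtain ⟨U, -, hx, σ, τ, -, -, -, h1, h2⟩ := E.exists_trivialization i (E.proj i b)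
  rw [← h1 b hx, ← E.rot_mul, ← E.rot_mul] at h
  have := congrArg τ h
  rw [(h2 _ hx _).1, (h2 _ hx _).1] at this
  exact mul_right_cancel this

open Classical in
/-- The element of the circle which moves `b` to the point `b'` of the same fibre. -/
def angle (i : ι) (b b' : M.X i) : Circle :=
  if h : E.proj i b = E.proj i b' then (E.exists_rot_eq h).choose else 1

theorem rot_angle {i : ι} {b b' : M.X i} (h : E.proj i b = E.proj i b') :
    E.rot i (E.angle i b b') b = b' := by
  rw [angle, dif_pos h]
  exact (E.exists_rot_eq h).choose_spec

theorem continuousOn_angle (i : ι) : ContinuousOn (fun a : M.X i × M.X i => E.angle i a.1 a.2)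
    {a | E.proj i a.1 = E.proj i a.2} := by
  have hproj := (E.proj_smooth i).continuous
  refine continuousOn_of_locally_continuousOn fun a _ => ?_
  obtain ⟨U, hU, hx, σ, τ, -, -, hτ, h1, h2⟩ := E.exists_trivialization i (E.proj i a.1)
  refine ⟨{a | E.proj i a.1 ∈ U}, hU.preimage (hproj.comp continuous_fst), hx, ?_⟩
  have hc : ContinuousOn (fun a : M.X i × M.X i => τ a.2 * (τ a.1)⁻¹)
      ({a | E.proj i a.1 = E.proj i a.2} ∩ {a | E.proj i a.1 ∈ U}) :=
    (hτ.comp continuousOn_snd fun b hb => by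
        rw [Set.mem_preimage, ← hb.1]; exact hb.2).mul
      (hτ.comp continuousOn_fst fun b hb => hb.2).inv
  refine hc.congr fun b hb => ?_
  apply E.rot_cancel (b := b.1)
  have h3 := h1 b.2 (by rw [Set.mem_preimage, ← hb.1]; exact hb.2)
  rw [← hb.1] at h3
  simp only
  rw [E.rot_angle hb.1, E.rot_mul, E.rot_inv_eq (h1 b.1 hb.2), h3]

theorem contMDiff_rot (i : ι) (z : Circle) :
    ContMDiff (𝓡 (n + 1)) (𝓡 (n + 1)) ∞ (E.rot i z) :=
  (E.rot_smooth i).comp (contMDiff_const.prodMk contMDiff_id)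

theorem mdifferentiable_rot (i : ι) (z : Circle) :
    MDifferentiable (𝓡 (n + 1)) (𝓡 (n + 1)) (E.rot i z) :=
  (E.contMDiff_rot i z).mdifferentiable (by simp)

theorem mdifferentiable_proj (i : ι) : MDifferentiable (𝓡 (n + 1)) (𝓡 n) (E.proj i) :=
  (E.proj_smooth i).mdifferentiable (by simp)

/-- Surjectivity comes from a smooth local section, rotated so as to pass through b; the rest is
part of the data. -/
theorem isLinearSubmersion (i : ι) (b : M.X i) :
    IsLinearSubmersion ((M.X i).form b) ((N.X i).form (E.proj i b)) n
      (mfderiv (𝓡 (n + 1)) (𝓡 n) (E.proj i) b).toLinearMap where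
  symm := (M.X i).metric.symm b
  surjective w := by
    obtain ⟨U, hU, hx, σ, τ, hσ, hp, -, h1, h2⟩ := E.exists_trivialization i (E.proj i b)
    have hσb : E.rot i (τ b) (σ (E.proj i b)) = b := h1 b hx
    have hd : MDifferentiableAt (𝓡 n) (𝓡 (n + 1)) (fun y => E.rot i (τ b) (σ y)) (E.proj i b) :=
      (E.mdifferentiable_rot i (τ b) _).comp (E.proj i b)
        ((hσ.contMDiffAt (hU.mem_nhds hx)).mdifferentiableAt (by simp))
    have hid : E.proj i ∘ (fun y => E.rot i (τ b) (σ y)) =ᶠ[𝓝 (E.proj i b)] id :=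
      Filter.eventuallyEq_of_mem (hU.mem_nhds hx) fun y hy => (h2 y hy _).2
    have hc := mfderiv_comp_apply_of_eq (E.proj i b) (E.mdifferentiable_proj i b) hd hσb w
    rw [hid.mfderiv_eq, mfderiv_id] at hc
    exact ⟨_, hc.symm⟩
  finrank_source := finrank_tangentSpace b
  finrank_target := finrank_tangentSpace _
  isometric v w h := E.submersion i b v w h

end CircleOrbibundle

/-! ### Rotation of frames and existence of adapted frames -/

namespace CircleOrbibundle

open ORManifold

variable {ι : Type w} {n : ℕ} {M : Orbifold.{u} ι (n + 1)} {N : Orbifold.{u} ι n}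
  (E : CircleOrbibundle M N)

/-- The z for which the rotated frame is positive form a clopen subset of the connected circle, and
it contains 1. -/
theorem isSO_map_rot {i : ι} {t : TangentTuple (n + 1) (M.X i)} (ht : (M.X i).IsSO t) (z : Circle) :
    (M.X i).IsSO (t.map (E.rot i z)) := by
  have hON : ∀ z, IsONTuple ((M.X i).form (t.map (E.rot i z)).pt) (t.map (E.rot i z)).vec :=
    fun z k l => (E.rot_isometric i z t.pt _ _).trans (ht.1 k l)
  refine ⟨hON z, ?_⟩
  let O : Set (TangentTuple (n + 1) (M.X i)) :=
    {t | IsPositiveBasis ((M.X i).orientation t.pt) t.vec}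
  have hO : IsOpen O := (M.X i).orientation_open
  let A : Set Circle := {z | t.map (E.rot i z) ∈ O}
  have hopen : ∀ t : TangentTuple (n + 1) (M.X i), IsOpen {z | t.map (E.rot i z) ∈ O} := fun t =>
    hO.preimage ((TangentTuple.continuous_map_action (E.rot_smooth i)).comp
      (continuous_id.prodMk continuous_const))
  -- The complement is open because it is the same kind of set for the frame with its first vector
  -- negated.
  have hcompl : Aᶜ = {z | (t.mul (flipZero n)).map (E.rot i z) ∈ O} := by
    ext z
    simp only [A, O, Set.mem_compl_iff, Set.mem_ofPred_eq, TangentTuple.map_mul]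
    constructor
    · intro h
      exact (isPositiveBasis_or_flip (hON z).linearIndependent (finrank_tangentSpace _)).resolve_left h
    · intro h h'
      exact not_isPositiveBasis_and_flip ⟨h', h⟩
  have hA : IsClopen A := ⟨⟨by rw [hcompl]; exact hopen _⟩, hopen t⟩
  have h1 : (1 : Circle) ∈ A := by
    have : E.rot i 1 = id := funext (E.rot_one i)
    change t.map (E.rot i 1) ∈ O
    rw [this, TangentTuple.map_id]
    exact ht.2
  have := hA.eq_univ ⟨1, h1⟩
  exact (this ▸ Set.mem_univ z : z ∈ A)

/-- The action of the circle on frames by differentials. -/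
def rotFrame (i : ι) (z : Circle) (e : (M.X i).SOFrame) : (M.X i).SOFrame :=
  ⟨e.1.map (E.rot i z), E.isSO_map_rot e.2 z⟩

theorem isImage_rot_iff {i : ι} {z : Circle} {e e' : (M.X i).SOFrame} :
    SOFrame.IsImage (E.rot i z) e e' ↔ e' = E.rotFrame i z e := by
  rw [SOFrame.isImage_iff]
  exact (Subtype.ext_iff (a1 := e') (a2 := E.rotFrame i z e)).symm

theorem rotFrame_one (i : ι) (e : (M.X i).SOFrame) : E.rotFrame i 1 e = e := by
  apply Subtype.ext
  have : E.rot i 1 = id := funext (E.rot_one i)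
  change e.1.map (E.rot i 1) = e.1
  rw [this, TangentTuple.map_id]

theorem rotFrame_mul (i : ι) (z z' : Circle) (e : (M.X i).SOFrame) :
    E.rotFrame i (z * z') e = E.rotFrame i z (E.rotFrame i z' e) := by
  apply Subtype.ext
  have : E.rot i (z * z') = E.rot i z ∘ E.rot i z' := funext (E.rot_mul i z z')
  change e.1.map (E.rot i (z * z')) = (e.1.map (E.rot i z')).map (E.rot i z)
  rw [this, TangentTuple.map_map (E.mdifferentiable_rot i z' _) (E.mdifferentiable_rot i z _)]

theorem continuous_rotFrame (i : ι) :
    Continuous fun a : Circle × (M.X i).SOFrame => E.rotFrame i a.1 a.2 :=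
  SOFrame.continuous_iff.2 ((TangentTuple.continuous_map_action (E.rot_smooth i)).comp
    (continuous_fst.prodMk (SOFrame.continuous_val.comp continuous_snd)))

theorem rotFrame_isRightMul {i : ι} {e f : (M.X i).SOFrame}
    {A : Matrix (Fin (n + 1)) (Fin (n + 1)) ℝ} (h : e.IsRightMul A f) (z : Circle) :
    (E.rotFrame i z e).IsRightMul A (E.rotFrame i z f) := by
  rw [SOFrame.isRightMul_iff] at h ⊢
  change f.1.map _ = (e.1.map _).mul A
  rw [h, TangentTuple.map_mul]

/-- Every change of charts of M covers one of N, so its domain is a union of fibres and it commutes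
with rotations there; differentiating gives the claim on frames. -/
theorem rotFrame_isImage {i j : ι} {k : OpenPartialHomeomorph (M.X i) (M.X j)}
    (hk : k ∈ M.trans i j) {e : (M.X i).SOFrame} {e' : (M.X j).SOFrame} (he : e.pt ∈ k.source)
    (h : SOFrame.IsImage k e e') (z : Circle) :
    SOFrame.IsImage k (E.rotFrame i z e) (E.rotFrame j z e') := by
  obtain ⟨h', -, hc⟩ := E.trans_descend i j k hk
  rw [SOFrame.isImage_iff] at h ⊢
  change e'.1.map _ = (e.1.map _).map k
  have hs : E.rot i z e.pt ∈ k.source := by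
    rw [hc.source_eq] at he ⊢
    rwa [Set.mem_preimage, E.proj_rot]
  have hiso := M.trans_isometry i j k hk
  rw [h, TangentTuple.map_map (hiso.mdifferentiableAt he) (E.mdifferentiable_rot j z _),
    TangentTuple.map_map (E.mdifferentiable_rot i z _) (hiso.mdifferentiableAt hs)]
  apply TangentTuple.map_congr
  exact Filter.eventuallyEq_of_mem (k.open_source.mem_nhds he) fun b hb =>
    (hc.equivariant b hb z).symm

/-! ### Adapted frames -/

/-- The first vector is vertical and the others project to a positively oriented orthonormal
frame. -/
def IsAdaptedTuple (i : ι) (t : TangentTuple (n + 1) (M.X i)) : Prop :=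
  mfderiv (𝓡 (n + 1)) (𝓡 n) (E.proj i) t.pt (t.vec 0) = 0 ∧ (N.X i).IsSO (t.mapTail (E.proj i))

theorem exists_isAdaptedOver_iff {i : ι} {e : (M.X i).SOFrame} :
    (∃ ε, SOFrame.IsAdaptedOver (E.proj i) e ε) ↔ E.IsAdaptedTuple i e.1 := by
  simp only [SOFrame.isAdaptedOver_iff]
  constructor
  · rintro ⟨ε, h0, h⟩
    refine ⟨h0, ?_⟩
    rw [← h]
    exact ε.2
  · rintro ⟨h0, h⟩
    exact ⟨⟨_, h⟩, h0, rfl⟩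

theorem mapTail_map_rot {i : ι} (t : TangentTuple (n + 1) (M.X i)) (z : Circle) :
    (t.map (E.rot i z)).mapTail (E.proj i) = t.mapTail (E.proj i) := by
  rw [TangentTuple.mapTail_map (E.mdifferentiable_rot i z _) (E.mdifferentiable_proj i _)]
  congr 1
  exact funext (E.proj_rot i z)

theorem mfderiv_proj_rot {i : ι} (b : M.X i) (z : Circle) (v : TangentSpace (𝓡 (n + 1)) b) :
    mfderiv (𝓡 (n + 1)) (𝓡 n) (E.proj i) (E.rot i z b)
      (mfderiv (𝓡 (n + 1)) (𝓡 (n + 1)) (E.rot i z) b v) =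
    mfderiv (𝓡 (n + 1)) (𝓡 n) (E.proj i) b v := by
  have h := mfderiv_comp_apply b (E.mdifferentiable_proj i (E.rot i z b))
    (E.mdifferentiable_rot i z b) v
  have h2 : E.proj i ∘ E.rot i z = E.proj i := funext (E.proj_rot i z)
  rw [h2] at h
  exact h.symm

variable {E}

theorem IsAdaptedTuple.map_rot {i : ι} {t : TangentTuple (n + 1) (M.X i)}
    (ht : E.IsAdaptedTuple i t) (z : Circle) : E.IsAdaptedTuple i (t.map (E.rot i z)) := by
  refine ⟨(E.mfderiv_proj_rot t.pt z (t.vec 0)).trans ht.1, ?_⟩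
  rw [E.mapTail_map_rot]
  exact ht.2

theorem IsAdaptedTuple.mul_blockOne {i : ι} {t : TangentTuple (n + 1) (M.X i)}
    (ht : E.IsAdaptedTuple i t) {A : Matrix (Fin n) (Fin n) ℝ} (hA : A.transpose * A = 1)
    (hdet : 0 < A.det) : E.IsAdaptedTuple i (t.mul (blockOne A)) := by
  refine ⟨?_, ?_⟩
  · rw [TangentTuple.mul_blockOne_vec_zero]
    exact ht.1
  · rw [TangentTuple.mapTail_mul]
    exact (ht.2.mul_iff A).2 ⟨hA, hdet⟩

theorem IsAdaptedTuple.map_trans {i j : ι} {h : OpenPartialHomeomorph (N.X i) (N.X j)}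
    (hh : h ∈ N.trans i j) {k : OpenPartialHomeomorph (M.X i) (M.X j)} (hk : k ∈ M.trans i j)
    (hc : CoversEquivariantly (E.proj i) (E.proj j) (E.rot i) (E.rot j) k h)
    {t : TangentTuple (n + 1) (M.X i)} (ht : E.IsAdaptedTuple i t) (hs : t.pt ∈ k.source) :
    (t.map k).mapTail (E.proj j) = (t.mapTail (E.proj i)).map h ∧
      E.IsAdaptedTuple j (t.map k) := by
  have hs' : E.proj i t.pt ∈ h.source := by rwa [hc.source_eq] at hs
  have hkd := (M.trans_isometry i j k hk).mdifferentiableAt hs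
  have hhd := (N.trans_isometry i j h hh).mdifferentiableAt hs'
  have hev : E.proj j ∘ k =ᶠ[𝓝 t.pt] h ∘ E.proj i :=
    Filter.eventuallyEq_of_mem (k.open_source.mem_nhds hs) fun b hb => hc.covers b hb
  have h1 : (t.map k).mapTail (E.proj j) = (t.mapTail (E.proj i)).map h := by
    rw [TangentTuple.mapTail_map hkd (E.mdifferentiable_proj j _),
      TangentTuple.map_mapTail (E.mdifferentiable_proj i _) hhd]
    exact TangentTuple.mapTail_congr hev
  refine ⟨h1, ?_, ?_⟩
  · have h2 := mfderiv_comp_apply t.pt (E.mdifferentiable_proj j (k t.pt)) hkd (t.vec 0)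
    rw [hev.mfderiv_eq] at h2
    refine h2.symm.trans ?_
    refine (mfderiv_comp_apply t.pt hhd (E.mdifferentiable_proj i t.pt) (t.vec 0)).trans ?_
    rw [ht.1]
    exact map_zero _
  · rw [h1]
    exact (N.trans_isometry i j h hh).isSO_map ht.2 hs'

/-- Two adapted frames at the same point differ by an element of `SO(n)`. -/
theorem IsAdaptedTuple.exists_eq_mul {i : ι} {t t' : TangentTuple (n + 1) (M.X i)}
    (ht : E.IsAdaptedTuple i t) (ht' : E.IsAdaptedTuple i t') (hso : (M.X i).IsSO t)
    (hso' : (M.X i).IsSO t') (hpt : t.pt = t'.pt) :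
    ∃ A : Matrix (Fin n) (Fin n) ℝ, t' = t.mul (blockOne A) ∧ A.transpose * A = 1 ∧ 0 < A.det := by
  obtain ⟨C, rfl, hC, hdet⟩ := hso.exists_eq_mul hso' hpt
  have hL := E.isLinearSubmersion i t.pt
  -- Both first vectors lie in the one-dimensional vertical space, so the first column of C is a
  -- multiple a of e₀.
  obtain ⟨a, ha⟩ := ker_le_span_singleton hL.surjective hL.finrank_source hL.finrank_target
    ht.1 (hso.1.linearIndependent.ne_zero 0) (y := (t.mul C).vec 0) ht'.1
  have hcol : ∀ k, C k 0 = if k = 0 then a else 0 := by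
    have h1 : ∑ k, (C k 0 - if k = 0 then a else 0) • t.vec k = 0 := by
      simp only [sub_smul, Finset.sum_sub_distrib, ite_smul, zero_smul, Finset.sum_ite_eq',
        Finset.mem_univ, if_true]
      exact sub_eq_zero.2 ha
    intro k
    exact sub_eq_zero.1 (Fintype.linearIndependent_iff.1 hso.1.linearIndependent _ h1 k)
  -- The first row of CᵀC = 1: it gives a² = 1 and forces the rest of the first row of C to vanish.
  have hprod : ∀ l, a * C 0 l = if 0 = l then 1 else 0 := by
    intro l
    have := congrFun (congrFun hC 0) l
    simpa [Matrix.mul_apply, hcol, Matrix.one_apply] using this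
  have haa : a * a = 1 := by simpa [hcol] using hprod 0
  have ha0 : a ≠ 0 := by rintro rfl; simp at haa
  have hrow : ∀ l : Fin n, C 0 l.succ = 0 := fun l => by
    have := hprod l.succ
    rw [if_neg (Fin.succ_ne_zero l).symm] at this
    exact (mul_eq_zero.1 this).resolve_left ha0
  set A := C.submatrix Fin.succ Fin.succ with hA
  have hSO := ht'.2
  rw [TangentTuple.mapTail_mul_of_row_zero _ _ hrow, ht.2.mul_iff] at hSO
  have hdet2 : C.det = a * A.det := by
    rw [Matrix.det_succ_row_zero, Fin.sum_univ_succ]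
    simp [hrow, hcol]
    exact .inl rfl
  -- Positivity of both frames on M and of both projections on N leaves only a = 1: this is where
  -- the direction of the vertical vector is fixed.
  have hapos : 0 < a := by
    rw [hdet2] at hdet
    exact (pos_iff_pos_of_mul_pos hdet).2 hSO.2
  have ha1 : a = 1 := by nlinarith
  have hCA : C = blockOne A := by
    ext k l
    refine Fin.cases ?_ (fun k => ?_) k
    · refine Fin.cases ?_ (fun l => ?_) l
      · simp [hcol, ha1]
      · simp [hrow]
    · refine Fin.cases ?_ (fun l => ?_) l
      · simp [hcol]
      · rfl
  exact ⟨A, by rw [← hCA], hSO⟩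

/-- The kernel of the differential is nonzero for reasons of dimension; normalize a vector in it and
expand it in the frame. -/
theorem exists_vertical_coeff (E : CircleOrbibundle M N) {i : ι}
    {t : TangentTuple (n + 1) (M.X i)} (ht : (M.X i).IsSO t) :
    ∃ c : Fin (n + 1) → ℝ, ∑ k, c k ^ 2 = 1 ∧ -1 < c 0 ∧
      mfderiv (𝓡 (n + 1)) (𝓡 n) (E.proj i) t.pt (∑ k, c k • t.vec k) = 0 := by
  have hL := E.isLinearSubmersion i t.pt
  set g := (M.X i).form t.pt with hg
  have hON := ht.1
  have hfin : FiniteDimensional ℝ (TangentSpace (𝓡 n) (E.proj i t.pt)) :=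
    inferInstanceAs (FiniteDimensional ℝ (EuclideanSpace ℝ (Fin n)))
  obtain ⟨v, hv, hv0⟩ := exists_ker_ne_zero (L := (mfderiv (𝓡 (n + 1)) (𝓡 n) (E.proj i) t.pt).toLinearMap)
    hL.finrank_source hL.finrank_target
  have hpos : 0 < g v v := (M.X i).metric.pos t.pt v hv0
  -- The sign of r makes the coefficient along the first frame vector nonnegative, so the antipode
  -- -e₀ excluded by `tilt` does not occur.
  obtain ⟨r, hr, hr0⟩ : ∃ r : ℝ, r * r * g v v = 1 ∧ 0 ≤ r * g v (t.vec 0) := by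
    have h1 : (Real.sqrt (g v v))⁻¹ * (Real.sqrt (g v v))⁻¹ * g v v = 1 := by
      rw [← mul_inv, Real.mul_self_sqrt hpos.le, inv_mul_cancel₀ hpos.ne']
    rcases le_total 0 (g v (t.vec 0)) with h | h
    · exact ⟨_, h1, mul_nonneg (inv_nonneg.2 (Real.sqrt_nonneg _)) h⟩
    · refine ⟨-(Real.sqrt (g v v))⁻¹, by rw [neg_mul_neg, h1], ?_⟩
      exact mul_nonneg_of_nonpos_of_nonpos (neg_nonpos.2 (inv_nonneg.2 (Real.sqrt_nonneg _))) h
  have hsum := hON.sum_smul (finrank_tangentSpace t.pt) (r • v)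
  refine ⟨fun k => g (r • v) (t.vec k), ?_, ?_, ?_⟩
  · have h1 : g (r • v) (r • v) = 1 := by
      simp only [map_smul, LinearMap.smul_apply, smul_eq_mul]
      rw [← mul_assoc, hr]
    have h2 := congrArg (g (r • v)) hsum
    rw [map_sum, h1] at h2
    rw [← h2]
    exact Finset.sum_congr rfl fun k _ =>
      (pow_two _).trans ((g (r • v)).map_smul _ _).symm
  · simp only [map_smul, LinearMap.smul_apply, smul_eq_mul]
    linarith
  · exact (congrArg (mfderiv (𝓡 (n + 1)) (𝓡 n) (E.proj i) t.pt) hsum).trans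
      ((map_smul (mfderiv (𝓡 (n + 1)) (𝓡 n) (E.proj i) t.pt) r v).trans
        ((congrArg (r • ·) hv).trans (smul_zero r)))

/-- The diagonal matrix with first two entries `-1` and all other entries `1`. -/
def flipTwo (m : ℕ) : Matrix (Fin (m + 2)) (Fin (m + 2)) ℝ :=
  Matrix.diagonal (Fin.cons (-1) (Fin.cons (-1) fun _ => 1))

theorem flipTwo_transpose_mul_self (m : ℕ) : (flipTwo m).transpose * flipTwo m = 1 := by
  rw [flipTwo, Matrix.diagonal_transpose, Matrix.diagonal_mul_diagonal, ← Matrix.diagonal_one]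
  congr 1
  funext k
  refine Fin.cases ?_ (fun k => Fin.cases ?_ (fun k => ?_) k) k <;> simp

theorem det_flipTwo (m : ℕ) : (flipTwo m).det = 1 := by
  simp [flipTwo, Matrix.det_diagonal, Fin.prod_univ_succ]

/-- With the first vector vertical, the others project to an orthonormal frame of N. If that frame
is negative, negating the first two vectors corrects it without changing the orientation on M; this
needs a second vector, hence base dimension m + 1. -/
theorem isAdaptedTuple_or_flipTwo {m : ℕ} {M : Orbifold.{u} ι (m + 2)} {N : Orbifold.{u} ι (m + 1)}
    (E : CircleOrbibundle M N) {i : ι} {t : TangentTuple (m + 2) (M.X i)} (ht : (M.X i).IsSO t)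
    (h0 : mfderiv (𝓡 (m + 2)) (𝓡 (m + 1)) (E.proj i) t.pt (t.vec 0) = 0) :
    E.IsAdaptedTuple i t ∨ E.IsAdaptedTuple i (t.mul (flipTwo m)) := by
  have hON := (E.isLinearSubmersion i t.pt).isONTuple_tail ht.1 h0
  have htail : (t.mul (flipTwo m)).mapTail (E.proj i) =
      (t.mapTail (E.proj i)).mul (flipZero m) := by
    rw [TangentTuple.mapTail_mul_of_row_zero _ _ fun l => ?_]
    · congr 1
      ext k l
      simp [flipTwo, flipZero, Matrix.diagonal_apply]
    · simp [flipTwo, (Fin.succ_ne_zero l).symm]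
  rcases isPositiveBasis_or_flip (o := (N.X i).orientation (E.proj i t.pt)) hON.linearIndependent
    (finrank_tangentSpace _) with h | h
  · exact .inl ⟨h0, hON, h⟩
  · refine .inr ⟨?_, ?_⟩
    · have h1 : (t.mul (flipTwo m)).vec 0 = (-1 : ℝ) • t.vec 0 := by
        change ∑ k, flipTwo m k 0 • t.vec k = _
        rw [Fin.sum_univ_succ]
        simp [flipTwo]
      rw [h1]
      exact (map_smul (mfderiv (𝓡 (m + 2)) (𝓡 (m + 1)) (E.proj i) t.pt) _ _).trans
        ((congrArg _ h0).trans (smul_zero _))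
    · rw [htail]
      refine ⟨(hON.mul_iff _).2 ?_, h⟩
      rw [flipZero_transpose, flipZero_mul_self]

/-- The vertical component of the `0`-th vector of the frame `t`, written in this frame. -/
def verticalCoeff (E : CircleOrbibundle M N) (i : ι) (t : TangentTuple (n + 1) (M.X i)) :
    Fin (n + 1) → ℝ := fun k =>
  (if k = 0 then 1 else 0) - (N.X i).scal (E.proj i t.pt)
    (mfderiv (𝓡 (n + 1)) (𝓡 n) (E.proj i) t.pt (t.vec k))
    (mfderiv (𝓡 (n + 1)) (𝓡 n) (E.proj i) t.pt (t.vec 0))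

theorem continuous_verticalCoeff (E : CircleOrbibundle M N) (i : ι) :
    Continuous (E.verticalCoeff i) :=
  continuous_pi fun k => continuous_const.sub (continuous_scal_differential (E.proj_smooth i) k 0)

/-- For a unit vertical vector v = ∑ c_k e_k, the coefficients are c₀ c_k, that is, those of c₀ v.
They do not change under v ↦ -v, so no choice of v is needed and they vary continuously with the
frame. -/
theorem mfderiv_verticalCoeff (E : CircleOrbibundle M N) {i : ι}
    {t : TangentTuple (n + 1) (M.X i)} (ht : (M.X i).IsSO t) :
    mfderiv (𝓡 (n + 1)) (𝓡 n) (E.proj i) t.pt (∑ k, E.verticalCoeff i t k • t.vec k) = 0 := by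
  obtain ⟨c, hc, -, hv⟩ := E.exists_vertical_coeff ht
  have hL := E.isLinearSubmersion i t.pt
  have hON := ht.1
  set g := (M.X i).form t.pt with hg
  set v := ∑ k, c k • t.vec k with hvdef
  have hON' : ∀ k l, g (t.vec k) (t.vec l) = if k = l then 1 else 0 := hON
  have hcoeff : ∀ k, g v (t.vec k) = c k := by
    intro k
    rw [hvdef]
    simp [hON']
  have hvv : g v v = 1 := by
    have h1 := congrArg (g v) hvdef
    simp only [map_sum, map_smul, hcoeff, smul_eq_mul, ← pow_two] at h1
    exact h1.trans hc
  have h1 : ∀ k, E.verticalCoeff i t k = c 0 * c k := by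
    intro k
    have h2 := hL.apply_apply hv hvv (t.vec k) (t.vec 0)
    rw [hON', hL.symm _ v, hL.symm _ v, hcoeff, hcoeff] at h2
    have h3 : E.verticalCoeff i t k = (if k = 0 then 1 else 0) -
      ((if k = 0 then 1 else 0) - c k * c 0) := congrArg _ h2
    rw [h3]
    ring
  have h4 : ∑ k, E.verticalCoeff i t k • t.vec k = c 0 • v := by
    simp only [h1, hvdef, Finset.smul_sum, smul_smul]
  rw [h4]
  exact (map_smul (mfderiv (𝓡 (n + 1)) (𝓡 n) (E.proj i) t.pt) _ _).trans
    ((congrArg _ hv).trans (smul_zero _))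

theorem verticalCoeff_of_isAdaptedTuple (E : CircleOrbibundle M N) {i : ι}
    {t : TangentTuple (n + 1) (M.X i)} (ht : E.IsAdaptedTuple i t) :
    E.verticalCoeff i t = Pi.single 0 1 := by
  have h0 : mfderiv (𝓡 (n + 1)) (𝓡 n) (E.proj i) t.pt (t.vec 0) = 0 := ht.1
  funext k
  simp only [verticalCoeff, h0, scal, map_zero, sub_zero]
  exact (Pi.single_apply 0 (1 : ℝ) k).symm

end CircleOrbibundle

/-! ### Deck transformations of spin structures -/

namespace SpinStructure

open ORManifold

variable {ι : Type w} {n : ℕ} {O : Orbifold.{u} ι (n + 1)} (S : SpinStructure.{u, v, w} O) {i : ι}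

theorem frame_act_val (p : S.P i) (s : Spin (n + 1)) :
    (S.frame i (S.act i p s)).1 = (S.frame i p).1.mul (spinMatrix s) :=
  SOFrame.isRightMul_iff.1 (S.frame_act i p s)

theorem frame_act_negOne (p : S.P i) : S.frame i (S.act i p (spinNegOne n)) = S.frame i p :=
  Subtype.ext (by rw [frame_act_val, spinMatrix_negOne, TangentTuple.mul_one])

theorem act_negOne_ne (p : S.P i) : S.act i p (spinNegOne n) ≠ p := by
  intro h
  rw [← (S.principal i).act_one p, ← (S.principal i).act_mul] at h
  exact spinNegOne_ne_one n ((one_mul _).symm.trans ((S.principal i).act_cancel h))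

/-- The distinct points p and p·(-1) lie over the same frame and already exhaust its two preimages.
-/
theorem eq_or_eq_act_negOne {p q : S.P i} (h : S.frame i q = S.frame i p) :
    q = p ∨ q = S.act i p (spinNegOne n) := by
  have hsub : {p, S.act i p (spinNegOne n)} ⊆ S.frame i ⁻¹' {S.frame i p} := by
    rintro r (rfl | rfl)
    · rfl
    · exact S.frame_act_negOne p
  have hcard := S.two_sheeted i (S.frame i p)
  have heq := Set.eq_of_subset_of_ncard_le hsub
    (by rw [hcard, Set.ncard_pair (S.act_negOne_ne p).symm])
    (Set.finite_of_ncard_ne_zero (by rw [hcard]; norm_num))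
  have hq : q ∈ S.frame i ⁻¹' {S.frame i p} := h
  rw [← heq] at hq
  exact hq

theorem act_negOne_act_negOne (p : S.P i) :
    S.act i (S.act i p (spinNegOne n)) (spinNegOne n) = p := by
  rw [← (S.principal i).act_mul, spinNegOne_mul_self, (S.principal i).act_one]

end SpinStructure

/-! ### The flow on the spin frame bundle -/

namespace CircleOrbibundle

open ORManifold unitInterval

variable {ι : Type w} {n : ℕ} {M : Orbifold.{u} ι (n + 1)} {N : Orbifold.{u} ι n}
  (E : CircleOrbibundle M N) (S : SpinStructure.{u, v, w} M)

/-- The rotation of spin frames by a part of a given angle, as a homotopy of frames. -/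
def rotHomotopy (i : ι) : C(I × (ℝ × S.P i), (M.X i).SOFrame) where
  toFun a := E.rotFrame i (Circle.exp (a.1 * a.2.1)) (S.frame i a.2.2)
  continuous_toFun := (E.continuous_rotFrame i).comp
    ((Circle.exp.continuous.comp ((continuous_subtype_val.comp continuous_fst).mul
      (continuous_fst.comp continuous_snd))).prodMk
      ((S.frame_continuous i).comp (continuous_snd.comp continuous_snd)))

theorem rotHomotopy_zero (i : ι) (a : ℝ × S.P i) :
    E.rotHomotopy S i (0, a) = S.frame i ((⟨Prod.snd, continuous_snd⟩ : C(ℝ × S.P i, S.P i)) a) := by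
  change E.rotFrame i (Circle.exp (((0 : I) : ℝ) * a.1)) _ = _
  rw [Set.Icc.coe_zero, zero_mul, Circle.exp_zero, E.rotFrame_one]
  rfl

/-- The lift to the spin frame bundle of the rotation of frames by a given angle. -/
def flow (i : ι) (t : ℝ) (p : S.P i) : S.P i :=
  (S.covering i).liftHomotopy (E.rotHomotopy S i) ⟨Prod.snd, continuous_snd⟩
    (E.rotHomotopy_zero S i) (1, (t, p))

variable {i : ι}

theorem continuous_flow : Continuous fun a : ℝ × S.P i => E.flow S i a.1 a.2 :=
  (ContinuousMap.continuous _).comp (continuous_const.prodMk continuous_id)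

theorem frame_flow (t : ℝ) (p : S.P i) :
    S.frame i (E.flow S i t p) = E.rotFrame i (Circle.exp t) (S.frame i p) := by
  have h := congrFun ((S.covering i).liftHomotopy_lifts (E.rotHomotopy S i) _
    (E.rotHomotopy_zero S i)) (1, (t, p))
  refine h.trans ?_
  change E.rotFrame i (Circle.exp (((1 : I) : ℝ) * t)) _ = _
  rw [Set.Icc.coe_one, one_mul]

/-- At angle 0 the homotopy of frames is constant in its parameter, and so is its lift, by
uniqueness on the connected interval. -/
theorem flow_zero (p : S.P i) : E.flow S i 0 p = p := by
  let L := (S.covering i).liftHomotopy (E.rotHomotopy S i) ⟨Prod.snd, continuous_snd⟩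
    (E.rotHomotopy_zero S i)
  have hL : ∀ s : I, S.frame i (L (s, (0, p))) = S.frame i p := by
    intro s
    refine (congrFun ((S.covering i).liftHomotopy_lifts (E.rotHomotopy S i) _
      (E.rotHomotopy_zero S i)) (s, (0, p))).trans ?_
    change E.rotFrame i (Circle.exp ((s : ℝ) * 0)) _ = _
    rw [mul_zero, Circle.exp_zero, E.rotFrame_one]
  have h := (S.covering i).eq_of_comp_eq (g₁ := fun s : I => L (s, (0, p))) (g₂ := fun _ => p)
    (by fun_prop) continuous_const (funext hL) 0
    ((S.covering i).liftHomotopy_zero (E.rotHomotopy S i) _ (E.rotHomotopy_zero S i) (0, p))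
  exact congrFun h 1

attribute [irreducible] flow

/-- Reduces each identity for the flow to the corresponding identity for frames together with the
case of time 0. -/
theorem eq_of_lifts {g₁ g₂ : ℝ → S.P i} (h₁ : Continuous g₁) (h₂ : Continuous g₂)
    (h : ∀ t, S.frame i (g₁ t) = S.frame i (g₂ t)) (h0 : g₁ 0 = g₂ 0) (t : ℝ) : g₁ t = g₂ t :=
  congrFun ((S.covering i).eq_of_comp_eq h₁ h₂ (funext h) 0 h0) t

theorem continuous_flow_left (p : S.P i) : Continuous fun t => E.flow S i t p :=
  (E.continuous_flow S).comp (f := fun t : ℝ => (t, p)) (continuous_id.prodMk continuous_const)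

theorem flow_add (t t' : ℝ) (p : S.P i) :
    E.flow S i (t + t') p = E.flow S i t (E.flow S i t' p) := by
  refine eq_of_lifts S (g₁ := fun t => E.flow S i (t + t') p)
    ((E.continuous_flow_left S p).comp (continuous_id.add continuous_const))
    (E.continuous_flow_left S _) (fun t => ?_) ?_ t
  · rw [frame_flow, frame_flow, frame_flow, ← E.rotFrame_mul, Circle.exp_add]
  · simp only [zero_add, flow_zero]

theorem flow_act (t : ℝ) (p : S.P i) (s : Spin (n + 1)) :
    E.flow S i t (S.act i p s) = S.act i (E.flow S i t p) s := by
  refine eq_of_lifts S (E.continuous_flow_left S _)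
    (g₂ := fun t => S.act i (E.flow S i t p) s)
    ((S.principal i).continuous_act.comp ((E.continuous_flow_left S p).prodMk continuous_const))
    (fun t => ?_) ?_ t
  · have h1 := S.frame_act i (E.flow S i t p) s
    have h2 := E.rotFrame_isRightMul (S.frame_act i p s) (Circle.exp t)
    rw [frame_flow] at h1
    rw [frame_flow]
    rw [SOFrame.isRightMul_iff] at h1 h2
    exact Subtype.ext (h2.trans h1.symm)
  · simp only [flow_zero]

theorem pt_flow_mem_source {j : ι} {k : OpenPartialHomeomorph (M.X i) (M.X j)}
    (hk : k ∈ M.trans i j) {p : S.P i} (hp : (S.frame i p).pt ∈ k.source) (t : ℝ) :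
    (S.frame i (E.flow S i t p)).pt ∈ k.source := by
  obtain ⟨h', -, hc⟩ := E.trans_descend i j k hk
  rw [frame_flow]
  change E.rot i _ (S.frame i p).pt ∈ _
  rw [hc.source_eq] at hp ⊢
  rwa [Set.mem_preimage, E.proj_rot]

/-- The flow does not leave the domain of k, which is a union of circle orbits, so both sides are
lifts defined for all times. -/
theorem flow_lift {j : ι} {k : OpenPartialHomeomorph (M.X i) (M.X j)} (hk : k ∈ M.trans i j)
    {p : S.P i} (hp : (S.frame i p).pt ∈ k.source) (t : ℝ) :
    E.flow S j t (S.lift k p) = S.lift k (E.flow S i t p) := by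
  refine eq_of_lifts S (E.continuous_flow_left S _) (g₂ := fun t => S.lift k (E.flow S i t p))
    ((S.lift_continuous i j k hk).comp_continuous (E.continuous_flow_left S p)
      (E.pt_flow_mem_source S hk hp)) (fun t => ?_) ?_ t
  · have h1 := S.lift_frame i j k hk _ (E.pt_flow_mem_source S hk hp t)
    have h2 := E.rotFrame_isImage hk hp (S.lift_frame i j k hk p hp) (Circle.exp t)
    rw [frame_flow] at h1
    rw [frame_flow]
    rw [SOFrame.isImage_iff] at h1 h2
    exact Subtype.ext (h2.trans h1.symm)
  · simp only [flow_zero]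

theorem flow_two_pi (p : S.P i) : E.flow S i (2 * Real.pi) p = p ∨
    E.flow S i (2 * Real.pi) p = S.act i p (spinNegOne n) :=
  S.eq_or_eq_act_negOne (by rw [frame_flow, Circle.exp_two_pi, E.rotFrame_one])

/-- The two alternatives define open sets, because two lifts through a covering agree on an open
set. Their images cover the connected chart. -/
theorem flow_two_pi_chart (i : ι) : (∀ p : S.P i, E.flow S i (2 * Real.pi) p = p) ∨
    ∀ p : S.P i, E.flow S i (2 * Real.pi) p = S.act i p (spinNegOne n) := by
  have hcont : Continuous (E.flow S i (2 * Real.pi)) :=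
    (E.continuous_flow S).comp (f := fun p : S.P i => (2 * Real.pi, p))
      (continuous_const.prodMk continuous_id)
  have hframe : ∀ p, S.frame i (E.flow S i (2 * Real.pi) p) = S.frame i p := fun p => by
    rw [frame_flow, Circle.exp_two_pi, E.rotFrame_one]
  have hA : IsOpen {p : S.P i | E.flow S i (2 * Real.pi) p = p} :=
    (S.covering i).isLocalHomeomorph.isLocallyInjective.isOpen_eqLocus hcont continuous_id
      (funext hframe)
  have hB : IsOpen {p : S.P i | E.flow S i (2 * Real.pi) p = S.act i p (spinNegOne n)} :=
    (S.covering i).isLocalHomeomorph.isLocallyInjective.isOpen_eqLocus hcont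
      ((S.principal i).continuous_act.comp (continuous_id.prodMk continuous_const))
      (funext fun p => (hframe p).trans (S.frame_act_negOne p).symm)
  have hconn := M.X_connected i
  set pr : S.P i → M.X i := fun p => (S.frame i p).pt with hpr
  have hopen := (S.principal i).isOpenMap_proj
  -- The flow commutes with the transitive action on a fibre, so the alternative depends only on the
  -- base point.
  have hdisj : ∀ p q : S.P i, pr p = pr q → E.flow S i (2 * Real.pi) p = p →
      E.flow S i (2 * Real.pi) q = q := by
    intro p q hpq hp
    obtain ⟨s, rfl⟩ := (S.principal i).exists_act_eq hpq
    rw [flow_act, hp]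
  have hcover : (Set.univ : Set (M.X i)) ⊆ pr '' {p | E.flow S i (2 * Real.pi) p = p} ∪
      pr '' {p | E.flow S i (2 * Real.pi) p = S.act i p (spinNegOne n)} := by
    intro b _
    obtain ⟨p, hp⟩ := (S.principal i).proj_surjective b
    exact (E.flow_two_pi S p).imp (fun h => ⟨p, h, hp⟩) fun h => ⟨p, h, hp⟩
  rcases Set.eq_empty_or_nonempty {p : S.P i | E.flow S i (2 * Real.pi) p = p} with h1 | ⟨p, hp⟩
  · exact .inr fun p => (E.flow_two_pi S p).resolve_left fun h =>
      (Set.eq_empty_iff_forall_notMem.1 h1 p) h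
  · refine .inl fun q => (E.flow_two_pi S q).resolve_right fun hq => ?_
    obtain ⟨b, -, ⟨p', hp', hb⟩, ⟨q', hq', hb'⟩⟩ := isPreconnected_univ _ _ (hopen _ hA) (hopen _ hB)
      hcover ⟨pr p, trivial, p, hp, rfl⟩ ⟨pr q, trivial, q, hq, rfl⟩
    have := hdisj p' q' (hb.trans hb'.symm) hp'
    exact S.act_negOne_ne q' (Eq.trans (Eq.symm hq') this)

/-- A change of charts of N through the common point lifts to M and then to spin frames, and it
intertwines the flows; one spin frame in its domain decides for the entire second chart. -/
theorem flow_two_pi_overlap {j : ι} {x : N.X i} {y : N.X j} (h : N.q i x = N.q j y)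
    (hi : ∀ p : S.P i, E.flow S i (2 * Real.pi) p = p) (q : S.P j) :
    E.flow S j (2 * Real.pi) q = q := by
  obtain ⟨φ, hφ, hx, -⟩ := N.trans_exists i j x y h
  obtain ⟨k, hk, hc⟩ := E.trans_lift i j φ hφ
  obtain ⟨U, -, hxU, b, τ, -, hb₀, -⟩ := E.exists_trivialization i x
  have hb : b x ∈ k.source := by rwa [hc.source_eq, Set.mem_preimage, hb₀ x hxU]
  obtain ⟨p, hp⟩ := (S.principal i).proj_surjective (b x)
  have hps : (S.frame i p).pt ∈ k.source := by
    have hp' : (S.frame i p).pt = b x := hp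
    rw [hp']
    exact hb
  have h1 := E.flow_lift S hk hps (2 * Real.pi)
  rw [hi p] at h1
  rcases E.flow_two_pi_chart S j with h2 | h2
  · exact h2 q
  · exact absurd ((h2 _).symm.trans h1) (S.act_negOne_ne _)

/-- The chart images of the two kinds are open sets covering the connected space of N; if both kinds
occurred they would meet, against the comparison on overlaps. -/
theorem flow_two_pi_global [ConnectedSpace N.space] :
    (∀ i (p : S.P i), E.flow S i (2 * Real.pi) p = p) ∨
      ∀ i (p : S.P i), E.flow S i (2 * Real.pi) p = S.act i p (spinNegOne n) := by
  let good : ι → Prop := fun i => ∀ p : S.P i, E.flow S i (2 * Real.pi) p = p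
  let A : Set N.space := ⋃ (i : ι) (_ : good i), Set.range (N.q i)
  let B : Set N.space := ⋃ (i : ι) (_ : ¬ good i), Set.range (N.q i)
  have hA : IsOpen A := isOpen_biUnion fun i _ => (N.q_open i).isOpen_range
  have hB : IsOpen B := isOpen_biUnion fun i _ => (N.q_open i).isOpen_range
  by_cases h : ∀ i, good i
  · exact .inl h
  right
  push Not at h
  obtain ⟨i₀, hi₀⟩ := h
  intro i
  refine (E.flow_two_pi_chart S i).resolve_left fun hi => ?_
  have hne : ∀ i, Nonempty (N.X i) := fun i => (N.X_connected i).toNonempty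
  obtain ⟨p, -, hpA, hpB⟩ := isPreconnected_univ A B hA hB (fun p _ => by
      obtain ⟨j, x, hx⟩ := N.q_cover p
      by_cases hj : good j
      · exact .inl (Set.mem_biUnion (show good j from hj) ⟨x, hx⟩)
      · exact .inr (Set.mem_biUnion (show ¬ good j from hj) ⟨x, hx⟩))
    ⟨N.q i (hne i).some, trivial, Set.mem_biUnion (show good i from hi) ⟨_, rfl⟩⟩
    ⟨N.q i₀ (hne i₀).some, trivial, Set.mem_biUnion (show ¬ good i₀ from hi₀) ⟨_, rfl⟩⟩
  simp only [A, B, Set.mem_iUnion] at hpA hpB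
  obtain ⟨j, hj, x, hx⟩ := hpA
  obtain ⟨l, hl, y, hy⟩ := hpB
  exact hl (E.flow_two_pi_overlap S (hx.trans hy.symm) hj)

/-- If the flow has period `2πd`, then it is an action of the `d`-fold covering of the circle. -/
def coverActionOfPeriod (d : ℕ) (h : ∀ i (p : S.P i), E.flow S i (d * (2 * Real.pi)) p = p) :
    E.CoverAction S d :=
  have hint : ∀ (m : ℤ) i (p : S.P i), E.flow S i (d * (m * (2 * Real.pi))) p = p := by
    intro m i p
    have hnat : ∀ (m : ℕ) (p : S.P i), E.flow S i (d * (m * (2 * Real.pi))) p = p := by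
      intro m
      induction m with
      | zero => intro p; simp [flow_zero]
      | succ m ih =>
        intro p
        have : (d : ℝ) * ((m + 1 : ℕ) * (2 * Real.pi)) =
            d * (m * (2 * Real.pi)) + d * (2 * Real.pi) := by push_cast; ring
        rw [this, flow_add, h, ih]
    obtain ⟨m, rfl | rfl⟩ := m.eq_nat_or_neg
    · exact hnat m p
    · have h1 := E.flow_add S (d * ((-(m : ℤ) : ℤ) * (2 * Real.pi))) (d * (m * (2 * Real.pi))) p
      rw [hnat] at h1
      rw [← h1]
      push_cast
      ring_nf
      exact E.flow_zero S p
  -- By periodicity, any real angle t of z may replace arg z, which removes the branch from all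
  -- later verifications.
  have hκ : ∀ (t : ℝ) i (p : S.P i),
      E.flow S i (d * Complex.arg (Circle.exp t)) p = E.flow S i (d * t) p := by
    intro t i p
    obtain ⟨m, hm⟩ := Circle.exp_eq_exp.1 (Circle.exp_arg (Circle.exp t))
    rw [hm, mul_add, flow_add, hint]
  { κ := fun i z p => E.flow S i (d * Complex.arg z) p
    continuous_κ := fun i => by
      -- Since arg is discontinuous, continuity is checked after pulling back along the quotient map
      -- ℝ × P → S¹ × P.
      have hq : Topology.IsQuotientMap (Prod.map Circle.exp (id : S.P i → S.P i)) :=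
        (isLocalHomeomorph_circleExp.isOpenMap.prodMap IsOpenMap.id).isQuotientMap
          (Circle.exp.continuous.prodMap continuous_id)
          (Circle.exp_surjective.prodMap Function.surjective_id)
      rw [hq.continuous_iff]
      refine ((E.continuous_flow S).comp (f := fun a : ℝ × S.P i => ((d : ℝ) * a.1, a.2))
        (by fun_prop)).congr fun a => ?_
      exact (hκ a.1 i a.2).symm
    κ_one := fun i p => by
      rw [← Circle.exp_zero, hκ, mul_zero, flow_zero]
    κ_mul := fun i z z' p => by
      obtain ⟨t, rfl⟩ := Circle.exp_surjective z
      obtain ⟨t', rfl⟩ := Circle.exp_surjective z'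
      rw [← Circle.exp_add, hκ, hκ, hκ, mul_add, flow_add]
    κ_frame := fun i z p => by
      rw [isImage_rot_iff, frame_flow, ← nsmul_eq_mul, Circle.exp_nsmul, Circle.exp_arg]
    κ_act := fun i z p s => E.flow_act S _ p s
    κ_lift := fun i j k hk p hp z => E.flow_lift S hk hp _ }

/-- A flow with period 2π would be a cover action with d = 1, which nonprojectability excludes. The
other alternative, used twice, gives period 4π since (-1)² = 1. -/
theorem exists_coverAction_two [ConnectedSpace N.space] (hS : ¬ E.IsProjectable S) :
    ∃ a : E.CoverAction S 2, ∀ i (p : S.P i), a.κ i (-1) p = S.act i p (spinNegOne n) := by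
  have hneg := (E.flow_two_pi_global S).resolve_left fun h =>
    hS ⟨E.coverActionOfPeriod S 1 fun i p => by rw [Nat.cast_one, one_mul, h]⟩
  refine ⟨E.coverActionOfPeriod S 2 fun i p => ?_, fun i p => ?_⟩
  · rw [Nat.cast_two, two_mul, flow_add, hneg, hneg, S.act_negOne_act_negOne]
  · change E.flow S i ((2 : ℕ) * Complex.arg ((-1 : Circle) : ℂ)) p = _
    rw [Circle.coe_neg, Circle.coe_one, Complex.arg_neg_one, Nat.cast_two, hneg]

end CircleOrbibundle

/-! ### The rotation of `e₀` to a given direction -/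

theorem normalized_mem {n : ℕ} {c : Fin (n + 1) → ℝ} (h : 0 < c 0) :
    (∑ k, ((Real.sqrt (∑ k, c k ^ 2))⁻¹ • c) k ^ 2) = 1 ∧
      -1 < ((Real.sqrt (∑ k, c k ^ 2))⁻¹ • c) 0 := by
  have hpos : 0 < ∑ k, c k ^ 2 := Finset.sum_pos' (fun k _ => sq_nonneg _)
    ⟨0, Finset.mem_univ _, by positivity⟩
  refine ⟨?_, ?_⟩
  · simp only [Pi.smul_apply, smul_eq_mul, mul_pow, inv_pow, Real.sq_sqrt hpos.le]
    rw [← Finset.mul_sum, inv_mul_cancel₀ hpos.ne']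
  · have : 0 ≤ (Real.sqrt (∑ k, c k ^ 2))⁻¹ * c 0 := by positivity
    simp only [Pi.smul_apply, smul_eq_mul]
    linarith

/-- For `c` with positive first coordinate, the element of `Spin(n+1)` which rotates `e₀` to the
direction of `c`. -/
def tiltDir {n : ℕ} (c : Fin (n + 1) → ℝ) : Spin (n + 1) :=
  if h : 0 < c 0 then tilt ⟨(Real.sqrt (∑ k, c k ^ 2))⁻¹ • c, normalized_mem h⟩ else 1

theorem spinMatrix_tiltDir {n : ℕ} {c : Fin (n + 1) → ℝ} (h : 0 < c 0) (k : Fin (n + 1)) :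
    spinMatrix (tiltDir c) k 0 = (Real.sqrt (∑ k, c k ^ 2))⁻¹ * c k := by
  rw [tiltDir, dif_pos h, spinMatrix_tilt]
  rfl

theorem continuousOn_tiltDir (n : ℕ) :
    ContinuousOn (tiltDir (n := n)) {c | 0 < c 0} := by
  rw [continuousOn_iff_continuous_domRestrict]
  have hpos : ∀ c : {c : Fin (n + 1) → ℝ | 0 < c 0}, 0 < ∑ k, c.1 k ^ 2 := fun c =>
    Finset.sum_pos' (fun k _ => sq_nonneg _)
      ⟨0, Finset.mem_univ _, pow_pos (show 0 < c.1 0 from c.2) 2⟩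
  have hk : ∀ k, Continuous fun c : {c : Fin (n + 1) → ℝ | 0 < c 0} => c.1 k := fun k =>
    (continuous_apply k).comp continuous_subtype_val
  have hc : Continuous fun c : {c : Fin (n + 1) → ℝ | 0 < c 0} =>
      (Real.sqrt (∑ k, c.1 k ^ 2))⁻¹ • c.1 :=
    (Continuous.inv₀ (Real.continuous_sqrt.comp (continuous_finsetSum _ fun k _ => (hk k).pow 2))
      fun c => (Real.sqrt_pos.2 (hpos c)).ne').smul continuous_subtype_val
  refine ((continuous_tilt n).comp (hc.subtype_mk fun c => normalized_mem c.2)).congr fun c => ?_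
  change _ = tiltDir c.1
  rw [tiltDir, dif_pos (show 0 < c.1 0 from c.2)]
  rfl

theorem tiltDir_single (n : ℕ) : tiltDir (Pi.single 0 1 : Fin (n + 1) → ℝ) = 1 := by
  have hs : ∑ k, (Pi.single 0 1 : Fin (n + 1) → ℝ) k ^ 2 = 1 := by simp [Pi.single_apply]
  rw [tiltDir, dif_pos (by simp)]
  simp only [hs, Real.sqrt_one, inv_one, one_smul]
  exact tilt_single _

/-! ### Square roots on the circle -/

/-- The square root of a point of the circle with argument in `(-π/2, π/2]`. -/
def circleSqrt (z : Circle) : Circle := Circle.exp (Complex.arg z / 2)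

theorem circleSqrt_sq (z : Circle) : circleSqrt z ^ 2 = z := by
  rw [circleSqrt, ← Circle.exp_nsmul, nsmul_eq_mul, Nat.cast_two, mul_div_cancel₀ _ two_ne_zero,
    Circle.exp_arg]

theorem continuousAt_circleSqrt_one : ContinuousAt circleSqrt 1 := by
  refine Circle.exp.continuous.continuousAt.comp ?_
  refine ContinuousAt.div_const ?_ 2
  exact (Complex.continuousAt_arg (by simp)).comp continuous_subtype_val.continuousAt

theorem circle_eq_or_eq_neg {z z' : Circle} (h : z ^ 2 = z' ^ 2) : z = z' ∨ z = -z' := by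
  have h1 : (z : ℂ) ^ 2 = (z' : ℂ) ^ 2 := by exact_mod_cast congrArg (fun a : Circle => (a : ℂ)) h
  exact (sq_eq_sq_iff_eq_or_eq_neg.1 h1).imp (fun h => Circle.ext h) fun h => Circle.ext h

theorem spinIncl_spinNegOne (m : ℕ) : spinIncl (spinNegOne m) = spinNegOne (m + 1) :=
  Subtype.ext (by simp [spinIncl, spinNegOne])

theorem isOpenQuotientMap_spinC (n : ℕ) :
    IsOpenQuotientMap (QuotientGroup.mk : Spin n × Circle → SpinC n) :=
  QuotientGroup.isOpenQuotientMap_mk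

/-! ### The action of `Spin^c(n)` on the adapted spin frames -/

namespace CircleOrbibundle

open ORManifold

namespace CoverAction

variable {ι : Type w} {n : ℕ} {M : Orbifold.{u} ι (n + 1)} {N : Orbifold.{u} ι n}
  {E : CircleOrbibundle M N} {S : SpinStructure.{u, v, w} M} (a : E.CoverAction S 2) {i : ι}

theorem frame_κ (z : Circle) (p : S.P i) :
    S.frame i (a.κ i z p) = E.rotFrame i (z ^ 2) (S.frame i p) :=
  E.isImage_rot_iff.1 (a.κ_frame i z p)

theorem κ_cancel {z : Circle} {p q : S.P i} (h : a.κ i z p = a.κ i z q) : p = q := by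
  have h1 := congrArg (a.κ i z⁻¹) h
  rwa [← a.κ_mul, ← a.κ_mul, inv_mul_cancel, a.κ_one, a.κ_one] at h1

/-- The action of `(s, z) ∈ Spin(n) × S¹` on spin frames. -/
def pairAct (p : S.P i) (g : Spin n × Circle) : S.P i := a.κ i g.2 (S.act i p (spinIncl g.1))

theorem pairAct_one (p : S.P i) : a.pairAct p 1 = p := by
  rw [pairAct, Prod.fst_one, Prod.snd_one, spinIncl_one, (S.principal i).act_one, a.κ_one]

theorem pairAct_mul (p : S.P i) (g g' : Spin n × Circle) :
    a.pairAct p (g * g') = a.pairAct (a.pairAct p g) g' := by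
  simp only [pairAct, Prod.fst_mul, Prod.snd_mul, spinIncl_mul, (S.principal i).act_mul,
    ← a.κ_act, ← a.κ_mul, mul_comm g.2]

theorem continuous_pairAct :
    Continuous fun b : S.P i × (Spin n × Circle) => a.pairAct b.1 b.2 := by
  have h1 := (S.principal i).continuous_act
  have h2 := (isInducing_spinIncl n).continuous
  exact (a.continuous_κ i).comp ((continuous_snd.comp continuous_snd).prodMk
    (h1.comp (continuous_fst.prodMk (h2.comp (continuous_fst.comp continuous_snd)))))

theorem frame_pairAct (p : S.P i) (g : Spin n × Circle) : (S.frame i (a.pairAct p g)).1 =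
    ((S.frame i p).1.mul (blockOne (spinMatrix g.1))).map (E.rot i (g.2 ^ 2)) := by
  rw [pairAct, frame_κ, ← spinMatrix_incl, ← S.frame_act_val]
  rfl

theorem pt_pairAct (p : S.P i) (g : Spin n × Circle) :
    (S.frame i (a.pairAct p g)).pt = E.rot i (g.2 ^ 2) (S.frame i p).pt :=
  congrArg (fun t => t.pt) (a.frame_pairAct p g)

/-- The spin frame p only serves to make s act: two orthonormal positive frames are related by a
special orthogonal matrix, here the block matrix of s, so nothing has to be computed in the Clifford
algebra. -/
theorem spinMatrix_orthogonal (p : S.P i) (s : Spin n) :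
    (spinMatrix s).transpose * spinMatrix s = 1 ∧ 0 < (spinMatrix s).det := by
  have h := (S.frame i (S.act i p (spinIncl s))).isSO
  rw [S.frame_act_val, (S.frame i p).isSO.mul_iff, spinMatrix_incl, det_blockOne] at h
  refine ⟨?_, h.2⟩
  ext k l
  have := congrFun (congrFun h.1 k.succ) l.succ
  simpa [Matrix.mul_apply, Fin.sum_univ_succ, Matrix.one_apply] using this

theorem mem_adapted_iff {p : S.P i} : p ∈ E.adapted S i ↔ E.IsAdaptedTuple i (S.frame i p).1 :=
  E.exists_isAdaptedOver_iff

theorem pairAct_mem_adapted {p : S.P i} (hp : p ∈ E.adapted S i) (g : Spin n × Circle) :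
    a.pairAct p g ∈ E.adapted S i := by
  rw [mem_adapted_iff] at hp ⊢
  obtain ⟨h1, h2⟩ := spinMatrix_orthogonal p g.1
  rw [frame_pairAct]
  exact (hp.mul_blockOne h1 h2).map_rot _

theorem mapTail_pairAct (p : S.P i) (g : Spin n × Circle) :
    (S.frame i (a.pairAct p g)).1.mapTail (E.proj i) =
      ((S.frame i p).1.mapTail (E.proj i)).mul (spinMatrix g.1) := by
  rw [frame_pairAct, E.mapTail_map_rot, TangentTuple.mapTail_mul]

/-- The pair (-1,-1) acts by κ_{-1} after -1 ∈ Spin(n+1); these agree, and their product is the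
identity. -/
theorem pairAct_eq_of_leftRel
    (ha : ∀ i (p : S.P i), a.κ i (-1) p = S.act i p (spinNegOne n))
    (p : S.P i) {g g' : Spin n × Circle}
    (h : QuotientGroup.leftRel (spinCKernel n) g g') : a.pairAct p g = a.pairAct p g' := by
  rw [QuotientGroup.leftRel_apply] at h
  have hg : g' = g * (g⁻¹ * g') := by group
  set k := g⁻¹ * g'
  rw [hg, pairAct_mul]
  rcases h with ⟨h1, h2⟩ | ⟨h1, h2⟩
  · have hk : k = 1 := Prod.ext (Subtype.ext h1) (Circle.ext h2)
    rw [hk, pairAct_one]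
  · have hk1 : spinIncl k.1 = spinNegOne n := Subtype.ext (by simp [spinIncl, spinNegOne, h1])
    have hk2 : k.2 = -1 := Circle.ext h2
    conv_rhs => rw [pairAct, hk1, hk2, ha, S.act_negOne_act_negOne]

/-- The circle acts freely on base points, so z² is determined and z is determined up to sign. The
spin bundle then gives s, or -s when the sign was changed through κ_{-1} = -1. -/
theorem pairAct_cancel
    (ha : ∀ i (p : S.P i), a.κ i (-1) p = S.act i p (spinNegOne n))
    {p : S.P i} {g g' : Spin n × Circle} (h : a.pairAct p g = a.pairAct p g') :
    (QuotientGroup.mk g : SpinC n) = QuotientGroup.mk g' := by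
  have hpt := congrArg (fun q => (S.frame i q).pt) h
  simp only [pt_pairAct] at hpt
  rw [QuotientGroup.eq]
  rcases circle_eq_or_eq_neg (E.rot_cancel hpt).symm with hz | hz
  · left
    rw [pairAct, pairAct, hz] at h
    have := spinIncl_injective n ((S.principal i).act_cancel (a.κ_cancel h))
    simp [this, hz]
  · right
    rw [pairAct, pairAct, hz, ← mul_neg_one, a.κ_mul, ha, ← (S.principal i).act_mul] at h
    have h1 := (S.principal i).act_cancel (a.κ_cancel h)
    have h2 : spinIncl (g.1⁻¹ * g'.1) = spinNegOne n := by
      have h3 : spinIncl g.1 * spinIncl (g.1⁻¹ * g'.1) = spinIncl g.1 * spinNegOne n := by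
        rw [← spinIncl_mul, mul_inv_cancel_left, h1, mul_assoc, spinNegOne_mul_self, mul_one]
      exact mul_left_cancel h3
    have h4 := congrArg (fun x : Spin (n + 1) => clRestrict n x) h2
    have h5 : clRestrict n 1 = 1 := by
      have := clRestrict_map_shift (1 : Cl n)
      rwa [map_one] at this
    simp only [spinIncl, clRestrict_map_shift, spinNegOne, map_neg, h5] at h4
    refine ⟨h4, ?_⟩
    simp [hz]

/-- The matrix in SO(n) relating the frames lifts to Spin(n) and carries p to q up to the sheet; the
sheet is corrected by -1, which lies in Spin(n) as n ≥ 1. -/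
theorem exists_spinIncl_eq (E : CircleOrbibundle M N) (hn : 0 < n) {p q : S.P i} (hp : p ∈ E.adapted S i)
    (hq : q ∈ E.adapted S i) (hpt : (S.frame i p).pt = (S.frame i q).pt) :
    ∃ s : Spin n, S.act i p (spinIncl s) = q := by
  rw [mem_adapted_iff] at hp hq
  obtain ⟨A, hA, h1, h2⟩ := hp.exists_eq_mul hq (S.frame i p).isSO (S.frame i q).isSO hpt
  obtain ⟨s, rfl⟩ := exists_spinMatrix_eq h1 h2
  obtain ⟨m, rfl⟩ : ∃ m, n = m + 1 := ⟨n - 1, by omega⟩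
  have hf : S.frame i q = S.frame i (S.act i p (spinIncl s)) :=
    Subtype.ext (by rw [S.frame_act_val, spinMatrix_incl, ← hA])
  rcases S.eq_or_eq_act_negOne hf with h | h
  · exact ⟨s, h.symm⟩
  · refine ⟨s * spinNegOne m, ?_⟩
    rw [h, spinIncl_mul, spinIncl_spinNegOne, (S.principal i).act_mul]

/-- Tilt the first vector into the vertical direction; if the projected frame is then negative,
apply a lift of `flipTwo`. -/
theorem exists_mem_adapted (E : CircleOrbibundle M N) (S : SpinStructure.{u, v, w} M)
    (hn : 0 < n) (p : S.P i) :
    ∃ s : Spin (n + 1), S.act i p s ∈ E.adapted S i := by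
  obtain ⟨m, rfl⟩ : ∃ m, n = m + 1 := ⟨n - 1, by omega⟩
  obtain ⟨c, hc, hc0, hv⟩ := E.exists_vertical_coeff (S.frame i p).isSO
  obtain ⟨s, hs⟩ := exists_spinMatrix_eq (flipTwo_transpose_mul_self m)
    (by rw [det_flipTwo]; exact one_pos)
  have h0 : (S.frame i (S.act i p (tilt ⟨c, hc, hc0⟩))).1 =
    (S.frame i p).1.mul (spinMatrix (tilt ⟨c, hc, hc0⟩)) := S.frame_act_val p _
  have h1 := E.isAdaptedTuple_or_flipTwo (S.frame i (S.act i p (tilt ⟨c, hc, hc0⟩))).isSO (by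
    rw [h0]
    have : ((S.frame i p).1.mul (spinMatrix (tilt ⟨c, hc, hc0⟩))).vec 0 =
        ∑ k, c k • (S.frame i p).1.vec k := by
      change ∑ k, spinMatrix (tilt ⟨c, hc, hc0⟩) k 0 • (S.frame i p).1.vec k = _
      exact Finset.sum_congr rfl fun k _ => by rw [spinMatrix_tilt]
    rw [this]
    exact hv)
  rcases h1 with h1 | h1
  · exact ⟨_, mem_adapted_iff.2 h1⟩
  · refine ⟨tilt ⟨c, hc, hc0⟩ * s, mem_adapted_iff.2 ?_⟩
    rwa [(S.principal i).act_mul, S.frame_act_val, hs]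

theorem exists_adapted_over (E : CircleOrbibundle M N) (S : SpinStructure.{u, v, w} M)
    (hn : 0 < n) (b : M.X i) : ∃ p ∈ E.adapted S i, (S.frame i p).pt = b := by
  obtain ⟨p, hp⟩ := (S.principal i).proj_surjective b
  obtain ⟨s, hs⟩ := exists_mem_adapted E S hn p
  exact ⟨_, hs, ((S.principal i).proj_act p s).trans hp⟩

/-- Near every point there is a continuous adapted spin frame over a local section of the circle
bundle. -/
theorem exists_adapted_section (E : CircleOrbibundle M N) (S : SpinStructure.{u, v, w} M)
    (hn : 0 < n) (x : N.X i) : ∃ U : Set (N.X i), IsOpen U ∧ x ∈ U ∧ ∃ ψ : N.X i → S.P i,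
      ContinuousOn ψ U ∧ ∀ y ∈ U, ψ y ∈ E.adapted S i ∧ E.proj i (S.frame i (ψ y)).pt = y := by
  obtain ⟨U, hU, hx, σ, τ, hσ, hproj, -⟩ := E.exists_trivialization i x
  obtain ⟨p, hp, hpt⟩ := exists_adapted_over E S hn (σ x)
  obtain ⟨U', hU', hx', r, hr, hrp, hr0⟩ := (S.principal i).exists_section p
  simp only [hpt] at hx' hr0
  rw [mem_adapted_iff] at hp
  -- Coordinates of a vertical vector in the frame of r(σ y). At y = x they are e₀ because p is
  -- adapted, so c₀ stays positive nearby, `tiltDir` is continuous there, and ψ x = p.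
  let c : N.X i → Fin (n + 1) → ℝ := fun y => E.verticalCoeff i (S.frame i (r (σ y))).1
  let ψ : N.X i → S.P i := fun y => S.act i (r (σ y)) (tiltDir (c y))
  have hc : ContinuousOn c (U ∩ σ ⁻¹' U') := (E.continuous_verticalCoeff i).comp_continuousOn
    (SOFrame.continuous_val.comp_continuousOn ((S.frame_continuous i).comp_continuousOn
      (hr.comp (hσ.continuousOn.mono Set.inter_subset_left) fun y hy => hy.2)))
  have hV : IsOpen (U ∩ σ ⁻¹' U') := hσ.continuousOn.isOpen_inter_preimage hU hU'
  have hV2 : IsOpen ((U ∩ σ ⁻¹' U') ∩ c ⁻¹' {d | 0 < d 0}) :=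
    hc.isOpen_inter_preimage hV (isOpen_lt continuous_const (continuous_apply 0))
  have hψ : ContinuousOn ψ ((U ∩ σ ⁻¹' U') ∩ c ⁻¹' {d | 0 < d 0}) :=
    (S.principal i).continuous_act.comp_continuousOn
      ((hr.comp (hσ.continuousOn.mono (Set.inter_subset_left.trans Set.inter_subset_left))
        fun y hy => hy.1.2).prodMk
      ((continuousOn_tiltDir n).comp (hc.mono Set.inter_subset_left) fun y hy => hy.2))
  -- Positivity of the projected frame is open and holds at x. Shrinking to it avoids a choice
  -- between the two vertical directions.
  let O : Set (TangentTuple n (N.X i)) :=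
    {t | IsPositiveBasis ((N.X i).orientation t.pt) t.vec}
  have hO : IsOpen O := (N.X i).orientation_open
  have hcont : Continuous fun q : S.P i => (S.frame i q).1.mapTail (E.proj i) :=
    (TangentTuple.continuous_mapTail (E.proj_smooth i)).comp
      (SOFrame.continuous_val.comp (S.frame_continuous i))
  have hcx : c x = Pi.single 0 1 := by
    simp only [c, hr0]
    exact E.verticalCoeff_of_isAdaptedTuple hp
  have hψx : ψ x = p := by
    simp only [ψ, hcx, hr0, tiltDir_single, (S.principal i).act_one]
  refine ⟨_, (hcont.comp_continuousOn hψ).isOpen_inter_preimage hV2 hO, ⟨⟨⟨hx, hx'⟩, ?_⟩, ?_⟩, ψ,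
    hψ.mono Set.inter_subset_left, fun y hy => ?_⟩
  · simp [hcx]
  · simp only [Set.mem_preimage, Function.comp_apply, hψx]
    exact hp.2.2
  · obtain ⟨⟨⟨hyU, hyU'⟩, hyc⟩, hyO⟩ := hy
    have hval : (S.frame i (ψ y)).1 =
      (S.frame i (r (σ y))).1.mul (spinMatrix (tiltDir (c y))) := S.frame_act_val _ _
    have hvec : ((S.frame i (r (σ y))).1.mul (spinMatrix (tiltDir (c y)))).vec 0 =
        (Real.sqrt (∑ k, c y k ^ 2))⁻¹ • ∑ k, c y k • (S.frame i (r (σ y))).1.vec k := by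
      change ∑ k, spinMatrix (tiltDir (c y)) k 0 • (S.frame i (r (σ y))).1.vec k = _
      rw [Finset.smul_sum]
      exact Finset.sum_congr rfl fun k _ => by rw [spinMatrix_tiltDir hyc, smul_smul]
    have hvert : mfderiv (𝓡 (n + 1)) (𝓡 n) (E.proj i) (S.frame i (ψ y)).1.pt
        ((S.frame i (ψ y)).1.vec 0) = 0 := by
      rw [hval, hvec]
      have h0 := E.mfderiv_verticalCoeff (S.frame i (r (σ y))).isSO
      change mfderiv (𝓡 (n + 1)) (𝓡 n) (E.proj i) (S.frame i (r (σ y))).1.pt _ = 0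
      rw [map_smul]
      exact (congrArg ((Real.sqrt (∑ k, c y k ^ 2))⁻¹ • ·) h0).trans (smul_zero _)
    refine ⟨mem_adapted_iff.2 ⟨hvert, ?_, hyO⟩, ?_⟩
    · exact (E.isLinearSubmersion i _).isONTuple_tail (S.frame i (ψ y)).isSO.1 hvert
    · have h1 : (S.frame i (ψ y)).pt = σ y :=
        ((S.principal i).proj_act _ _).trans (hrp _ hyU')
      rw [h1, hproj y hyU]

end CoverAction

end CircleOrbibundle

/-! ### The principal spin^c bundle of adapted spin frames over a chart -/

namespace CircleOrbibundle

open ORManifold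

namespace CoverAction

variable {ι : Type w} {n : ℕ} {M : Orbifold.{u} ι (n + 1)} {N : Orbifold.{u} ι n}
  {E : CircleOrbibundle M N} {S : SpinStructure.{u, v, w} M} (a : E.CoverAction S 2) {i : ι}
  (ha : ∀ i (p : S.P i), a.κ i (-1) p = S.act i p (spinNegOne n))

/-- The action of `Spin^c(n)` on the adapted spin frames, `p · [s, z] = κ_z (p · s)`. -/
def actC (p : E.adapted S i) (g : SpinC n) : E.adapted S i :=
  Quotient.lift (fun g : Spin n × Circle =>
      (⟨a.pairAct p.1 g, a.pairAct_mem_adapted p.2 g⟩ : E.adapted S i))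
    (fun _ _ h => Subtype.ext (a.pairAct_eq_of_leftRel ha p.1 h)) g

theorem actC_mk (p : E.adapted S i) (g : Spin n × Circle) :
    (a.actC ha p (QuotientGroup.mk g)).1 = a.pairAct p.1 g := rfl

theorem actC_one (p : E.adapted S i) : a.actC ha p 1 = p :=
  Subtype.ext (a.pairAct_one p.1)

theorem actC_mul (p : E.adapted S i) (g g' : SpinC n) :
    a.actC ha p (g * g') = a.actC ha (a.actC ha p g) g' := by
  obtain ⟨g, rfl⟩ := QuotientGroup.mk_surjective g
  obtain ⟨g', rfl⟩ := QuotientGroup.mk_surjective g'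
  exact Subtype.ext (a.pairAct_mul p.1 g g')

theorem actC_cancel {p : E.adapted S i} {g g' : SpinC n} (h : a.actC ha p g = a.actC ha p g') :
    g = g' := by
  obtain ⟨g, rfl⟩ := QuotientGroup.mk_surjective g
  obtain ⟨g', rfl⟩ := QuotientGroup.mk_surjective g'
  exact a.pairAct_cancel ha (congrArg Subtype.val h)

theorem continuous_actC :
    Continuous fun b : E.adapted S i × SpinC n => a.actC ha b.1 b.2 := by
  refine Continuous.subtype_mk (p := fun p => p ∈ E.adapted S i)
    (f := fun b : E.adapted S i × SpinC n => (a.actC ha b.1 b.2).1) ?_ _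
  rw [← (IsOpenQuotientMap.id.prodMap (isOpenQuotientMap_spinC n)).continuous_comp_iff]
  exact a.continuous_pairAct.comp
    ((continuous_subtype_val.comp continuous_fst).prodMk continuous_snd)

/-- The base point in `N` of an adapted spin frame. -/
def base (p : E.adapted S i) : N.X i := E.proj i (S.frame i p.1).pt

theorem continuous_base : Continuous (base : E.adapted S i → N.X i) :=
  (E.proj_smooth i).continuous.comp
    ((S.principal i).continuous_proj.comp continuous_subtype_val)

theorem base_actC (p : E.adapted S i) (g : SpinC n) : base (a.actC ha p g) = base p := by
  obtain ⟨g, rfl⟩ := QuotientGroup.mk_surjective g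
  rw [base, actC_mk, pt_pairAct, E.proj_rot]
  rfl

theorem pt_κ (z : Circle) (p : S.P i) :
    (S.frame i (a.κ i z p)).pt = E.rot i (z ^ 2) (S.frame i p).pt := by
  rw [frame_κ]
  rfl

theorem pt_κ_eq {p q : E.adapted S i} (h : base p = base q) {z : Circle}
    (hz : z ^ 2 = E.angle i (S.frame i p.1).pt (S.frame i q.1).pt) :
    (S.frame i (a.κ i z p.1)).pt = (S.frame i q.1).pt := by
  rw [pt_κ, hz, E.rot_angle h]

theorem κ_mem_adapted {p : S.P i} (hp : p ∈ E.adapted S i) (z : Circle) :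
    a.κ i z p ∈ E.adapted S i := by
  rw [mem_adapted_iff] at hp ⊢
  rw [frame_κ]
  exact hp.map_rot _

theorem exists_pairAct_eq (hn : 0 < n) {p q : E.adapted S i} (h : base p = base q) {z : Circle}
    (hz : z ^ 2 = E.angle i (S.frame i p.1).pt (S.frame i q.1).pt) :
    ∃ s : Spin n, S.act i (a.κ i z p.1) (spinIncl s) = q.1 :=
  exists_spinIncl_eq E hn (a.κ_mem_adapted p.2 z) q.2 (a.pt_κ_eq h hz)

theorem actC_mk_eq {p q : E.adapted S i} {s : Spin n} {z : Circle}
    (h : S.act i (a.κ i z p.1) (spinIncl s) = q.1) :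
    a.actC ha p (QuotientGroup.mk (s, z)) = q :=
  Subtype.ext ((a.κ_act i z p.1 (spinIncl s)).trans h)

theorem exists_actC_eq (hn : 0 < n) {p q : E.adapted S i} (h : base p = base q) :
    ∃ g, a.actC ha p g = q := by
  obtain ⟨s, hs⟩ := a.exists_pairAct_eq hn h (circleSqrt_sq _)
  exact ⟨_, a.actC_mk_eq ha hs⟩

open Classical in
/-- The element of `Spin^c(n)` which carries `p` to `q`. -/
def divC (p q : E.adapted S i) : SpinC n :=
  if h : ∃ g, a.actC ha p g = q then h.choose else 1

theorem actC_divC (hn : 0 < n) {p q : E.adapted S i} (h : base p = base q) :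
    a.actC ha p (a.divC ha p q) = q := by
  have h1 := a.exists_actC_eq ha hn h
  rw [divC, dif_pos h1]
  exact h1.choose_spec

/-- Locally the quotient is [s, z] with z a continuous square root of the angle between base points,
and s the translation function of the spin bundle applied to κ_z p and q. -/
theorem continuousOn_divC (hn : 0 < n) :
    ContinuousOn (fun b : E.adapted S i × E.adapted S i => a.divC ha b.1 b.2)
      {b | base b.1 = base b.2} := by
  classical
  intro b₀ hb₀
  let A : E.adapted S i × E.adapted S i → Circle := fun b =>
    E.angle i (S.frame i b.1.1).pt (S.frame i b.2.1).pt
  -- A branch of the square root adapted to b₀: the second factor is evaluated at 1 when b = b₀,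
  -- where `circleSqrt` is continuous.
  let Z : E.adapted S i × E.adapted S i → Circle := fun b =>
    circleSqrt (A b₀) * circleSqrt (A b * (A b₀)⁻¹)
  have hZ : ∀ b, Z b ^ 2 = A b := fun b => by
    rw [mul_pow, circleSqrt_sq, circleSqrt_sq, mul_comm, inv_mul_cancel_right]
  let s : E.adapted S i × E.adapted S i → Spin n := fun b =>
    if h : ∃ s : Spin n, S.act i (a.κ i (Z b) b.1.1) (spinIncl s) = b.2.1 then h.choose else 1
  have hs : ∀ b ∈ {b : E.adapted S i × E.adapted S i | base b.1 = base b.2},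
      S.act i (a.κ i (Z b) b.1.1) (spinIncl (s b)) = b.2.1 := fun b hb => by
    have h := a.exists_pairAct_eq hn hb (hZ b)
    simp only [s, dif_pos h]
    exact h.choose_spec
  have hpt : Continuous fun p : E.adapted S i => (S.frame i p.1).pt :=
    (S.principal i).continuous_proj.comp continuous_subtype_val
  have hA : ContinuousWithinAt A {b | base b.1 = base b.2} b₀ :=
    (E.continuousOn_angle i).comp (f := fun b : E.adapted S i × E.adapted S i =>
        ((S.frame i b.1.1).pt, (S.frame i b.2.1).pt))
      ((hpt.comp continuous_fst).prodMk (hpt.comp continuous_snd)).continuousOn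
      (fun b hb => hb) b₀ hb₀
  have hZc : ContinuousWithinAt Z {b | base b.1 = base b.2} b₀ := by
    have h1 : ContinuousWithinAt (fun b => A b * (A b₀)⁻¹) {b | base b.1 = base b.2} b₀ :=
      hA.mul continuousWithinAt_const
    have h2 : ContinuousAt circleSqrt (A b₀ * (A b₀)⁻¹) := by
      rw [mul_inv_cancel]
      exact continuousAt_circleSqrt_one
    exact continuousWithinAt_const.mul
      (ContinuousAt.comp_continuousWithinAt (f := fun b => A b * (A b₀)⁻¹) h2 h1)
  have hsc : ContinuousWithinAt s {b | base b.1 = base b.2} b₀ := by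
    rw [(isInducing_spinIncl n).continuousWithinAt_iff]
    have h1 : ContinuousWithinAt (fun b : E.adapted S i × E.adapted S i =>
        (a.κ i (Z b) b.1.1, b.2.1)) {b | base b.1 = base b.2} b₀ :=
      ((a.continuous_κ i).continuousAt.comp_continuousWithinAt
        (hZc.prodMk (continuous_subtype_val.comp continuous_fst).continuousWithinAt)).prodMk
        (continuous_subtype_val.comp continuous_snd).continuousWithinAt
    refine (((S.principal i).continuousOn_div _ (a.pt_κ_eq hb₀ (hZ b₀))).comp h1
      fun b hb => a.pt_κ_eq hb (hZ b)).congr (fun b hb => ?_) ?_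
    · exact (S.principal i).act_cancel ((hs b hb).trans
        ((S.principal i).act_div (a.pt_κ_eq hb (hZ b))).symm)
    · exact (S.principal i).act_cancel ((hs b₀ hb₀).trans
        ((S.principal i).act_div (a.pt_κ_eq hb₀ (hZ b₀))).symm)
  -- The class [s, z] does not depend on the branch, by freeness of the action, so continuity at
  -- each b₀ may use its own branch.
  have heq : ∀ b ∈ {b : E.adapted S i × E.adapted S i | base b.1 = base b.2},
      a.divC ha b.1 b.2 = QuotientGroup.mk (s b, Z b) := fun b hb =>
    a.actC_cancel ha ((a.actC_divC ha hn hb).trans (a.actC_mk_eq ha (hs b hb)).symm)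
  exact ((isOpenQuotientMap_spinC n).continuous.continuousAt.comp_continuousWithinAt
    (hsc.prodMk hZc)).congr heq (heq b₀ hb₀)

theorem isPrincipalBundle_actC (hn : 0 < n) :
    IsPrincipalBundle (base : E.adapted S i → N.X i) (a.actC ha) := by
  classical
  refine .of_sections continuous_base (a.continuous_actC ha) (a.actC_one ha) (a.actC_mul ha)
    (a.base_actC ha) (fun p g g' => a.actC_cancel ha) (a.divC ha) (a.continuousOn_divC ha hn)
    (fun p q => a.actC_divC ha hn) fun x => ?_
  obtain ⟨U, hU, hx, ψ, hψ, h⟩ := exists_adapted_section E S hn x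
  refine ⟨U, hU, hx, fun y => if hy : ψ y ∈ E.adapted S i then ⟨ψ y, hy⟩ else
    ⟨ψ x, (h x hx).1⟩, ?_, fun y hy => ?_⟩
  · rw [Topology.IsInducing.subtypeVal.continuousOn_iff]
    refine hψ.congr fun y hy => ?_
    simp only [Function.comp_apply, dif_pos (h y hy).1]
  · simp only [dif_pos (h y hy).1]
    exact (h y hy).2

/-! ### The map to the frames of `N` -/

/-- The frame of `N` onto which an adapted frame projects. -/
def frameN (p : E.adapted S i) : (N.X i).SOFrame :=
  ⟨(S.frame i p.1).1.mapTail (E.proj i), (mem_adapted_iff.1 p.2).2⟩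

theorem continuous_frameN : Continuous (frameN : E.adapted S i → (N.X i).SOFrame) :=
  SOFrame.continuous_iff.2 ((TangentTuple.continuous_mapTail (E.proj_smooth i)).comp
    (SOFrame.continuous_val.comp ((S.frame_continuous i).comp continuous_subtype_val)))

theorem isRightMul_frameN (p : E.adapted S i) (g : SpinC n) :
    (frameN p).IsRightMul (spinCMatrix g) (frameN (a.actC ha p g)) := by
  obtain ⟨g, rfl⟩ := QuotientGroup.mk_surjective g
  exact SOFrame.isRightMul_iff.2 (a.mapTail_pairAct p.1 g)

theorem isAdaptedOver_frameN (p : E.adapted S i) :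
    SOFrame.IsAdaptedOver (E.proj i) (S.frame i p.1) (frameN p) :=
  SOFrame.isAdaptedOver_iff.2 ⟨(mem_adapted_iff.1 p.2).1, rfl⟩

end CoverAction

/-! ### The changes of charts -/

section Lift

variable {ι : Type w} {n : ℕ} {M : Orbifold.{u} ι (n + 1)} {N : Orbifold.{u} ι n}
  {E : CircleOrbibundle M N} {S : SpinStructure.{u, v, w} M} {i j l : ι}

open CoverAction

/-- `k` is the change of charts of `M` which lifts the change of charts `h` of `N`. -/
structure IsTransLift (E : CircleOrbibundle M N) (h : OpenPartialHomeomorph (N.X i) (N.X j))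
    (k : OpenPartialHomeomorph (M.X i) (M.X j)) : Prop where
  mem : h ∈ N.trans i j
  mem_lift : k ∈ M.trans i j
  covers : CoversEquivariantly (E.proj i) (E.proj j) (E.rot i) (E.rot j) k h

theorem IsTransLift.mem_source {h : OpenPartialHomeomorph (N.X i) (N.X j)}
    {k : OpenPartialHomeomorph (M.X i) (M.X j)} (hk : E.IsTransLift h k) {b : M.X i} :
    b ∈ k.source ↔ E.proj i b ∈ h.source := by
  rw [hk.covers.source_eq, Set.mem_preimage]

/-- The uniqueness of lifts to M gives equality at a single point over which the germs on N agree;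
agreement of germs is an open condition, so equality holds nearby too. -/
theorem IsTransLift.eventuallyEq {h h' : OpenPartialHomeomorph (N.X i) (N.X j)}
    {k k' : OpenPartialHomeomorph (M.X i) (M.X j)} (hk : E.IsTransLift h k)
    (hk' : E.IsTransLift h' k') {b : M.X i} (hb : E.proj i b ∈ h.source)
    (hb' : E.proj i b ∈ h'.source) (hh : h =ᶠ[𝓝 (E.proj i b)] h') : k =ᶠ[𝓝 b] k' := by
  have hc := (E.proj_smooth i).continuous.continuousAt (x := b)
  filter_upwards [hc.eventually (h.open_source.mem_nhds hb),
    hc.eventually (h'.open_source.mem_nhds hb'), hc.eventually hh.eventually_nhds] with c h1 h2 h3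
  exact E.trans_unique i j h hk.mem h' hk'.mem k hk.mem_lift k' hk'.mem_lift hk.covers hk'.covers c
    h1 h2 h3

/-- Equal germs below give equal germs on M, and lifts to spin frames depend only on germs. With h =
h' this frees `liftN` from its choice of lift. -/
theorem IsTransLift.lift_eq {h h' : OpenPartialHomeomorph (N.X i) (N.X j)}
    {k k' : OpenPartialHomeomorph (M.X i) (M.X j)} (hk : E.IsTransLift h k)
    (hk' : E.IsTransLift h' k') {p : S.P i} (hb : E.proj i (S.frame i p).pt ∈ h.source)
    (hb' : E.proj i (S.frame i p).pt ∈ h'.source) (hh : h =ᶠ[𝓝 (E.proj i (S.frame i p).pt)] h') :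
    S.lift k p = S.lift k' p :=
  S.lift_germ i j k hk.mem_lift k' hk'.mem_lift p (hk.mem_source.2 hb) (hk'.mem_source.2 hb')
    (hk.eventuallyEq hk' hb hb' hh)

theorem IsTransLift.trans {h : OpenPartialHomeomorph (N.X i) (N.X j)}
    {k : OpenPartialHomeomorph (M.X i) (M.X j)} {h' : OpenPartialHomeomorph (N.X j) (N.X l)}
    {k' : OpenPartialHomeomorph (M.X j) (M.X l)} (hk : E.IsTransLift h k)
    (hk' : E.IsTransLift h' k') : E.IsTransLift (h.trans h') (k.trans k') where
  mem := N.trans_comp i j l h hk.mem h' hk'.mem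
  mem_lift := M.trans_comp i j l k hk.mem_lift k' hk'.mem_lift
  covers :=
    { source_eq := by
        ext b
        simp only [OpenPartialHomeomorph.trans_source, Set.mem_inter_iff, Set.mem_preimage]
        refine (and_congr_left' hk.mem_source).trans (and_congr_right fun hb => ?_)
        rw [hk'.mem_source, hk.covers.covers b (hk.mem_source.2 hb)]
      covers := fun b hb => by
        rw [OpenPartialHomeomorph.trans_source] at hb
        simp only [OpenPartialHomeomorph.coe_trans, Function.comp_apply]
        rw [hk'.covers.covers _ hb.2, hk.covers.covers _ hb.1]
      equivariant := fun b hb z => by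
        rw [OpenPartialHomeomorph.trans_source] at hb
        simp only [OpenPartialHomeomorph.coe_trans, Function.comp_apply]
        rw [hk.covers.equivariant _ hb.1, hk'.covers.equivariant _ hb.2] }

theorem frame_lift_val {k : OpenPartialHomeomorph (M.X i) (M.X j)} (hk : k ∈ M.trans i j)
    {p : S.P i} (hp : (S.frame i p).pt ∈ k.source) :
    (S.frame j (S.lift k p)).1 = (S.frame i p).1.map k :=
  SOFrame.isImage_iff.1 (S.lift_frame i j k hk p hp)

theorem IsTransLift.lift_mem_adapted {h : OpenPartialHomeomorph (N.X i) (N.X j)}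
    {k : OpenPartialHomeomorph (M.X i) (M.X j)} (hk : E.IsTransLift h k) (p : E.adapted S i)
    (hp : base p ∈ h.source) : S.lift k p.1 ∈ E.adapted S j := by
  have hb := hk.mem_source.2 hp
  rw [mem_adapted_iff, frame_lift_val hk.mem_lift hb]
  exact (IsAdaptedTuple.map_trans hk.mem hk.mem_lift hk.covers (mem_adapted_iff.1 p.2) hb).2

theorem IsTransLift.mapTail_lift {h : OpenPartialHomeomorph (N.X i) (N.X j)}
    {k : OpenPartialHomeomorph (M.X i) (M.X j)} (hk : E.IsTransLift h k) (p : E.adapted S i)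
    (hp : base p ∈ h.source) :
    (S.frame j (S.lift k p.1)).1.mapTail (E.proj j) = (frameN p).1.map h := by
  have hb := hk.mem_source.2 hp
  rw [frame_lift_val hk.mem_lift hb]
  exact (IsAdaptedTuple.map_trans hk.mem hk.mem_lift hk.covers (mem_adapted_iff.1 p.2) hb).1

/-- Provides the irrelevant value of `liftN` outside the domain of h. -/
theorem nonempty_adapted (E : CircleOrbibundle M N) (S : SpinStructure.{u, v, w} M) (hn : 0 < n)
    (i : ι) : Nonempty (E.adapted S i) := by
  have := M.X_connected i
  obtain ⟨b⟩ := (inferInstance : Nonempty (M.X i))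
  obtain ⟨p, hp, -⟩ := exists_adapted_over E S hn b
  exact ⟨⟨p, hp⟩⟩

open Classical in
/-- The lift of a change of charts `h` of `N` to the adapted spin frames. -/
def liftN (hn : 0 < n) (h : OpenPartialHomeomorph (N.X i) (N.X j)) (p : E.adapted S i) :
    E.adapted S j :=
  if H : (∃ k, E.IsTransLift h k) ∧ base p ∈ h.source then
    ⟨S.lift H.1.choose p.1, H.1.choose_spec.lift_mem_adapted p H.2⟩
  else (nonempty_adapted E S hn j).some

theorem liftN_val (hn : 0 < n) {h : OpenPartialHomeomorph (N.X i) (N.X j)}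
    {k : OpenPartialHomeomorph (M.X i) (M.X j)} (hk : E.IsTransLift h k) (p : E.adapted S i)
    (hp : base p ∈ h.source) : (liftN hn h p).1 = S.lift k p.1 := by
  have H : (∃ k, E.IsTransLift h k) ∧ base p ∈ h.source := ⟨⟨k, hk⟩, hp⟩
  rw [liftN, dif_pos H]
  exact H.1.choose_spec.lift_eq hk hp hp Filter.EventuallyEq.rfl

theorem exists_isTransLift (E : CircleOrbibundle M N) {h : OpenPartialHomeomorph (N.X i) (N.X j)}
    (hh : h ∈ N.trans i j) : ∃ k, E.IsTransLift h k := by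
  obtain ⟨k, hk, hc⟩ := E.trans_lift i j h hh
  exact ⟨k, hh, hk, hc⟩

theorem isImage_liftN (hn : 0 < n) {h : OpenPartialHomeomorph (N.X i) (N.X j)}
    (hh : h ∈ N.trans i j) (p : E.adapted S i) (hp : base p ∈ h.source) :
    (frameN p).IsImage h (frameN (liftN hn h p)) := by
  obtain ⟨k, hk⟩ := E.exists_isTransLift hh
  refine SOFrame.isImage_iff.2 ((congrArg
    (fun q => (S.frame j q).1.mapTail (E.proj j)) (liftN_val hn hk p hp)).trans ?_)
  exact hk.mapTail_lift p hp

theorem base_liftN (hn : 0 < n) {h : OpenPartialHomeomorph (N.X i) (N.X j)}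
    (hh : h ∈ N.trans i j) (p : E.adapted S i) (hp : base p ∈ h.source) :
    base (liftN hn h p) = h (base p) :=
  (isImage_liftN hn hh p hp).1

end Lift

/-- The spin^c structure on `N` given by the adapted spin frames. -/
def CoverAction.spinC {ι : Type w} {n : ℕ} {M : Orbifold.{u} ι (n + 1)} {N : Orbifold.{u} ι n}
    {E : CircleOrbibundle M N} {S : SpinStructure.{u, v, w} M} (a : E.CoverAction S 2)
    (ha : ∀ i (p : S.P i), a.κ i (-1) p = S.act i p (spinNegOne n)) (hn : 0 < n) :
    SpinCStructure.{u, v, w} N where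
  P i := E.adapted S i
  frame i := CoverAction.frameN
  frame_continuous i := CoverAction.continuous_frameN
  act i := a.actC ha
  principal i := a.isPrincipalBundle_actC ha hn
  frame_act i := a.isRightMul_frameN ha
  lift h := liftN hn h
  lift_continuous i j h hh := by
    obtain ⟨k, hk⟩ := E.exists_isTransLift hh
    rw [Topology.IsInducing.subtypeVal.continuousOn_iff]
    exact ((S.lift_continuous i j k hk.mem_lift).comp continuous_subtype_val.continuousOn
      fun p hp => hk.mem_source.2 hp).congr fun p hp => liftN_val hn hk p hp
  lift_frame i j h hh p hp := isImage_liftN hn hh p hp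
  lift_act i j h hh p hp g := by
    obtain ⟨k, hk⟩ := E.exists_isTransLift hh
    obtain ⟨g, rfl⟩ := QuotientGroup.mk_surjective g
    have hp' : CoverAction.base p ∈ h.source := hp
    have hb := hk.mem_source.2 hp'
    refine Subtype.ext ?_
    -- The lift of k commutes with Spin(n+1), being a bundle map, and with κ by `κ_lift`, applied at
    -- p·s, which has the same base point as p.
    rw [liftN_val hn hk _ (by rwa [a.base_actC]), a.actC_mk, a.actC_mk, liftN_val hn hk p hp',
      CoverAction.pairAct, CoverAction.pairAct, ← S.lift_act i j k hk.mem_lift _ hb]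
    refine (a.κ_lift i j k hk.mem_lift _ ?_ _).symm
    rwa [(S.principal i).proj_act p.1 (spinIncl g.1)]
  lift_comp i j l h hh h' hh' p hp := by
    obtain ⟨k, hk⟩ := E.exists_isTransLift hh
    obtain ⟨k', hk'⟩ := E.exists_isTransLift hh'
    have hp0 : CoverAction.base p ∈ (h.trans h').source := hp
    have hp1 : CoverAction.base p ∈ h.source ∧ h (CoverAction.base p) ∈ h'.source := by
      rwa [OpenPartialHomeomorph.trans_source] at hp0
    have hp2 : CoverAction.base (liftN hn h p) ∈ h'.source := by
      rw [base_liftN hn hh p hp1.1]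
      exact hp1.2
    refine Subtype.ext ?_
    rw [liftN_val hn (hk.trans hk') p hp0, liftN_val hn hk' _ hp2, liftN_val hn hk p hp1.1]
    exact S.lift_comp i j l k hk.mem_lift k' hk'.mem_lift p.1 ((hk.trans hk').mem_source.2 hp0)
  lift_germ i j h hh h' hh' p hp hp' heq := by
    obtain ⟨k, hk⟩ := E.exists_isTransLift hh
    obtain ⟨k', hk'⟩ := E.exists_isTransLift hh'
    refine Subtype.ext ?_
    rw [liftN_val hn hk p hp, liftN_val hn hk' p hp']
    exact hk.lift_eq hk' hp hp' heq

end CircleOrbibundle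

end

theorem lemma3p7 {ι : Type w} {n : ℕ} (hn : 0 < n)
    (M : Orbifold.{u} ι (n + 1)) (N : Orbifold.{u} ι n) [ConnectedSpace N.space]
    (E : CircleOrbibundle M N) (S : SpinStructure.{u, v, w} M) (hS : ¬ E.IsProjectable S) :
    ∃ a : E.CoverAction S 2,
      (∀ i (p : S.P i), a.κ i (-1) p = S.act i p (spinNegOne n)) ∧
      ∃ (T : SpinCStructure.{u, v, w} N) (Φ : ∀ i, T.P i → S.P i), E.Induces S a T Φ := by
  obtain ⟨a, ha⟩ := E.exists_coverAction_two S hS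
  refine ⟨a, ha, a.spinC ha hn, fun i => Subtype.val, ?_⟩
  exact
    { embedding := fun i => Topology.IsEmbedding.subtypeVal
      range_eq := fun i => Subtype.range_coe
      frame_eq := fun i p => CircleOrbibundle.CoverAction.isAdaptedOver_frameN p
      act_eq := fun i p s z => rfl
      lift_eq := fun i j h hh k hk hc p hp =>
        CircleOrbibundle.liftN_val hn ⟨hh, hk, hc⟩ p hp }
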